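/- **Proposition (semiclassical Sigal–Soffer propagation estimate).** Write $\langle x\rangle=(1+x^2)^{1/2}$. Let $\hbar_0>0$, and for $\hbar\in(0,\hbar_0]$ let $H=H(\hbar)$ and $A=A(\hbar)$ be (possibly unbounded) self-adjoint operators on a complex Hilbert space, whose domains do not depend on $\hbar$. Define iterated commutators by $\mathrm{ad}_A^0(B)=B$ and $\mathrm{ad}_A^{k}(B)=[\mathrm{ad}_A^{k-1}(B),A]$ for $k\ge 1$. Assume that for every $k\ge 0$ and every smooth compactly supported function $g:\mathbb R\to\mathbb C$ the form $\mathrm{ad}_A^k(g(H))$ extends to a bounded operator with $$\|\mathrm{ad}_A^k(g(H))\|\le C(k,g)\,\hbar^k\qquad\text{for all }\hbar\in(0,\hbar_0],$$ where $C(k,g)$ does not depend on $\hbar$. Let $I\subset\mathbb R$ be a compact interval and $\theta>0$, both independent of $\hbar$, such that for all $\hbar\in(0,\hbar_0]$ the Mourre bound $$\chi_I(H)\,\tfrac{i}{\hbar}[H,A]\,\chi_I(H)\ \ge\ \theta\,\hbar\,\chi_I(H)$$ holds in the sense of quadratic forms, that is, $\tfrac{i}{\hbar}\big(\langle H\psi,A\psi\rangle-\langle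 A\psi,H\psi\rangle\big)\ge\theta\hbar\|\psi\|^2$ for all $\psi\in D(A)$ in the range of $\chi_I(H)$ (inner product linear in the second argument). Let $g_I:\mathbb R\to\mathbb C$ be smooth with support in $I$, and let $\alpha\ge 0$. Then there are $\hbar_1\in(0,\hbar_0]$ and $C<\infty$, depending only on $\alpha$, $\theta$, $g_I$, $I$, on $\hbar_0$ and on the constants $C(k,g)$ (and not otherwise on the Hilbert space, $H$ or $A$), such that $$\big\|\langle A\rangle^{-\alpha}e^{-itH/\hbar}g_I(H)\langle A\rangle^{-\alpha}f\big\|\le C\,\langle\hbar t\rangle^{-\alpha}\,\|f\|$$ for all $\hbar\in(0,\hbar_1]$, all $t\in\mathbb R$ and all vectors $f$. -/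

import Mathlib

open scoped ContDiff InnerProductSpace Topology
open Set Filter

noncomputable section

namespace SigalSoffer

/-- The Japanese bracket `⟨x⟩ = (1 + x²)^{1/2}`. -/
def bracket (x : ℝ) : ℝ := Real.sqrt (1 + x ^ 2)

/-- Bounded Borel functions. -/
def BddBorel {X : Type*} [MeasurableSpace X] (f : X → ℂ) : Prop :=
  Measurable f ∧ ∃ C : ℝ, ∀ x, ‖f x‖ ≤ C

/-- `Φ` is a unital `*`-homomorphism from the bounded Borel functions on `X` to the bounded
operators on `E`, contractive for the sup norm and strongly continuous under bounded pointwise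
convergence. -/
structure IsBorelHom {E : Type*} [NormedAddCommGroup E] [InnerProductSpace ℂ E] [CompleteSpace E]
    {X : Type*} [MeasurableSpace X] (Φ : (X → ℂ) → E →L[ℂ] E) : Prop where
  map_one : Φ (fun _ => 1) = 1
  map_add : ∀ f g, BddBorel f → BddBorel g → Φ (fun x => f x + g x) = Φ f + Φ g
  map_smul : ∀ (c : ℂ) (f), BddBorel f → Φ (fun x => c * f x) = c • Φ f
  map_mul : ∀ f g, BddBorel f → BddBorel g → Φ (fun x => f x * g x) = Φ f * Φ g
  map_star : ∀ f, BddBorel f → Φ (fun x => star (f x)) = star (Φ f)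
  norm_le : ∀ f, BddBorel f → ∀ C : ℝ, 0 ≤ C → (∀ x, ‖f x‖ ≤ C) → ‖Φ f‖ ≤ C
  tendsto_of_bounded : ∀ (F : ℕ → X → ℂ) (f : X → ℂ) (C : ℝ),
    (∀ n, Measurable (F n)) → (∀ n x, ‖F n x‖ ≤ C) →
    (∀ x, Tendsto (fun n => F n x) atTop (𝓝 (f x))) →
    ∀ u : E, Tendsto (fun n => Φ (F n) u) atTop (𝓝 (Φ f u))

/-- `Φ` is the bounded Borel functional calculus `f ↦ f(H)` of the (possibly unbounded)
self-adjoint operator `H`: moreover it sends bounded approximations of the identity function to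
strong approximations of `H` on its domain. This determines `Φ` on all bounded Borel functions. -/
structure IsBorelCalculus {E : Type*} [NormedAddCommGroup E] [InnerProductSpace ℂ E]
    [CompleteSpace E] (H : E →ₗ.[ℂ] E) (Φ : (ℝ → ℂ) → E →L[ℂ] E) : Prop extends
    IsBorelHom Φ where
  tendsto_id : ∀ F : ℕ → ℝ → ℂ, (∀ n, BddBorel (F n)) → (∀ n x, ‖F n x‖ ≤ |x|) →
    (∀ x : ℝ, Tendsto (fun n => F n x) atTop (𝓝 (x : ℂ))) →
    ∀ u : H.domain, Tendsto (fun n => Φ (F n) (u : E)) atTop (𝓝 (H u))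

section Spectral
set_option linter.unusedSectionVars false
open MeasureTheory CompactlySupported

variable {E : Type*} [NormedAddCommGroup E] [InnerProductSpace ℂ E] [CompleteSpace E]
variable {X : Type*} [MetricSpace X] [CompactSpace X] [MeasurableSpace X] [BorelSpace X]

/-- A continuous real function as a continuous complex function. -/
def cplx (f : X → ℝ) (hf : Continuous f) : C(X, ℂ) :=
  ⟨fun x => (f x : ℂ), Complex.continuous_ofReal.comp hf⟩

theorem inner_star_mul (π : C(X, ℂ) →⋆ₐ[ℂ] (E →L[ℂ] E)) (g : C(X, ℂ)) (u : E) :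
    (⟪u, π (star g * g) u⟫_ℂ).re = ‖π g u‖ ^ 2 := by
  rw [map_mul, map_star, mul_apply_eq_comp, ContinuousLinearMap.star_eq_adjoint,
    ContinuousLinearMap.adjoint_inner_right]
  exact inner_self_eq_norm_sq (𝕜 := ℂ) _

theorem exists_measure (π : C(X, ℂ) →⋆ₐ[ℂ] (E →L[ℂ] E)) (u : E) :
    ∃ μ : Measure X, IsFiniteMeasure μ ∧ ∀ g : C(X, ℂ), ‖π g u‖ₑ = eLpNorm g 2 μ := by
  let L : C_c(X, ℝ) →ₗ[ℝ] ℝ :=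
    { toFun := fun f => (⟪u, π (cplx f f.continuous) u⟫_ℂ).re
      map_add' := by
        intro f g
        have : cplx (⇑(f + g)) (f + g).continuous = cplx f f.continuous + cplx g g.continuous := by
          ext x; simp [cplx]
        rw [this]; simp
      map_smul' := by
        intro c f
        have : cplx (⇑(c • f)) (c • f).continuous = (c : ℂ) • cplx f f.continuous := by
          ext x; simp [cplx]
        rw [this, map_smul]; simp }
  have hL : ∀ f : C_c(X, ℝ), 0 ≤ f → 0 ≤ L f := by
    intro f hf
    have hs : Continuous fun x => Real.sqrt (f x) := Real.continuous_sqrt.comp f.continuous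
    have : cplx f f.continuous = star (cplx _ hs) * cplx _ hs := by
      ext x
      simp only [cplx, ContinuousMap.coe_mk, ContinuousMap.mul_apply, ContinuousMap.star_apply,
        RCLike.star_def, Complex.conj_ofReal, ← Complex.ofReal_mul]
      rw [Real.mul_self_sqrt (hf x)]
    change 0 ≤ (⟪u, π (cplx f f.continuous) u⟫_ℂ).re
    rw [this, inner_star_mul]
    positivity
  let Λ : C_c(X, ℝ) →ₚ[ℝ] ℝ := PositiveLinearMap.mk₀ L hL
  refine ⟨RealRMK.rieszMeasure Λ, inferInstance, fun g => ?_⟩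
  have hc : Continuous fun x => ‖g x‖ ^ 2 := by fun_prop
  let f : C_c(X, ℝ) := ⟨⟨_, hc⟩, HasCompactSupport.of_compactSpace _⟩
  have h1 : ∫ x, f x ∂(RealRMK.rieszMeasure Λ) = Λ f := RealRMK.integral_rieszMeasure Λ f
  have h2 : Λ f = ‖π g u‖ ^ 2 := by
    rw [← inner_star_mul]
    have : star g * g = cplx f f.continuous := by
      ext x
      simp [cplx, f, Complex.conj_mul']
    rw [this]; rfl
  have h3 : MemLp g 2 (RealRMK.rieszMeasure Λ) := by
    obtain ⟨C, hC⟩ := isCompact_univ.exists_bound_of_continuousOn g.continuous.continuousOn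
    exact MemLp.of_bound g.continuous.aestronglyMeasurable C (ae_of_all _ fun x => hC x trivial)
  rw [h3.eLpNorm_eq_integral_rpow_norm (by simp) (by simp)]
  have h4 : ∫ x, ‖g x‖ ^ (2 : ENNReal).toReal ∂(RealRMK.rieszMeasure Λ) = ‖π g u‖ ^ 2 := by
    rw [← h2, ← h1]
    simp [f]
  rw [h4, ← ofReal_norm]
  congr 1
  rw [← Real.rpow_natCast, ← Real.rpow_mul (norm_nonneg _)]
  simp

theorem BddBorel.memLp {f : X → ℂ} (hf : BddBorel f) (μ : Measure X) [IsFiniteMeasure μ] :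
    MemLp f 2 μ := by
  obtain ⟨C, hC⟩ := hf.2
  exact MemLp.of_bound hf.1.aestronglyMeasurable C (ae_of_all _ hC)

theorem exists_approx {f : X → ℂ} (hf : BddBorel f) (μ : Measure X) [IsFiniteMeasure μ] :
    ∃ g : ℕ → C(X, ℂ), Tendsto (fun n => eLpNorm (⇑(g n) - f) 2 μ) atTop (𝓝 0) := by
  have h : ∀ n : ℕ, ∃ g : C(X, ℂ), eLpNorm (⇑g - f) 2 μ ≤ ((n : ENNReal) + 1)⁻¹ := by
    intro n
    obtain ⟨g, hg, -⟩ := (hf.memLp μ).exists_boundedContinuous_eLpNorm_sub_le (by simp)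
      (ε := ((n : ENNReal) + 1)⁻¹) (by simp)
    refine ⟨g.toContinuousMap, ?_⟩
    rw [eLpNorm_sub_comm]
    exact hg
  choose g hg using h
  refine ⟨g, tendsto_of_tendsto_of_tendsto_of_le_of_le tendsto_const_nhds ?_
    (fun n => bot_le) hg⟩
  have := (tendsto_add_atTop_iff_nat (f := fun n : ℕ => ((n : ENNReal))⁻¹) 1).2
    ENNReal.tendsto_inv_nat_nhds_zero
  simpa using this

theorem exists_extension (L : C(X, ℂ) →ₗ[ℂ] E) (μ : Measure X) [IsFiniteMeasure μ]
    (hL : ∀ g, ‖L g‖ₑ = eLpNorm g 2 μ) :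
    ∃ Ψ : (X → ℂ) → E, ∀ f, BddBorel f → ‖Ψ f‖ₑ = eLpNorm f 2 μ ∧
      ∀ g : ℕ → C(X, ℂ), Tendsto (fun n => eLpNorm (⇑(g n) - f) 2 μ) atTop (𝓝 0) →
        Tendsto (fun n => L (g n)) atTop (𝓝 (Ψ f)) := by
  classical
  let e : C(X, ℂ) →L[ℂ] Lp ℂ 2 μ := ContinuousMap.toLp 2 μ ℂ
  have he : ∀ g, ‖L g‖ = ‖e g‖ := by
    intro g
    have : ‖L g‖ₑ = ‖e g‖ₑ := by
      rw [hL, Lp.enorm_def]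
      exact (eLpNorm_congr_ae (ContinuousMap.coeFn_toLp μ g)).symm
    simpa [← toReal_enorm] using congrArg ENNReal.toReal this
  have hd : DenseRange (e : C(X, ℂ) →ₗ[ℂ] Lp ℂ 2 μ) :=
    ContinuousMap.toLp_denseRange ℂ μ ℂ (by simp)
  let U : Lp ℂ 2 μ →L[ℂ] E := L.extendOfNorm (e : C(X, ℂ) →ₗ[ℂ] Lp ℂ 2 μ)
  have hU : ∀ g, U (e g) = L g := fun g =>
    LinearMap.extendOfNorm_eq hd ⟨1, fun g => by simpa using (he g).le⟩ g
  have hUn : ∀ v, ‖U v‖ = ‖v‖ := by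
    intro v
    refine hd.induction_on v (isClosed_eq (by fun_prop) (by fun_prop)) ?_
    intro g
    change ‖U (e g)‖ = ‖e g‖
    rw [hU, he]
  refine ⟨fun f => if h : MemLp f 2 μ then U (h.toLp f) else 0, fun f hf => ?_⟩
  have hm := hf.memLp μ
  simp only [hm, dif_pos]
  constructor
  · rw [← ofReal_norm, hUn, ofReal_norm, Lp.enorm_toLp]
  · intro g hg
    have := (U.continuous.tendsto (hm.toLp f)).comp
      ((Lp.tendsto_Lp_iff_tendsto_eLpNorm (fun n => e (g n)) f hm).2 (by
        refine hg.congr fun n => ?_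
        refine eLpNorm_congr_ae ?_
        filter_upwards [ContinuousMap.coeFn_toLp (p := 2) (𝕜 := ℂ) μ (g n)] with x hx
        change (g n) x - f x = (e (g n)) x - f x
        rw [hx]))
    refine this.congr fun n => ?_
    exact hU (g n)

theorem BddBorel.add {f g : X → ℂ} (hf : BddBorel f) (hg : BddBorel g) :
    BddBorel fun x => f x + g x := by
  obtain ⟨C, hC⟩ := hf.2
  obtain ⟨D, hD⟩ := hg.2
  exact ⟨hf.1.add hg.1, C + D, fun x => (norm_add_le _ _).trans (add_le_add (hC x) (hD x))⟩

theorem BddBorel.mul {f g : X → ℂ} (hf : BddBorel f) (hg : BddBorel g) :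
    BddBorel fun x => f x * g x := by
  obtain ⟨C, hC⟩ := hf.2
  obtain ⟨D, hD⟩ := hg.2
  refine ⟨hf.1.mul hg.1, C * D, fun x => ?_⟩
  rw [norm_mul]
  exact mul_le_mul (hC x) (hD x) (norm_nonneg _) ((norm_nonneg _).trans (hC x))

theorem BddBorel.const_mul (c : ℂ) {f : X → ℂ} (hf : BddBorel f) :
    BddBorel fun x => c * f x :=
  BddBorel.mul ⟨measurable_const, ‖c‖, fun _ => le_rfl⟩ hf

theorem BddBorel.star {f : X → ℂ} (hf : BddBorel f) : BddBorel fun x => star (f x) := by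
  obtain ⟨C, hC⟩ := hf.2
  exact ⟨continuous_star.measurable.comp hf.1, C, fun x => by simpa using hC x⟩

theorem bddBorel_continuous (g : C(X, ℂ)) : BddBorel (g : X → ℂ) := by
  obtain ⟨C, hC⟩ := isCompact_univ.exists_bound_of_continuousOn g.continuous.continuousOn
  exact ⟨g.continuous.measurable, C, fun x => hC x trivial⟩

theorem tendsto_eLpNorm_mul {μ : Measure X} {F : ℕ → X → ℂ} {f k : X → ℂ} (hk : BddBorel k)
    (h : Tendsto (fun n => eLpNorm (F n - f) 2 μ) atTop (𝓝 0)) :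
    Tendsto (fun n => eLpNorm ((fun x => k x * F n x) - fun x => k x * f x) 2 μ)
      atTop (𝓝 0) := by
  obtain ⟨C, hC⟩ := hk.2
  have h' := ENNReal.Tendsto.const_mul (a := ENNReal.ofReal C) h (Or.inr (by simp))
  rw [mul_zero] at h'
  refine tendsto_of_tendsto_of_tendsto_of_le_of_le tendsto_const_nhds h' (fun n => bot_le)
    (fun n => ?_)
  refine eLpNorm_le_mul_eLpNorm_of_ae_le_mul (ae_of_all _ fun x => ?_) 2
  simp only [Pi.sub_apply, ← mul_sub, norm_mul]
  exact mul_le_mul_of_nonneg_right (hC x) (norm_nonneg _)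

theorem tendsto_eLpNorm_of_bounded {μ : Measure X} [IsFiniteMeasure μ] {F : ℕ → X → ℂ}
    {f : X → ℂ} {C : ℝ} (hF : ∀ n, Measurable (F n)) (hf : Measurable f)
    (hb : ∀ n x, ‖F n x - f x‖ ≤ C)
    (h : ∀ x, Tendsto (fun n => F n x) atTop (𝓝 (f x))) :
    Tendsto (fun n => eLpNorm (F n - f) 2 μ) atTop (𝓝 0) := by
  have hm : ∀ n, MemLp (F n - f) 2 μ := fun n =>
    MemLp.of_bound ((hF n).sub hf).aestronglyMeasurable C (ae_of_all _ (hb n))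
  have hi : Tendsto (fun n => ∫ x, ‖(F n - f) x‖ ^ (2 : ENNReal).toReal ∂μ) atTop (𝓝 0) := by
    have : (0 : ℝ) = ∫ x, (0 : ℝ) ∂μ := by simp
    rw [this]
    refine tendsto_integral_of_dominated_convergence (fun _ => C ^ 2) ?_ ?_ ?_ ?_
    · intro n
      exact (((hF n).sub hf).norm.pow_const _).aestronglyMeasurable
    · exact integrable_const _
    · intro n
      refine ae_of_all _ fun x => ?_
      simp only [ENNReal.toReal_ofNat, Real.rpow_ofNat, norm_pow, norm_norm]
      exact pow_le_pow_left₀ (norm_nonneg _) (hb n x) 2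
    · refine ae_of_all _ fun x => ?_
      have h1 := ((h x).sub_const (f x)).norm.pow 2
      simpa using h1
  have h2 := (hi.rpow_const (p := (2 : ENNReal).toReal⁻¹) (Or.inr (by simp)))
  have h3 := (ENNReal.continuous_ofReal.tendsto _).comp h2
  have h0 : ENNReal.ofReal ((0 : ℝ) ^ (2 : ENNReal).toReal⁻¹) = 0 := by simp
  rw [h0] at h3
  refine h3.congr fun n => ?_
  rw [(hm n).eLpNorm_eq_integral_rpow_norm (by simp) (by simp)]
  rfl

/-- A representation of the continuous functions extends to the bounded Borel functions. -/
theorem exists_borelHom (π : C(X, ℂ) →⋆ₐ[ℂ] (E →L[ℂ] E)) :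
    ∃ Φ : (X → ℂ) → E →L[ℂ] E, IsBorelHom Φ ∧ ∀ g : C(X, ℂ), Φ g = π g := by
  classical
  choose μ hμ hiso using exists_measure (X := X) π
  let L : E → C(X, ℂ) →ₗ[ℂ] E := fun u =>
    { toFun := fun g => π g u
      map_add' := fun g h => by simp
      map_smul' := fun c h => by simp }
  choose Ψ hΨ using fun u => exists_extension (L u) (μ u) (hiso u)
  -- convergence along approximations for a larger measure
  have key : ∀ (ν : Measure X) (u : E), μ u ≤ ν → ∀ f, BddBorel f → ∀ g : ℕ → C(X, ℂ),
      Tendsto (fun n => eLpNorm (⇑(g n) - f) 2 ν) atTop (𝓝 0) →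
      Tendsto (fun n => π (g n) u) atTop (𝓝 (Ψ u f)) := by
    intro ν u hν f hf g hg
    exact (hΨ u f hf).2 g (tendsto_of_tendsto_of_tendsto_of_le_of_le tendsto_const_nhds hg
      (fun n => bot_le) fun n => eLpNorm_mono_measure _ hν)
  have hadd : ∀ f, BddBorel f → ∀ u v, Ψ (u + v) f = Ψ u f + Ψ v f := by
    intro f hf u v
    obtain ⟨g, hg⟩ := exists_approx hf (μ (u + v) + μ u + μ v)
    have h1 := key _ (u + v) (by rw [add_assoc]; exact Measure.le_add_right le_rfl) f hf g hg
    have h2 := key _ u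
      (Measure.le_add_right (Measure.le_add_left le_rfl)) f hf g hg
    have h3 := key _ v (Measure.le_add_left le_rfl) f hf g hg
    refine tendsto_nhds_unique h1 ((h2.add h3).congr fun n => ?_)
    simp
  have hsmul : ∀ f, BddBorel f → ∀ (c : ℂ) u, Ψ (c • u) f = c • Ψ u f := by
    intro f hf c u
    obtain ⟨g, hg⟩ := exists_approx hf (μ (c • u) + μ u)
    have h1 := key _ (c • u) (Measure.le_add_right le_rfl) f hf g hg
    have h2 := key _ u (Measure.le_add_left le_rfl) f hf g hg
    refine tendsto_nhds_unique h1 ((h2.const_smul c).congr fun n => ?_)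
    simp
  have hnorm : ∀ f, BddBorel f → ∀ C : ℝ, 0 ≤ C → (∀ x, ‖f x‖ ≤ C) → ∀ u,
      ‖Ψ u f‖ ≤ C * ‖u‖ := by
    intro f hf C hC hb u
    have h1 : ‖Ψ u f‖ₑ ≤ ENNReal.ofReal C * ‖u‖ₑ := by
      rw [(hΨ u f hf).1]
      have h2 : ‖u‖ₑ = eLpNorm (1 : C(X, ℂ)) 2 (μ u) := by
        rw [← hiso]; simp
      rw [h2]
      exact eLpNorm_le_mul_eLpNorm_of_ae_le_mul (ae_of_all _ fun x => by simpa using hb x) 2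
    have h3 := ENNReal.toReal_mono (ENNReal.mul_ne_top (by simp) (by simp)) h1
    simpa [ENNReal.toReal_mul, toReal_enorm, ENNReal.toReal_ofReal hC] using h3
  have hex : ∀ f : X → ℂ, ∃ T : E →L[ℂ] E, BddBorel f → ∀ u, T u = Ψ u f := by
    intro f
    by_cases hf : BddBorel f
    · obtain ⟨C, hC⟩ := hf.2
      refine ⟨LinearMap.mkContinuous
        { toFun := fun u => Ψ u f
          map_add' := hadd f hf
          map_smul' := hsmul f hf } (max C 0)
        (hnorm f hf _ (le_max_right _ _) fun x => (hC x).trans (le_max_left _ _)),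
        fun _ u => rfl⟩
    · exact ⟨0, fun h => absurd h hf⟩
  choose Φ hΦ using hex
  have hπ : ∀ g : C(X, ℂ), Φ g = π g := by
    intro g
    ext u
    rw [hΦ g (bddBorel_continuous g)]
    refine tendsto_nhds_unique ((hΨ u g (bddBorel_continuous g)).2 (fun _ => g) ?_)
      tendsto_const_nhds
    simp
  have Hadd : ∀ f g, BddBorel f → BddBorel g → Φ (fun x => f x + g x) = Φ f + Φ g := by
    intro f g hf hg
    ext u
    obtain ⟨a, ha⟩ := exists_approx hf (μ u)
    obtain ⟨b, hb⟩ := exists_approx hg (μ u)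
    rw [hΦ _ (hf.add hg), add_apply, hΦ f hf, hΦ g hg]
    have h1 := key _ u le_rfl _ hf a ha
    have h2 := key _ u le_rfl _ hg b hb
    refine tendsto_nhds_unique (key _ u le_rfl _ (hf.add hg) (fun n => a n + b n) ?_)
      ((h1.add h2).congr fun n => by simp)
    have h3 := ha.add hb
    rw [add_zero] at h3
    refine tendsto_of_tendsto_of_tendsto_of_le_of_le tendsto_const_nhds h3 (fun n => bot_le)
      (fun n => ?_)
    have h4 : (⇑(a n + b n) - fun x => f x + g x) = (⇑(a n) - f) + (⇑(b n) - g) := by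
      ext x
      simp only [Pi.sub_apply, Pi.add_apply, ContinuousMap.add_apply]
      ring
    rw [h4]
    exact eLpNorm_add_le ((a n).continuous.measurable.sub hf.1).aestronglyMeasurable
      ((b n).continuous.measurable.sub hg.1).aestronglyMeasurable (by simp)
  have Hmulc : ∀ (k : C(X, ℂ)) g, BddBorel g → Φ (fun x => k x * g x) = π k * Φ g := by
    intro k g hg
    have hk := bddBorel_continuous k
    ext u
    obtain ⟨b, hb⟩ := exists_approx hg (μ u)
    rw [hΦ _ (hk.mul hg), mul_apply_eq_comp, hΦ g hg]
    have h2 := key _ u le_rfl _ hg b hb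
    refine tendsto_nhds_unique (key _ u le_rfl _ (hk.mul hg) (fun n => k * b n) ?_)
      ((((π k).continuous.tendsto _).comp h2).congr fun n => by simp)
    exact tendsto_eLpNorm_mul hk hb
  have Hmul : ∀ f g, BddBorel f → BddBorel g → Φ (fun x => f x * g x) = Φ f * Φ g := by
    intro f g hf hg
    ext u
    obtain ⟨a, ha⟩ := exists_approx hf (μ (Φ g u) + μ u)
    have h1 := key _ (Φ g u) (Measure.le_add_right le_rfl) _ hf a ha
    rw [mul_apply_eq_comp, hΦ f hf (Φ g u)]
    refine tendsto_nhds_unique ?_ h1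
    have h2 : Tendsto (fun n => eLpNorm ((fun x => g x * a n x) - fun x => g x * f x) 2 (μ u))
        atTop (𝓝 0) := by
      refine tendsto_eLpNorm_mul hg ?_
      exact tendsto_of_tendsto_of_tendsto_of_le_of_le tendsto_const_nhds ha
        (fun n => bot_le) fun n => eLpNorm_mono_measure _ (Measure.le_add_left le_rfl)
    rw [tendsto_iff_edist_tendsto_0]
    refine h2.congr fun n => ?_
    have hb : BddBorel fun x => a n x * g x := (bddBorel_continuous (a n)).mul hg
    have hs := Hadd _ _ hb ((hf.mul hg).const_mul (-1))
    have hd := hb.add ((hf.mul hg).const_mul (-1))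
    have h3 : Φ (fun x => -1 * (f x * g x)) = - Φ (fun x => f x * g x) := by
      have h5 := Hmulc (ContinuousMap.const X (-1)) _ (hf.mul hg)
      simp only [ContinuousMap.const_apply] at h5
      rw [h5]
      have h6 : ContinuousMap.const X (-1 : ℂ) = -1 := by ext; simp
      rw [h6, map_neg, _root_.map_one, neg_one_mul]
    rw [h3, Hmulc _ _ hg] at hs
    have h4 := hΦ _ hd u
    rw [hs] at h4
    rw [edist_eq_enorm_sub]
    have h7 : π (a n) (Φ g u) - Φ (fun x => f x * g x) u =
        (π (a n) * Φ g + -Φ fun x => f x * g x) u := by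
      simp [sub_eq_add_neg]
    rw [h7, h4, (hΨ u _ hd).1]
    congr 1
    ext x
    simp only [Pi.sub_apply]
    ring
  have Hsmul : ∀ (c : ℂ) (f), BddBorel f → Φ (fun x => c * f x) = c • Φ f := by
    intro c f hf
    have h5 := Hmulc (ContinuousMap.const X c) _ hf
    simp only [ContinuousMap.const_apply] at h5
    rw [h5]
    have h6 : ContinuousMap.const X c = c • (1 : C(X, ℂ)) := by ext; simp
    rw [h6, _root_.map_smul, _root_.map_one, smul_mul_assoc, one_mul]
  refine ⟨Φ, ⟨?_, Hadd, Hsmul, Hmul, ?_, ?_, ?_⟩, hπ⟩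
  · have h := hπ 1
    rw [_root_.map_one] at h
    exact h
  · intro f hf
    rw [ContinuousLinearMap.star_eq_adjoint, ContinuousLinearMap.eq_adjoint_iff]
    intro u v
    obtain ⟨a, ha⟩ := exists_approx hf (μ u + μ v)
    have h2 := key _ v (Measure.le_add_left le_rfl) _ hf a ha
    have h1 := key _ u (Measure.le_add_right le_rfl) _ hf.star (fun n => star (a n)) (by
      refine ha.congr fun n => ?_
      refine eLpNorm_congr_norm_ae (ae_of_all _ fun x => ?_)
      simp only [Pi.sub_apply, ContinuousMap.star_apply, ← star_sub, norm_star])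
    rw [hΦ _ hf.star, hΦ f hf]
    have h1' : Tendsto (fun n => ⟪π (star (a n)) u, v⟫_ℂ) atTop
        (𝓝 ⟪Ψ u fun x => star (f x), v⟫_ℂ) := h1.inner tendsto_const_nhds
    have h2' : Tendsto (fun n => ⟪u, π (a n) v⟫_ℂ) atTop (𝓝 ⟪u, Ψ v f⟫_ℂ) :=
      tendsto_const_nhds.inner h2
    refine tendsto_nhds_unique h1' (h2'.congr fun n => ?_)
    rw [map_star, ContinuousLinearMap.star_eq_adjoint,
      ContinuousLinearMap.adjoint_inner_left]
  · intro f hf C hC hb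
    refine ContinuousLinearMap.opNorm_le_bound _ hC fun u => ?_
    rw [hΦ f hf]
    exact hnorm f hf C hC hb u
  · intro F f C hF hb hlim u
    have hfm : Measurable f := measurable_of_tendsto_metrizable hF (tendsto_pi_nhds.2 hlim)
    have hfb : ∀ x, ‖f x‖ ≤ C := fun x =>
      le_of_tendsto (hlim x).norm (Eventually.of_forall fun n => hb n x)
    have hf : BddBorel f := ⟨hfm, C, hfb⟩
    rw [tendsto_iff_edist_tendsto_0]
    refine (tendsto_eLpNorm_of_bounded (μ := μ u) (C := C + C) hF hfm (fun n x =>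
      (norm_sub_le _ _).trans (add_le_add (hb n x) (hfb x))) hlim).congr fun n => ?_
    have hFn : BddBorel (F n) := ⟨hF n, C, hb n⟩
    have hd := hFn.add (hf.const_mul (-1))
    have hs := Hadd _ _ hFn (hf.const_mul (-1))
    rw [Hsmul _ _ hf] at hs
    have h4 := hΦ _ hd u
    rw [hs] at h4
    have h7 : Φ (F n) u - Φ f u = (Φ (F n) + (-1 : ℂ) • Φ f) u := by
      simp [sub_eq_add_neg]
    rw [edist_eq_enorm_sub, h7, h4, (hΨ u _ hd).1]
    congr 1
    ext x
    simp only [Pi.sub_apply]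
    ring

theorem norm_shift_sq (H : E →ₗ.[ℂ] E) (hH : IsSelfAdjoint H) (ε : ℝ) (hε : ε ^ 2 = 1)
    (u : H.domain) :
    ‖H u + (ε * Complex.I) • (u : E)‖ ^ 2 = ‖H u‖ ^ 2 + ‖(u : E)‖ ^ 2 := by
  have hf : ⟪H u, (u : E)⟫_ℂ = ⟪(u : E), H u⟫_ℂ := by
    have h := H.adjoint_isFormalAdjoint hH.dense_domain
    have h' : H.IsFormalAdjoint H := by
      have h2 := LinearPMap.isSelfAdjoint_def.1 hH
      rwa [h2] at h
    exact h' u u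
  have him : (⟪H u, (u : E)⟫_ℂ).im = 0 := by
    have h1 := inner_conj_symm (𝕜 := ℂ) (H u) (u : E)
    rw [← hf] at h1
    exact Complex.conj_eq_iff_im.1 h1
  rw [norm_add_sq (𝕜 := ℂ), norm_smul, inner_smul_right]
  have h2 : ‖(ε : ℂ) * Complex.I‖ = |ε| := by simp
  rw [h2, mul_pow, sq_abs, hε]
  simp [him]

theorem exists_resolvent (H : E →ₗ.[ℂ] E) (hH : IsSelfAdjoint H) (ε : ℝ) (hε : ε ^ 2 = 1) :
    ∃ R : E →L[ℂ] E, (∀ w, ∃ h : R w ∈ H.domain, H ⟨R w, h⟩ + (ε * Complex.I) • R w = w) ∧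
      ∀ u : H.domain, R (H u + (ε * Complex.I) • (u : E)) = u := by
  have hadj : H.adjoint = H := LinearPMap.isSelfAdjoint_def.1 hH
  have hform : H.IsFormalAdjoint H := by
    have h := H.adjoint_isFormalAdjoint hH.dense_domain
    rwa [hadj] at h
  let S : H.domain →ₗ[ℂ] E := H.toFun + (ε * Complex.I : ℂ) • H.domain.subtype
  have hS : ∀ u : H.domain, S u = H u + (ε * Complex.I) • (u : E) := fun u => rfl
  have hn : ∀ u : H.domain, ‖(u : E)‖ ≤ ‖S u‖ := by
    intro u
    refine (sq_le_sq₀ (norm_nonneg _) (norm_nonneg _)).1 ?_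
    rw [hS, norm_shift_sq H hH ε hε]
    nlinarith [sq_nonneg ‖H u‖]
  have hn' : ∀ u : H.domain, ‖H u‖ ≤ ‖S u‖ := by
    intro u
    refine (sq_le_sq₀ (norm_nonneg _) (norm_nonneg _)).1 ?_
    rw [hS, norm_shift_sq H hH ε hε]
    nlinarith [sq_nonneg ‖(u : E)‖]
  have hinj : Function.Injective S := by
    rw [← LinearMap.ker_eq_bot, LinearMap.ker_eq_bot']
    intro u hu
    have := hn u
    rw [hu, norm_zero] at this
    exact Subtype.ext (norm_le_zero_iff.1 this)
  have hclosed : IsClosed (LinearMap.range S : Set E) := by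
    refine IsSeqClosed.isClosed fun y w hy hw => ?_
    choose a ha using hy
    have hc : CauchySeq y := hw.cauchySeq
    have hca : CauchySeq fun n => (a n : E) := by
      rw [Metric.cauchySeq_iff'] at hc ⊢
      intro e he
      obtain ⟨N, hN⟩ := hc e he
      refine ⟨N, fun n hn2 => lt_of_le_of_lt ?_ (hN n hn2)⟩
      rw [dist_eq_norm, dist_eq_norm, ← ha, ← ha, ← map_sub]
      exact hn (a n - a N)
    have hcH : CauchySeq fun n => H (a n) := by
      rw [Metric.cauchySeq_iff'] at hc ⊢
      intro e he
      obtain ⟨N, hN⟩ := hc e he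
      refine ⟨N, fun n hn2 => lt_of_le_of_lt ?_ (hN n hn2)⟩
      rw [dist_eq_norm, dist_eq_norm, ← ha, ← ha, ← map_sub, ← LinearPMap.map_sub]
      exact hn' (a n - a N)
    obtain ⟨u, hu⟩ := cauchySeq_tendsto_of_complete hca
    obtain ⟨v, hv⟩ := cauchySeq_tendsto_of_complete hcH
    have hg : ((u, v) : E × E) ∈ (H.graph : Set (E × E)) := by
      refine hH.isClosed.mem_of_tendsto (hu.prodMk_nhds hv) (Eventually.of_forall fun n => ?_)
      exact LinearPMap.mem_graph H (a n)
    obtain ⟨z, hz1, hz2⟩ := (LinearPMap.mem_graph_iff H).1 hg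
    refine ⟨z, ?_⟩
    rw [hS, hz1, hz2]
    refine tendsto_nhds_unique (hv.add (hu.const_smul _)) (hw.congr fun n => ?_)
    rw [← ha, hS]
  have horth : (LinearMap.range S)ᗮ = ⊥ := by
    rw [Submodule.eq_bot_iff]
    intro w hw
    have h1 : ∀ u : H.domain, ⟪(ε * Complex.I) • w, (u : E)⟫_ℂ = ⟪w, H u⟫_ℂ := by
      intro u
      have h2 := Submodule.inner_left_of_mem_orthogonal (LinearMap.mem_range_self S u) hw
      rw [hS, inner_add_right, inner_smul_right] at h2
      rw [inner_smul_left]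
      simp only [map_mul, Complex.conj_ofReal, Complex.conj_I]
      linear_combination -h2
    have hd : w ∈ H.adjoint.domain := LinearPMap.mem_adjoint_domain_of_exists w ⟨_, h1⟩
    have h3 : H.adjoint ⟨w, hd⟩ = (ε * Complex.I) • w :=
      LinearPMap.adjoint_apply_eq hH.dense_domain _ h1
    have h4 : ∃ hd' : w ∈ H.domain, H ⟨w, hd'⟩ = (ε * Complex.I) • w := by
      have h5 : (w, (ε * Complex.I) • w) ∈ H.adjoint.graph :=
        (LinearPMap.mem_graph_iff _).2 ⟨⟨w, hd⟩, rfl, h3⟩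
      rw [hadj] at h5
      obtain ⟨z, hz1, hz2⟩ := (LinearPMap.mem_graph_iff _).1 h5
      simp only at hz1 hz2
      subst hz1
      exact ⟨z.2, hz2⟩
    obtain ⟨hd', h6⟩ := h4
    have h7 := norm_shift_sq H hH (-ε) (by rw [neg_sq, hε]) ⟨w, hd'⟩
    rw [h6] at h7
    simp only [Complex.ofReal_neg, neg_mul, neg_smul, add_neg_cancel, norm_zero] at h7
    have h8 : ‖w‖ ^ 2 = 0 := by nlinarith [sq_nonneg ‖w‖, sq_nonneg ‖(ε * Complex.I) • w‖]
    simpa using h8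
  have hsurj : Function.Surjective S := by
    rw [← LinearMap.range_eq_top]
    have : CompleteSpace (LinearMap.range S) := hclosed.completeSpace_coe
    exact Submodule.orthogonal_eq_bot_iff.1 horth
  let e : H.domain ≃ₗ[ℂ] E := LinearEquiv.ofBijective S ⟨hinj, hsurj⟩
  have he : ∀ w, S (e.symm w) = w := fun w => e.apply_symm_apply w
  let R : E →L[ℂ] E := LinearMap.mkContinuous (H.domain.subtype ∘ₗ e.symm.toLinearMap) 1 (by
    intro w
    have := hn (e.symm w)
    rw [he] at this
    simpa using this)
  refine ⟨R, fun w => ⟨(e.symm w).2, he w⟩, fun u => ?_⟩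
  exact congrArg Subtype.val (e.symm_apply_apply u)

/-- The spectral theorem in functional calculus form. -/
theorem exists_borelCalculus (H : E →ₗ.[ℂ] E) (hH : IsSelfAdjoint H) :
    ∃ Φ : (ℝ → ℂ) → E →L[ℂ] E, IsBorelCalculus H Φ := by
  have hform : H.IsFormalAdjoint H := by
    have h := H.adjoint_isFormalAdjoint hH.dense_domain
    rwa [LinearPMap.isSelfAdjoint_def.1 hH] at h
  obtain ⟨R, hR1, hR2⟩ := exists_resolvent H hH 1 (by norm_num)
  obtain ⟨Q, hQ1, hQ2⟩ := exists_resolvent H hH (-1) (by norm_num)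
  simp only [Complex.ofReal_one, one_mul, Complex.ofReal_neg, neg_mul] at hR1 hR2 hQ1 hQ2
  have hstar : star R = Q := by
    rw [ContinuousLinearMap.star_eq_adjoint, eq_comm, ContinuousLinearMap.eq_adjoint_iff]
    intro x y
    obtain ⟨hx, hx'⟩ := hQ1 x
    obtain ⟨hy, hy'⟩ := hR1 y
    have h := hform ⟨Q x, hx⟩ ⟨R y, hy⟩
    simp only at h
    conv_lhs => rw [← hy']
    conv_rhs => rw [← hx']
    rw [inner_add_right, inner_add_left, inner_smul_left, inner_smul_right]
    simp only [map_neg, Complex.conj_I]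
    rw [← h]
    ring

  have hRQ : R - Q = -(2 * Complex.I) • (R * Q) := by
    ext x
    obtain ⟨hx, hx'⟩ := hR1 x
    obtain ⟨hy, hy'⟩ := hQ1 x
    have h := hR2 (⟨R x, hx⟩ - ⟨Q x, hy⟩)
    have h2 : H (⟨R x, hx⟩ - ⟨Q x, hy⟩) + Complex.I • ((⟨R x, hx⟩ - ⟨Q x, hy⟩ : H.domain) : E)
        = -(2 * Complex.I) • Q x := by
      rw [LinearPMap.map_sub]
      have e1 : H ⟨R x, hx⟩ = x - Complex.I • R x := eq_sub_of_add_eq hx'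
      have e2 : H ⟨Q x, hy⟩ = x - -Complex.I • Q x := eq_sub_of_add_eq hy'
      rw [e1, e2]
      simp only [AddSubgroupClass.coe_sub]
      module
    rw [h2] at h
    simp only [map_smul] at h
    simpa using h.symm
  have hQR : R - Q = -(2 * Complex.I) • (Q * R) := by
    ext x
    obtain ⟨hx, hx'⟩ := hR1 x
    obtain ⟨hy, hy'⟩ := hQ1 x
    have h := hQ2 (⟨R x, hx⟩ - ⟨Q x, hy⟩)
    have h2 : H (⟨R x, hx⟩ - ⟨Q x, hy⟩) + -Complex.I • ((⟨R x, hx⟩ - ⟨Q x, hy⟩ : H.domain) : E)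
        = -(2 * Complex.I) • R x := by
      rw [LinearPMap.map_sub]
      have e1 : H ⟨R x, hx⟩ = x - Complex.I • R x := eq_sub_of_add_eq hx'
      have e2 : H ⟨Q x, hy⟩ = x - -Complex.I • Q x := eq_sub_of_add_eq hy'
      rw [e1, e2]
      simp only [AddSubgroupClass.coe_sub]
      module
    rw [h2] at h
    simp only [map_smul] at h
    simpa using h.symm
  have hnormal : IsStarNormal R := by
    refine ⟨?_⟩
    rw [hstar]
    change Q * R = R * Q
    have h : -(2 * Complex.I) • (R * Q) = -(2 * Complex.I) • (Q * R) := by rw [← hRQ, ← hQR]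
    exact (smul_right_injective _ (by simp) h).symm
  have hRinj : ∀ w, R w = 0 → w = 0 := by
    intro w hw
    obtain ⟨h, h'⟩ := hR1 w
    have h0 : (⟨R w, h⟩ : H.domain) = 0 := Subtype.ext hw
    rw [h0, LinearPMap.map_zero, hw] at h'
    simpa using h'.symm
  have hQinj : ∀ w, Q w = 0 → w = 0 := by
    intro w hw
    obtain ⟨h, h'⟩ := hQ1 w
    have h0 : (⟨Q w, h⟩ : H.domain) = 0 := Subtype.ext hw
    rw [h0, LinearPMap.map_zero, hw] at h'
    simpa using h'.symm
  -- Borel calculus of the normal operator `R`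
  let X := spectrum ℂ R
  have : CompactSpace X := isCompact_iff_compactSpace.1 (spectrum.isCompact R)
  obtain ⟨Φ, hΦ, hΦπ⟩ := exists_borelHom (X := X) (cfcHom hnormal)
  let z : C(X, ℂ) := (ContinuousMap.id ℂ).restrict X
  have hz : Φ z = R := by rw [hΦπ]; exact cfcHom_id hnormal
  have hzv : ∀ x : X, z x = (x : ℂ) := fun x => rfl
  have bz : BddBorel (z : X → ℂ) := bddBorel_continuous z
  have hzs : Φ (fun x => star (z x)) = Q := by rw [hΦ.map_star _ bz, hz, hstar]
  let κ : X → ℝ := fun x => ((x : ℂ)⁻¹).re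
  have hκ : Measurable κ := Complex.measurable_re.comp (measurable_inv.comp measurable_subtype_coe)
  have hκz : ∀ x : X, ‖(κ x : ℂ) * z x‖ ≤ 1 := by
    intro x
    rw [norm_mul, Complex.norm_real, Real.norm_eq_abs, hzv]
    calc |κ x| * ‖(x : ℂ)‖ ≤ ‖(x : ℂ)⁻¹‖ * ‖(x : ℂ)‖ :=
          mul_le_mul_of_nonneg_right (Complex.abs_re_le_norm _) (norm_nonneg _)
      _ ≤ 1 := by
          rw [norm_inv]
          exact inv_mul_le_one
  have bκz : BddBorel fun x => (κ x : ℂ) * z x :=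
    ⟨(Complex.measurable_ofReal.comp hκ).mul bz.1, 1, hκz⟩
  have b1 : BddBorel (fun _ : X => (1 : ℂ)) := ⟨measurable_const, 1, fun _ => by simp⟩
  have main : Φ (fun x => (κ x : ℂ) * z x) = 1 - Complex.I • R := by
    have bzz := bz.mul bz.star
    have hh0 : Φ (fun x => (z x + (-1) * star (z x)) + (2 * Complex.I) * (z x * star (z x))) = 0 := by
      rw [hΦ.map_add _ _ (bz.add (bz.star.const_mul _)) (bzz.const_mul _),
        hΦ.map_add _ _ bz (bz.star.const_mul _), hΦ.map_smul _ _ bz.star, hΦ.map_smul _ _ bzz,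
        hΦ.map_mul _ _ bz bz.star, hz, hzs]
      have : R + (-1 : ℂ) • Q = -(2 * Complex.I) • (R * Q) := by rw [← hRQ]; module
      rw [this]; module
    have bh := (bz.add (bz.star.const_mul (-1))).add (bzz.const_mul (2 * Complex.I))
    have bk := bκz.add ((b1.add (bz.const_mul (-Complex.I))).const_mul (-1))
    have hid : (fun x => (star (z x) * z x) *
          ((κ x : ℂ) * z x + (-1) * (1 + (-Complex.I) * z x))) =
        fun x => ((1 / 2 : ℂ) * z x) *
          ((z x + (-1) * star (z x)) + (2 * Complex.I) * (z x * star (z x))) := by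
      ext x
      by_cases hx : (x : ℂ) = 0
      · simp [hzv, hx]
      · have hn : star (x : ℂ) ≠ 0 := by simpa using hx
        have hk : (κ x : ℂ) = ((x : ℂ)⁻¹ + (star (x : ℂ))⁻¹) / 2 := by
          have := Complex.re_eq_add_conj ((x : ℂ)⁻¹)
          rw [map_inv₀] at this
          exact this
        rw [hk, hzv]
        field_simp
        ring
    have h1 := hΦ.map_mul _ _ (bz.star.mul bz) bk
    rw [hid, hΦ.map_mul _ _ (bz.const_mul _) bh, hh0, mul_zero, hΦ.map_mul _ _ bz.star bz, hz,
      hzs] at h1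
    have h2 : Φ (fun x => (κ x : ℂ) * z x + (-1) * (1 + (-Complex.I) * z x)) = 0 := by
      ext w
      have h3 := congrArg (fun T : E →L[ℂ] E => T w) h1.symm
      simp only [mul_apply_eq_comp, zero_apply] at h3
      exact hRinj _ (hQinj _ h3)
    rw [hΦ.map_add _ _ bκz ((b1.add (bz.const_mul _)).const_mul _),
      hΦ.map_smul _ _ (b1.add (bz.const_mul _)), hΦ.map_add _ _ b1 (bz.const_mul _),
      hΦ.map_smul _ _ bz, hΦ.map_one, hz] at h2
    rw [eq_neg_of_add_eq_zero_left h2]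
    module
  have bcomp : ∀ f : ℝ → ℂ, BddBorel f → BddBorel fun x : X => f (κ x) := by
    intro f hf
    obtain ⟨C, hC⟩ := hf.2
    exact ⟨hf.1.comp hκ, C, fun x => hC _⟩
  refine ⟨fun f => Φ fun x => f (κ x), ⟨⟨hΦ.map_one, ?_, ?_, ?_, ?_, ?_, ?_⟩, ?_⟩⟩
  · exact fun f g hf hg => hΦ.map_add _ _ (bcomp f hf) (bcomp g hg)
  · exact fun c f hf => hΦ.map_smul c _ (bcomp f hf)
  · exact fun f g hf hg => hΦ.map_mul _ _ (bcomp f hf) (bcomp g hg)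
  · exact fun f hf => hΦ.map_star _ (bcomp f hf)
  · exact fun f hf C hC hb => hΦ.norm_le _ (bcomp f hf) C hC fun x => hb _
  · exact fun F f C hF hb hl u => hΦ.tendsto_of_bounded _ _ C (fun n => (hF n).comp hκ)
      (fun n x => hb n _) (fun x => hl _) u
  · intro F hF hb hl u
    have hlim := hΦ.tendsto_of_bounded (fun n x => F n (κ x) * z x)
      (fun x => (κ x : ℂ) * z x) 1 (fun n => ((hF n).1.comp hκ).mul bz.1)
      (fun n x => by
        refine le_trans ?_ (hκz x)
        rw [norm_mul, norm_mul, Complex.norm_real]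
        exact mul_le_mul_of_nonneg_right (hb n _) (norm_nonneg _))
      (fun x => (hl _).mul_const _) (H u + Complex.I • (u : E))
    rw [main] at hlim
    have h1 : (1 - Complex.I • R) (H u + Complex.I • (u : E)) = H u := by
      simp only [sub_apply, smul_apply, one_apply_eq_self, hR2 u]
      simp
    rw [h1] at hlim
    refine hlim.congr fun n => ?_
    rw [hΦ.map_mul _ _ (bcomp _ (hF n)) bz, mul_apply_eq_comp, hz, hR2 u]

end Spectral

section Operators

variable {E : Type*} [NormedAddCommGroup E] [InnerProductSpace ℂ E]

open scoped Classical in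
/-- The operator `f(H)`, for `H` self-adjoint and `f` bounded Borel. -/
def fc [CompleteSpace E] (H : E →ₗ.[ℂ] E) (f : ℝ → ℂ) : E →L[ℂ] E :=
  if h : IsSelfAdjoint H then (exists_borelCalculus H h).choose f else 0

theorem fc_isBorelCalculus [CompleteSpace E] (H : E →ₗ.[ℂ] E) (h : IsSelfAdjoint H) :
    IsBorelCalculus H (fc H) := by
  have hs := (exists_borelCalculus H h).choose_spec
  have he : fc H = (exists_borelCalculus H h).choose := by
    funext f
    simp [fc, h]
  rw [he]
  exact hs

/-- The spectral projection `χ_S(H)`. -/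
def spectralProj [CompleteSpace E] (H : E →ₗ.[ℂ] E) (S : Set ℝ) : E →L[ℂ] E :=
  fc H (S.indicator fun _ => 1)

/-- The unitary operator `e^{-i s H}`. -/
def evol [CompleteSpace E] (H : E →ₗ.[ℂ] E) (s : ℝ) : E →L[ℂ] E :=
  fc H fun x => Complex.exp (-Complex.I * s * x)

/-- The weight `⟨A⟩^{-α}`. -/
def weight [CompleteSpace E] (A : E →ₗ.[ℂ] E) (α : ℝ) : E →L[ℂ] E :=
  fc A fun x => ((bracket x ^ (-α) : ℝ) : ℂ)

/-- The commutator `[B, A] = BA - AB` of a bounded `B` with a self-adjoint `A`, which is defined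
as a sesquilinear form on the domain of `A`, extends to the bounded operator `T`. -/
def IsCommutator (A : E →ₗ.[ℂ] E) (B T : E →L[ℂ] E) : Prop :=
  ∀ u v : A.domain,
    ⟪(u : E), T (v : E)⟫_ℂ = ⟪(u : E), B (A v)⟫_ℂ - ⟪A u, B (v : E)⟫_ℂ

/-- The iterated commutators `ad_A^1(B), …, ad_A^k(B)` extend to bounded operators,
and `ad_A^k(B) = T`; here `ad_A^0(B) = B` and `ad_A^{k+1}(B) = [ad_A^k(B), A]`. -/
def IsAd (A : E →ₗ.[ℂ] E) (B : E →L[ℂ] E) : ℕ → (E →L[ℂ] E) → Prop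
  | 0, T => T = B
  | k + 1, T => ∃ S : E →L[ℂ] E, IsAd A B k S ∧ IsCommutator A S T

/-- The quadratic form `⟨u, i[H, A] u⟩ = i (⟨Hu, Au⟩ - ⟨Au, Hu⟩)` on the intersection of
the domains of `H` and `A`. -/
def commForm (H A : E →ₗ.[ℂ] E) (u : E) (hH : u ∈ H.domain) (hA : u ∈ A.domain) : ℂ :=
  Complex.I * (⟪H ⟨u, hH⟩, A ⟨u, hA⟩⟫_ℂ - ⟪A ⟨u, hA⟩, H ⟨u, hH⟩⟫_ℂ)

/-- The Mourre bound `χ_S(H) (i/ħ)[H, A] χ_S(H) ≥ θ ħ χ_S(H)` in the sense of quadratic forms: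
it is tested on all `u` for which `χ_S(H) u` lies in the domain of the form `[H, A]`. -/
def MourreBound [CompleteSpace E] (H A : E →ₗ.[ℂ] E) (S : Set ℝ) (θ ħ : ℝ) : Prop :=
  ∀ (u : E) (hH : spectralProj H S u ∈ H.domain) (hA : spectralProj H S u ∈ A.domain),
    θ * ħ * (⟪u, spectralProj H S u⟫_ℂ).re
      ≤ ħ⁻¹ * (commForm H A (spectralProj H S u) hH hA).re

end Operators

end SigalSoffer

end

/-! In the time τ = ħt the evolution is e^{-iτH/ħ²}, and on energies in I = [a, b] the Mourre bound
reads ħ⁻² i[H, A] ≥ θ: the observable A grows at least at rate θ in τ. A state that starts in A ≥ c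
should thus have left A ≤ c + θτ − 2δs for 0 ≤ τ ≤ s, up to errors of every order in 1/s. This is
`Decay`, an energy estimate for ⟨φ(τ), S((A − c − θτ)/s) φ(τ)⟩ with S a decreasing cutoff, S' = −G².

The τ-derivative has two parts. The moving cutoff gives + (θ/s)‖Gφ‖². The commutator of the energy
with S(·) has leading term −s⁻¹ħ⁻² i⟨Gφ, [H, A] Gφ⟩, which by the Mourre bound is at most
−(θ/s)‖Gφ‖². The two cancel, and what is left is O(s⁻²) times the mass of the state where a slightly
wider cutoff F lives (`flux_le`). If that mass is O(s⁻ʲ), integration over a time at most s gives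
O(s⁻ʲ⁻¹). At τ = 0 the mass is O(s⁻ⁿ) for every n, because g(H) is almost local in A at scale s
(`IsMourrePair.expect_zero_le`). Induction on j gives all orders, starting from the trivial bound j
= 0.

Two tools carry this. The first is the expansion T₀ f(A_s) = ∑_{k<n} s⁻ᵏ f⁽ᵏ⁾(A_s) T_k / k! +
O(s⁻ⁿ‖T_n‖), where A_s = (A − c)/s and T_k is the k-th iterated commutator of T₀ with A
(`norm_commRem_le`). It comes from Taylor's formula for e^{-irA} T₀ e^{irA}, integrated against the
Fourier transform of f. As ‖T_k‖ = O(ħᵏ), terms with k ≥ 2 absorb the prefactor ħ⁻².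

The second tool is forced by the Mourre bound, which holds only on the range of χ_I(H), while Gφ is
not energy localized. If the energy cutoff is a product g·r, then φ = g(H)w with w carrying the
cutoff r, and Gφ can be exchanged for g(H)Gw at the price of the commutator [g(H), G] acting on w.
This needs the decay of order j both for r and for g·r, with no enlargement of I. Hence the
factorization lemma `factor_induction`: a smooth function supported in [a, b] is a finite sum of
products of two such functions.

The weighted estimate follows by splitting: the weights are O(τ^{-α}) where |A| is at least a
multiple of τ, and between A ≥ −θτ/4 initially and A ≤ θτ/2 finally the decay of order j ≥ 2α
applies. Negative times are reached by taking adjoints. Throughout, constants are chosen before the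
Hilbert space and the operators, which is how uniformity in ħ is recorded. -/

namespace SigalSoffer

/-! ### Bounded Borel functions -/

section BoundedBorel
variable {X : Type*} [MeasurableSpace X] {f g : X → ℂ}

theorem BddBorel.fun_add (hf : BddBorel f) (hg : BddBorel g) : BddBorel fun x => f x + g x := by
  obtain ⟨C, hC⟩ := hf.2
  obtain ⟨D, hD⟩ := hg.2
  exact ⟨hf.1.add hg.1, C + D, fun x => (norm_add_le _ _).trans (add_le_add (hC x) (hD x))⟩

theorem BddBorel.fun_mul (hf : BddBorel f) (hg : BddBorel g) : BddBorel fun x => f x * g x := by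
  obtain ⟨C, hC⟩ := hf.2
  obtain ⟨D, hD⟩ := hg.2
  refine ⟨hf.1.mul hg.1, C * D, fun x => ?_⟩
  rw [norm_mul]
  exact mul_le_mul (hC x) (hD x) (norm_nonneg _) ((norm_nonneg _).trans (hC x))

theorem bddBorel_const (c : ℂ) : BddBorel fun _ : X => c :=
  ⟨measurable_const, ‖c‖, fun _ => le_rfl⟩

theorem BddBorel.fun_const_mul (hf : BddBorel f) (c : ℂ) : BddBorel fun x => c * f x :=
  (bddBorel_const c).fun_mul hf

theorem BddBorel.fun_neg (hf : BddBorel f) : BddBorel fun x => -f x := by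
  simpa using hf.fun_const_mul (-1)

theorem BddBorel.fun_sub (hf : BddBorel f) (hg : BddBorel g) : BddBorel fun x => f x - g x := by
  simpa [sub_eq_add_neg] using hf.fun_add hg.fun_neg

theorem BddBorel.fun_star (hf : BddBorel f) : BddBorel fun x => Star.star (f x) := by
  obtain ⟨C, hC⟩ := hf.2
  exact ⟨continuous_star.measurable.comp hf.1, C, fun x => by simpa using hC x⟩

theorem bddBorel_indicator {s : Set X} (hs : MeasurableSet s) :
    BddBorel (s.indicator fun _ => (1 : ℂ)) := by
  refine ⟨measurable_const.indicator hs, 1, fun x => ?_⟩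
  by_cases h : x ∈ s <;> simp [h]

theorem bddBorel_exp (r : ℝ) : BddBorel fun x : ℝ => Complex.exp (Complex.I * r * x) := by
  refine ⟨by fun_prop, 1, fun x => ?_⟩
  have : Complex.I * r * x = ((r * x : ℝ) : ℂ) * Complex.I := by push_cast; ring
  simp only [this, Complex.norm_exp_ofReal_mul_I, le_refl]

end BoundedBorel

/-! ### Consequences of the axioms of a Borel functional calculus -/

section BorelHom
variable {E : Type*} [NormedAddCommGroup E] [InnerProductSpace ℂ E] [CompleteSpace E]
variable {X : Type*} [MeasurableSpace X] {Φ : (X → ℂ) → E →L[ℂ] E} {f g : X → ℂ}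

theorem IsBorelHom.map_zero (h : IsBorelHom Φ) : Φ (fun _ => 0) = 0 := by
  simpa using h.map_smul 0 _ (bddBorel_const 0)

theorem IsBorelHom.map_sub (h : IsBorelHom Φ) (hf : BddBorel f) (hg : BddBorel g) :
    Φ (fun x => f x - g x) = Φ f - Φ g := by
  have h1 := h.map_add f (fun x => (-1) * g x) hf (hg.fun_const_mul _)
  rw [h.map_smul _ _ hg] at h1
  simpa [sub_eq_add_neg] using h1

theorem IsBorelHom.inner_left (h : IsBorelHom Φ) (hf : BddBorel f) (u v : E) :
    ⟪Φ f u, v⟫_ℂ = ⟪u, Φ (fun x => star (f x)) v⟫_ℂ := by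
  rw [h.map_star f hf, ContinuousLinearMap.star_eq_adjoint,
    ContinuousLinearMap.adjoint_inner_right]

theorem IsBorelHom.mul_apply (h : IsBorelHom Φ) (hf : BddBorel f) (hg : BddBorel g) (u : E) :
    Φ f (Φ g u) = Φ (fun x => f x * g x) u := by
  rw [h.map_mul f g hf hg]; rfl

theorem IsBorelHom.commute_apply (h : IsBorelHom Φ) (hf : BddBorel f) (hg : BddBorel g) (u : E) :
    Φ f (Φ g u) = Φ g (Φ f u) := by
  rw [h.mul_apply hf hg, h.mul_apply hg hf]
  simp only [mul_comm]

theorem IsBorelHom.norm_apply_le (h : IsBorelHom Φ) (hf : BddBorel f) {C : ℝ} (hC : 0 ≤ C)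
    (hb : ∀ x, ‖f x‖ ≤ C) (u : E) : ‖Φ f u‖ ≤ C * ‖u‖ :=
  (Φ f).le_of_opNorm_le (h.norm_le f hf C hC hb) u

/-- The quotient f/g is bounded by C, with value 0 where g vanishes, and f = (f/g)·g. -/
theorem IsBorelHom.norm_apply_le_of_le (h : IsBorelHom Φ) (hf : BddBorel f) (hg : BddBorel g)
    {C : ℝ} (hC : 0 ≤ C) (hb : ∀ x, ‖f x‖ ≤ C * ‖g x‖) (u : E) : ‖Φ f u‖ ≤ C * ‖Φ g u‖ := by
  have hm : ∀ x, ‖f x / g x‖ ≤ C := fun x => by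
    rw [norm_div]
    exact div_le_of_le_mul₀ (norm_nonneg _) hC (hb x)
  have hq : BddBorel fun x => f x / g x := ⟨hf.1.div hg.1, C, hm⟩
  have he : f = fun x => f x / g x * g x := by
    ext x
    by_cases hx : g x = 0
    · have := hb x
      rw [hx, norm_zero, mul_zero] at this
      simp [hx, norm_le_zero_iff.1 this]
    · rw [div_mul_cancel₀ _ hx]
  conv_lhs => rw [he]
  rw [← h.mul_apply hq hg]
  exact h.norm_apply_le hq hC hm _

theorem IsBorelHom.inner_self_sq (h : IsBorelHom Φ) (hf : BddBorel f) (u : E) :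
    ⟪u, Φ (fun x => star (f x) * f x) u⟫_ℂ = ((‖Φ f u‖ ^ 2 : ℝ) : ℂ) := by
  rw [← h.mul_apply hf.fun_star hf, ← h.inner_left hf, inner_self_eq_norm_sq_to_K]
  simp

theorem IsBorelHom.inner_nonneg (h : IsBorelHom Φ) {f : X → ℝ} (hf : Measurable f) {C : ℝ}
    (h0 : ∀ x, 0 ≤ f x) (h1 : ∀ x, f x ≤ C) (u : E) :
    ⟪u, Φ (fun x => (f x : ℂ)) u⟫_ℂ
      = ((‖Φ (fun x => ((Real.sqrt (f x) : ℝ) : ℂ)) u‖ ^ 2 : ℝ) : ℂ) := by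
  have hb : BddBorel fun x => ((Real.sqrt (f x) : ℝ) : ℂ) := by
    refine ⟨Complex.measurable_ofReal.comp hf.sqrt, Real.sqrt C, fun x => ?_⟩
    rw [Complex.norm_real, Real.norm_of_nonneg (Real.sqrt_nonneg _)]
    exact Real.sqrt_le_sqrt (h1 x)
  rw [← h.inner_self_sq hb]
  congr 3
  ext x
  rw [RCLike.star_def, Complex.conj_ofReal, ← Complex.ofReal_mul, Real.mul_self_sqrt (h0 x)]

end BorelHom

/-! ### Scalar spectral measures and Fourier superpositions -/

section SpectralMeasure
open MeasureTheory
variable {E : Type*} [NormedAddCommGroup E] [InnerProductSpace ℂ E] [CompleteSpace E]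
variable {X : Type*} [MeasurableSpace X] {Φ : (X → ℂ) → E →L[ℂ] E}

theorem IsBorelHom.inner_indicator (h : IsBorelHom Φ) {s : Set X} (hs : MeasurableSet s) (u : E) :
    ⟪u, Φ (s.indicator fun _ => 1) u⟫_ℂ = ((‖Φ (s.indicator fun _ => 1) u‖ ^ 2 : ℝ) : ℂ) := by
  rw [← h.inner_self_sq (bddBorel_indicator hs)]
  congr 3
  ext x
  by_cases hx : x ∈ s <;> simp [hx]

/-- The set function s ↦ ‖1_s(A)u‖² is additive since the calculus is linear, and countably additive
since it is continuous under bounded pointwise convergence. Simple functions and bounded convergence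
then give all bounded Borel f. The measure makes Fubini available for functions of an operator. -/
theorem IsBorelHom.exists_spectralMeasure (h : IsBorelHom Φ) (u : E) :
    ∃ μ : Measure X, IsFiniteMeasure μ ∧
      ∀ f, BddBorel f → ⟪u, Φ f u⟫_ℂ = ∫ x, f x ∂μ := by
  classical
  let p : Set X → ℝ := fun s => ‖Φ (s.indicator fun _ => 1) u‖ ^ 2
  have hp : ∀ s, MeasurableSet s → ⟪u, Φ (s.indicator fun _ => 1) u⟫_ℂ = (p s : ℂ) :=
    fun s hs => h.inner_indicator hs u
  have hp0 : ∀ s, 0 ≤ p s := fun s => by positivity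
  have hunion : ∀ s t, MeasurableSet s → MeasurableSet t → Disjoint s t →
      p (s ∪ t) = p s + p t := by
    intro s t hs ht hst
    have h1 := hp _ (hs.union ht)
    have h2 : ((s ∪ t).indicator fun _ => (1 : ℂ)) =
        fun x => (s.indicator fun _ => (1 : ℂ)) x + (t.indicator fun _ => (1 : ℂ)) x := by
      rw [Set.indicator_union_of_disjoint hst]
    rw [h2, h.map_add _ _ (bddBorel_indicator hs) (bddBorel_indicator ht), add_apply,
      inner_add_right, hp s hs, hp t ht] at h1
    exact_mod_cast h1.symm
  have hpe : p ∅ = 0 := by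
    have : (∅ : Set X).indicator (fun _ => (1 : ℂ)) = fun _ => 0 := by simp
    simp only [p]
    rw [this, h.map_zero]
    simp
  have hfin : ∀ (s : ℕ → Set X), (∀ i, MeasurableSet (s i)) → Pairwise (Function.onFun Disjoint s) →
      ∀ n, p (⋃ i ∈ Finset.range n, s i) = ∑ i ∈ Finset.range n, p (s i) := by
    intro s hs hd n
    induction n with
    | zero => simpa using hpe
    | succ n ih =>
      rw [Finset.sum_range_succ, ← ih, ← hunion _ _ (Finset.measurableSet_biUnion _ fun i _ => hs i)
        (hs n)]
      · congr 1
        rw [Finset.range_add_one, Finset.set_biUnion_insert, Set.union_comm]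
      · rw [Set.disjoint_iUnion₂_left]
        intro i hi
        exact hd (by simp at hi; omega)
  have hsum : ∀ (s : ℕ → Set X), (∀ i, MeasurableSet (s i)) → Pairwise (Function.onFun Disjoint s) →
      HasSum (fun i => p (s i)) (p (⋃ i, s i)) := by
    intro s hs hd
    rw [hasSum_iff_tendsto_nat_of_nonneg fun i => hp0 _]
    have h1 := h.tendsto_of_bounded (fun n => (⋃ i ∈ Finset.range n, s i).indicator fun _ => 1)
      ((⋃ i, s i).indicator fun _ => 1) 1
      (fun n => measurable_const.indicator (Finset.measurableSet_biUnion _ fun i _ => hs i))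
      (fun n x => by
        by_cases hx : x ∈ ⋃ i ∈ Finset.range n, s i
        · rw [Set.indicator_of_mem hx]; simp
        · rw [Set.indicator_of_notMem hx]; simp)
      (fun x => by
        by_cases hx : x ∈ ⋃ i, s i
        · obtain ⟨i, hi⟩ := Set.mem_iUnion.1 hx
          refine tendsto_const_nhds.congr' ?_
          filter_upwards [eventually_gt_atTop i] with n hn
          rw [Set.indicator_of_mem hx, Set.indicator_of_mem]
          exact Set.mem_iUnion₂.2 ⟨i, Finset.mem_range.2 hn, hi⟩
        · refine tendsto_const_nhds.congr fun n => ?_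
          rw [Set.indicator_of_notMem hx, Set.indicator_of_notMem]
          intro hx'
          obtain ⟨i, _, hi⟩ := Set.mem_iUnion₂.1 hx'
          exact hx (Set.mem_iUnion.2 ⟨i, hi⟩)) u
    refine (h1.norm.pow 2).congr fun n => ?_
    exact hfin s hs hd n
  let μ : Measure X := Measure.ofMeasurable (fun s _ => ENNReal.ofReal (p s))
    (by simp [hpe]) (by
      intro s hs hd
      rw [← (hsum s hs hd).tsum_eq, ENNReal.ofReal_tsum_of_nonneg (fun i => hp0 _)
        (hsum s hs hd).summable])
  have hμ : ∀ s, MeasurableSet s → μ s = ENNReal.ofReal (p s) := fun s hs =>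
    Measure.ofMeasurable_apply s hs
  have hfinite : IsFiniteMeasure μ := ⟨by rw [hμ _ MeasurableSet.univ]; simp⟩
  refine ⟨μ, hfinite, ?_⟩
  have hsimple : ∀ F : SimpleFunc X ℂ, BddBorel F ∧ ⟪u, Φ F u⟫_ℂ = ∫ x, F x ∂μ := by
    intro F
    have hb : ∀ F : SimpleFunc X ℂ, BddBorel F := fun F => by
      obtain ⟨C, hC⟩ := F.exists_forall_norm_le
      exact ⟨F.measurable, C, hC⟩
    refine ⟨hb F, ?_⟩
    induction F using SimpleFunc.induction with
    | const c hs =>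
      rename_i s
      have h1 : ⇑(SimpleFunc.piecewise s hs (SimpleFunc.const X c) (SimpleFunc.const X 0)) =
          fun x => c * (s.indicator fun _ => (1 : ℂ)) x := by
        ext x
        by_cases hx : x ∈ s <;> simp [hx]
      rw [h1, h.map_smul _ _ (bddBorel_indicator hs), smul_apply, inner_smul_right,
        hp s hs, integral_const_mul, integral_indicator_const _ hs]
      simp [Measure.real, hμ s hs, ENNReal.toReal_ofReal (hp0 s)]
    | add hd hF hG =>
      rename_i F G
      have h1 : ⇑(F + G) = fun x => F x + G x := rfl
      have hi : ∀ F : SimpleFunc X ℂ, Integrable F μ := fun F => F.integrable_of_isFiniteMeasure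
      rw [h1, h.map_add _ _ (hb F) (hb G), add_apply, inner_add_right, hF, hG,
        integral_add (hi F) (hi G)]
  intro f hf
  obtain ⟨C, hC⟩ := hf.2
  have hs := hf.1.stronglyMeasurable
  have hC0 : ∀ x : X, 0 ≤ C := fun x => (norm_nonneg _).trans (hC x)
  rcases isEmpty_or_nonempty X with hX | ⟨⟨x0⟩⟩
  · have : f = (0 : SimpleFunc X ℂ) := by ext x; exact (hX.false x).elim
    rw [this]
    exact (hsimple 0).2
  have l1 := h.tendsto_of_bounded (fun n => hs.approxBounded C n) f C
    (fun n => (hs.approxBounded C n).measurable)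
    (fun n x => hs.norm_approxBounded_le (hC0 x0) n x)
    (fun x => StronglyMeasurable.tendsto_approxBounded_of_norm_le hs (hC x)) u
  have l2 : Tendsto (fun n => ∫ x, hs.approxBounded C n x ∂μ) atTop (𝓝 (∫ x, f x ∂μ)) := by
    refine tendsto_integral_of_dominated_convergence (fun _ => C) ?_ (integrable_const _) ?_ ?_
    · exact fun n => (hs.approxBounded C n).aestronglyMeasurable
    · exact fun n => ae_of_all _ fun x => hs.norm_approxBounded_le (hC0 x0) n x
    · exact ae_of_all _ fun x => StronglyMeasurable.tendsto_approxBounded_of_norm_le hs (hC x)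
  refine tendsto_nhds_unique (tendsto_const_nhds.inner l1) (l2.congr fun n => ?_)
  exact ((hsimple _).2).symm

/-- Superpositions of characters: `(∫ m(ν) e^{iκνx} dν)(A) = ∫ m(ν) e^{iκνA} dν`, weakly. -/
theorem IsBorelHom.inner_integral_exp {Φ : (ℝ → ℂ) → E →L[ℂ] E} (h : IsBorelHom Φ)
    {m : ℝ → ℂ} (hm : Integrable m) (κ : ℝ) {F : ℝ → ℂ}
    (hF : ∀ x : ℝ, F x = ∫ ν, m ν * Complex.exp (Complex.I * ((κ * ν : ℝ) : ℂ) * x)) (u v : E) :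
    Integrable (fun ν => m ν *
        ⟪u, Φ (fun x => Complex.exp (Complex.I * ((κ * ν : ℝ) : ℂ) * x)) v⟫_ℂ) ∧
    ⟪u, Φ F v⟫_ℂ = ∫ ν, m ν *
        ⟪u, Φ (fun x => Complex.exp (Complex.I * ((κ * ν : ℝ) : ℂ) * x)) v⟫_ℂ := by
  let e : ℝ → ℝ → ℂ := fun ν x => Complex.exp (Complex.I * ((κ * ν : ℝ) : ℂ) * x)
  have hprod : ∀ (μ : Measure ℝ) [IsFiniteMeasure μ],
      Integrable (fun z : ℝ × ℝ => m z.1 * e z.1 z.2) (volume.prod μ) := by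
    intro μ _
    have h1 : Integrable (fun z : ℝ × ℝ => m z.1 * 1) (volume.prod μ) :=
      hm.mul_prod (integrable_const (1 : ℂ))
    simp only [mul_one] at h1
    refine h1.mul_bdd (c := 1) ?_ (ae_of_all _ fun z => ?_)
    · exact (by fun_prop : Continuous fun z : ℝ × ℝ => e z.1 z.2).aestronglyMeasurable
    · obtain ⟨-, -⟩ := bddBorel_exp (κ * z.1)
      have : Complex.I * ((κ * z.1 : ℝ) : ℂ) * z.2 = ((κ * z.1 * z.2 : ℝ) : ℂ) * Complex.I := by
        push_cast; ring
      simp only [e]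
      rw [this, Complex.norm_exp_ofReal_mul_I]
  have hFb : BddBorel F := by
    have hFe : F = fun x => ∫ ν, m ν * e ν x := funext hF
    refine ⟨?_, ∫ ν, ‖m ν‖, fun x => ?_⟩
    · rw [hFe]
      have : Continuous fun x => ∫ ν, m ν * e ν x := by
        refine continuous_of_dominated (bound := fun ν => ‖m ν‖) ?_ ?_ hm.norm ?_
        · exact fun x => hm.aestronglyMeasurable.mul
            (by fun_prop : Continuous fun ν => e ν x).aestronglyMeasurable
        · refine fun x => ae_of_all _ fun ν => ?_
          have : Complex.I * ((κ * ν : ℝ) : ℂ) * x = ((κ * ν * x : ℝ) : ℂ) * Complex.I := by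
            push_cast; ring
          simp only [e, norm_mul]
          rw [this, Complex.norm_exp_ofReal_mul_I, mul_one]
        · exact ae_of_all _ fun ν => by fun_prop
      exact this.measurable
    · rw [hF]
      refine (norm_integral_le_integral_norm _).trans (le_of_eq ?_)
      congr 1
      ext ν
      have : Complex.I * ((κ * ν : ℝ) : ℂ) * x = ((κ * ν * x : ℝ) : ℂ) * Complex.I := by
        push_cast; ring
      rw [norm_mul, this, Complex.norm_exp_ofReal_mul_I, mul_one]
  -- On the diagonal the matrix element is an integral against a finite measure, so the identity is
  -- Fubini's theorem.
  have diag : ∀ w : E, Integrable (fun ν => m ν * ⟪w, Φ (e ν) w⟫_ℂ) ∧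
      ⟪w, Φ F w⟫_ℂ = ∫ ν, m ν * ⟪w, Φ (e ν) w⟫_ℂ := by
    intro w
    obtain ⟨μ, hμ, hμf⟩ := h.exists_spectralMeasure w
    have he : ∀ ν, m ν * ⟪w, Φ (e ν) w⟫_ℂ = ∫ x, m ν * e ν x ∂μ := by
      intro ν
      rw [hμf _ (bddBorel_exp _), integral_const_mul]
    simp only [he]
    refine ⟨(hprod μ).integral_prod_left, ?_⟩
    rw [hμf F hFb, integral_integral_swap (hprod μ)]
    exact integral_congr_ae (ae_of_all _ hF)
  -- Polarization reduces general matrix elements to diagonal ones.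
  have pol : ∀ T : E →L[ℂ] E, ⟪u, T v⟫_ℂ =
      (⟪u + v, T (u + v)⟫_ℂ - ⟪u - v, T (u - v)⟫_ℂ
        - Complex.I * ⟪u + Complex.I • v, T (u + Complex.I • v)⟫_ℂ
        + Complex.I * ⟪u - Complex.I • v, T (u - Complex.I • v)⟫_ℂ) / 4 := by
    intro T
    simp only [_root_.map_add, _root_.map_sub, _root_.map_smul, inner_add_left, inner_add_right, inner_sub_left, inner_sub_right,
      inner_smul_left, inner_smul_right, Complex.conj_I]
    linear_combination (1 / 2 * ⟪u, T v⟫_ℂ - 1 / 2 * ⟪v, T u⟫_ℂ) * (Complex.I_sq)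
  obtain ⟨i1, d1⟩ := diag (u + v)
  obtain ⟨i2, d2⟩ := diag (u - v)
  obtain ⟨i3, d3⟩ := diag (u + Complex.I • v)
  obtain ⟨i4, d4⟩ := diag (u - Complex.I • v)
  have he : ∀ ν, m ν * ⟪u, Φ (e ν) v⟫_ℂ = ((m ν * ⟪u + v, Φ (e ν) (u + v)⟫_ℂ
        - m ν * ⟪u - v, Φ (e ν) (u - v)⟫_ℂ)
        - Complex.I * (m ν * ⟪u + Complex.I • v, Φ (e ν) (u + Complex.I • v)⟫_ℂ)
        + Complex.I * (m ν * ⟪u - Complex.I • v, Φ (e ν) (u - Complex.I • v)⟫_ℂ)) / 4 := by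
    intro ν
    rw [pol (Φ (e ν))]
    ring
  have hi := ((i1.sub i2).sub (i3.const_mul Complex.I)).add (i4.const_mul Complex.I)
  constructor
  · refine (hi.div_const 4).congr (ae_of_all _ fun ν => ?_)
    exact (he ν).symm
  · change _ = ∫ ν, m ν * ⟪u, Φ (e ν) v⟫_ℂ
    simp only [he]
    have e1 := integral_add ((i1.sub i2).sub (i3.const_mul Complex.I)) (i4.const_mul Complex.I)
    have e2 := integral_sub (i1.sub i2) (i3.const_mul Complex.I)
    have e3 := integral_sub i1 i2
    simp only [Pi.sub_apply] at e1 e2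
    rw [integral_div, e1, e2, e3, integral_const_mul, integral_const_mul, ← d1, ← d2, ← d3, ← d4,
      pol (Φ F)]

end SpectralMeasure

end SigalSoffer

namespace SigalSoffer

/-! ### Self-adjoint operators: domains and the unitary group -/

section SelfAdjoint
variable {E : Type*} [NormedAddCommGroup E] [InnerProductSpace ℂ E] [CompleteSpace E]
variable {A : E →ₗ.[ℂ] E} {Φ : (ℝ → ℂ) → E →L[ℂ] E} {f : ℝ → ℂ}
set_option linter.unusedSectionVars false

theorem inner_apply_left (hA : IsSelfAdjoint A) (u v : A.domain) :
    ⟪A u, (v : E)⟫_ℂ = ⟪(u : E), A v⟫_ℂ := by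
  have h := A.adjoint_isFormalAdjoint hA.dense_domain
  rw [LinearPMap.isSelfAdjoint_def.1 hA] at h
  exact h u v

/-- The hypothesis puts v in the domain of the adjoint, which is A itself. This is the only way
membership in an operator domain is established below. -/
theorem mem_domain_of_inner (hA : IsSelfAdjoint A) {v z : E}
    (h : ∀ w : A.domain, ⟪A w, v⟫_ℂ = ⟪(w : E), z⟫_ℂ) :
    ∃ hv : v ∈ A.domain, A ⟨v, hv⟩ = z := by
  have h' : ∀ w : A.domain, ⟪z, (w : E)⟫_ℂ = ⟪v, A w⟫_ℂ := fun w => by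
    rw [← inner_conj_symm, ← h w, inner_conj_symm]
  have hv : v ∈ A.adjoint.domain := LinearPMap.mem_adjoint_domain_of_exists v ⟨z, h'⟩
  have hv' : v ∈ A.domain := by rwa [LinearPMap.isSelfAdjoint_def.1 hA] at hv
  refine ⟨hv', ?_⟩
  refine hA.dense_domain.eq_of_inner_right (𝕜 := ℂ) fun w hw => ?_
  rw [← inner_apply_left hA ⟨w, hw⟩ ⟨v, hv'⟩]
  exact h ⟨w, hw⟩

/-- Truncations of the identity function. -/
def clip (n : ℕ) (x : ℝ) : ℝ := max (-n) (min x n)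

theorem abs_clip_le (n : ℕ) (x : ℝ) : |clip n x| ≤ |x| := by
  have hn : (0 : ℝ) ≤ n := n.cast_nonneg
  unfold clip
  rcases le_total x n with h | h <;> rcases le_total x (-n) with h' | h'
  · rw [min_eq_left h, max_eq_left h', abs_neg, abs_of_nonneg hn]
    exact le_trans (by linarith) (neg_le_abs x)
  · rw [min_eq_left h, max_eq_right h']
  · linarith [abs_nonneg x, show x = 0 by linarith, show (n : ℝ) = 0 by linarith,
      (by rw [min_eq_right h, max_eq_right (by linarith), abs_of_nonneg hn]; linarith [le_abs_self x] :
        |max (-(n : ℝ)) (min x n)| ≤ |x|)]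
  · rw [min_eq_right h, max_eq_right (by linarith), abs_of_nonneg hn]
    exact h.trans (le_abs_self x)

theorem tendsto_clip (x : ℝ) : Tendsto (fun n => clip n x) atTop (𝓝 x) := by
  refine tendsto_const_nhds.congr' ?_
  obtain ⟨N, hN⟩ := exists_nat_ge |x|
  filter_upwards [eventually_ge_atTop N] with n hn
  have : |x| ≤ n := hN.trans (by exact_mod_cast hn)
  obtain ⟨h1, h2⟩ := abs_le.1 this
  rw [clip, min_eq_left h2, max_eq_right h1]

theorem bddBorel_clip (n : ℕ) : BddBorel fun x => (clip n x : ℂ) := by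
  refine ⟨by unfold clip; fun_prop, n, fun x => ?_⟩
  rw [Complex.norm_real, Real.norm_eq_abs, abs_le, clip]
  exact ⟨le_max_left _ _, max_le (by linarith [n.cast_nonneg (α := ℝ)]) (min_le_right _ _)⟩

theorem IsBorelCalculus.tendsto_clip (h : IsBorelCalculus A Φ) (u : A.domain) :
    Tendsto (fun n => Φ (fun x => (clip n x : ℂ)) (u : E)) atTop (𝓝 (A u)) := by
  refine h.tendsto_id _ bddBorel_clip (fun n x => ?_) (fun x => ?_) u
  · rw [Complex.norm_real, Real.norm_eq_abs]
    exact abs_clip_le n x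
  · exact (Complex.continuous_ofReal.tendsto _).comp (SigalSoffer.tendsto_clip x)

theorem IsBorelCalculus.clip_inner (h : IsBorelCalculus A Φ) (n : ℕ) (u v : E) :
    ⟪Φ (fun x => (clip n x : ℂ)) u, v⟫_ℂ = ⟪u, Φ (fun x => (clip n x : ℂ)) v⟫_ℂ := by
  rw [h.toIsBorelHom.inner_left (bddBorel_clip n)]
  simp

/-- Functions of `A` leave the domain of `A` invariant and commute with `A`. -/
theorem IsBorelCalculus.apply_mem_domain (h : IsBorelCalculus A Φ) (hA : IsSelfAdjoint A)
    (hf : BddBorel f) (u : A.domain) :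
    ∃ hv : Φ f (u : E) ∈ A.domain, A ⟨_, hv⟩ = Φ f (A u) := by
  refine mem_domain_of_inner hA fun w => ?_
  -- The identity to be proved holds for the bounded truncations of A, which commute with f(A); both
  -- sides converge as the truncation is removed.
  have h1 := (h.tendsto_clip w).inner (𝕜 := ℂ) (tendsto_const_nhds (x := Φ f (u : E)))
  have h2 := (tendsto_const_nhds (x := (w : E))).inner (𝕜 := ℂ)
    (((Φ f).continuous.tendsto _).comp (h.tendsto_clip u))
  refine tendsto_nhds_unique h1 (h2.congr fun n => ?_)
  rw [h.clip_inner, Function.comp_apply, h.toIsBorelHom.commute_apply hf (bddBorel_clip n)]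

/-- The range of `f(A)` lies in the domain of `A` when `x f(x)` is bounded. -/
theorem IsBorelCalculus.range_mem_domain (h : IsBorelCalculus A Φ) (hA : IsSelfAdjoint A)
    (hf : BddBorel f) (hf' : BddBorel fun x : ℝ => (x : ℂ) * f x) (v : E) :
    ∃ hv : Φ f v ∈ A.domain, A ⟨_, hv⟩ = Φ (fun x : ℝ => (x : ℂ) * f x) v := by
  refine mem_domain_of_inner hA fun w => ?_
  have h1 := (h.tendsto_clip w).inner (𝕜 := ℂ) (tendsto_const_nhds (x := Φ f v))
  obtain ⟨C, hC⟩ := hf'.2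
  have h3 := h.tendsto_of_bounded (fun n x => (clip n x : ℂ) * f x) (fun x => (x : ℂ) * f x) C
    (fun n => (bddBorel_clip n).1.mul hf.1)
    (fun n x => by
      refine le_trans ?_ (hC x)
      rw [norm_mul, norm_mul, Complex.norm_real, Complex.norm_real]
      exact mul_le_mul_of_nonneg_right (abs_clip_le n x) (norm_nonneg _))
    (fun x => ((Complex.continuous_ofReal.tendsto _).comp
      (SigalSoffer.tendsto_clip x)).mul_const _) v
  have h2 := (tendsto_const_nhds (x := (w : E))).inner (𝕜 := ℂ) h3
  refine tendsto_nhds_unique h1 (h2.congr fun n => ?_)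
  rw [h.clip_inner, h.toIsBorelHom.mul_apply (bddBorel_clip n) hf]

/-- The unitary group `e^{iλA}`. -/
noncomputable def grp (Φ : (ℝ → ℂ) → E →L[ℂ] E) (r : ℝ) : E →L[ℂ] E :=
  Φ fun x => Complex.exp (Complex.I * r * x)

theorem IsBorelHom.grp_zero (h : IsBorelHom Φ) : grp Φ 0 = 1 := by
  simp [grp, h.map_one]

theorem IsBorelHom.grp_add (h : IsBorelHom Φ) (r s : ℝ) (u : E) :
    grp Φ (r + s) u = grp Φ r (grp Φ s u) := by
  rw [grp, grp, grp, h.mul_apply (bddBorel_exp r) (bddBorel_exp s)]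
  congr 2
  ext x
  rw [← Complex.exp_add]
  congr 1
  push_cast
  ring

theorem IsBorelHom.grp_inner (h : IsBorelHom Φ) (r : ℝ) (u v : E) :
    ⟪grp Φ r u, v⟫_ℂ = ⟪u, grp Φ (-r) v⟫_ℂ := by
  rw [grp, h.inner_left (bddBorel_exp r), grp]
  congr 3
  ext x
  rw [RCLike.star_def, ← Complex.exp_conj]
  simp

theorem IsBorelHom.grp_neg_grp (h : IsBorelHom Φ) (r : ℝ) (u : E) :
    grp Φ (-r) (grp Φ r u) = u := by
  rw [← h.grp_add]
  simp [h.grp_zero]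

theorem IsBorelHom.norm_grp (h : IsBorelHom Φ) (r : ℝ) (u : E) : ‖grp Φ r u‖ = ‖u‖ := by
  have h1 : ⟪grp Φ r u, grp Φ r u⟫_ℂ = ⟪u, u⟫_ℂ := by rw [h.grp_inner, h.grp_neg_grp]
  rw [inner_self_eq_norm_sq_to_K, inner_self_eq_norm_sq_to_K] at h1
  have h2 : ‖grp Φ r u‖ ^ 2 = ‖u‖ ^ 2 := by exact_mod_cast h1
  exact (pow_left_inj₀ (norm_nonneg _) (norm_nonneg _) two_ne_zero).1 h2

theorem hasDerivAt_clm_apply (B : E →L[ℂ] E) {w : ℝ → E} {w' : E} {r : ℝ}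
    (h : HasDerivAt w w' r) : HasDerivAt (fun r => B (w r)) (B w') r :=
  (B.restrictScalars ℝ).hasFDerivAt.comp_hasDerivAt r h

/-- The difference quotients (e^{irx} − 1)/(ir) are bounded by |x| and tend to x, so they are
bounded approximations of the identity function in the sense of `tendsto_id`. -/
theorem IsBorelCalculus.hasDerivAt_grp_zero (h : IsBorelCalculus A Φ) (u : A.domain) :
    HasDerivAt (fun r => grp Φ r (u : E)) (Complex.I • A u) 0 := by
  rw [hasDerivAt_iff_tendsto_slope_zero]
  refine tendsto_of_seq_tendsto fun t ht => ?_
  rw [tendsto_nhdsWithin_iff] at ht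
  obtain ⟨ht0, htn⟩ := ht
  let F : ℕ → ℝ → ℂ := fun n x => (t n * Complex.I : ℂ)⁻¹ * (Complex.exp (Complex.I * t n * x) - 1)
  have hexp : ∀ (r x : ℝ), Complex.I * r * x = Complex.I * ((r * x : ℝ) : ℂ) := fun r x => by
    push_cast; ring
  have hF : ∀ n, BddBorel (F n) := fun n =>
    ((bddBorel_exp (t n)).fun_sub (bddBorel_const 1)).fun_const_mul _
  have hb : ∀ n x, ‖F n x‖ ≤ |x| := by
    intro n x
    simp only [F]
    rw [norm_mul, norm_inv, norm_mul, Complex.norm_I, mul_one, Complex.norm_real, hexp]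
    have := Real.norm_exp_I_mul_ofReal_sub_one_le (x := t n * x)
    rw [Real.norm_eq_abs, abs_mul] at this
    rw [Real.norm_eq_abs]
    by_cases h0 : t n = 0
    · simp [h0]
    · calc |t n|⁻¹ * ‖Complex.exp (Complex.I * ((t n * x : ℝ) : ℂ)) - 1‖
          ≤ |t n|⁻¹ * (|t n| * |x|) := by gcongr
        _ = |x| := by rw [inv_mul_cancel_left₀ (abs_ne_zero.2 h0)]
  have hl : ∀ x : ℝ, Tendsto (fun n => F n x) atTop (𝓝 (x : ℂ)) := by
    intro x
    have hd : HasDerivAt (fun r : ℝ => Complex.exp (Complex.I * r * x)) (Complex.I * x) 0 := by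
      have h1 : HasDerivAt (fun r : ℝ => Complex.I * r * x) (Complex.I * 1 * x) 0 :=
        ((hasDerivAt_id (0 : ℝ)).ofReal_comp.const_mul Complex.I).mul_const (x : ℂ)
      simpa using h1.cexp
    rw [hasDerivAt_iff_tendsto_slope_zero] at hd
    have h2 := (hd.comp (tendsto_nhdsWithin_iff.2 ⟨ht0, htn⟩)).const_mul Complex.I⁻¹
    rw [inv_mul_cancel_left₀ Complex.I_ne_zero] at h2
    refine h2.congr fun n => ?_
    simp only [F, Function.comp_apply, zero_add, Complex.ofReal_zero, mul_zero, zero_mul,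
      Complex.exp_zero, Complex.real_smul, mul_inv, Complex.ofReal_inv]
    ring
  have h3 := (h.tendsto_id F hF hb hl u).const_smul Complex.I
  refine h3.congr' ?_
  filter_upwards with n
  have h4 : Φ (F n) = (t n * Complex.I : ℂ)⁻¹ • (grp Φ (t n) - 1) := by
    rw [h.map_smul _ _ ((bddBorel_exp (t n)).fun_sub (bddBorel_const 1)),
      h.toIsBorelHom.map_sub (bddBorel_exp (t n)) (bddBorel_const 1), h.map_one]
    rfl
  simp only [Function.comp_apply, zero_add]
  rw [h4, h.toIsBorelHom.grp_zero, smul_apply, sub_apply, one_apply_eq_self, smul_smul,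
    mul_inv, mul_left_comm, mul_inv_cancel₀ Complex.I_ne_zero, mul_one, ← Complex.ofReal_inv]
  rfl

theorem IsBorelCalculus.hasDerivAt_grp (h : IsBorelCalculus A Φ) (u : A.domain) (r : ℝ) :
    HasDerivAt (fun r => grp Φ r (u : E)) (Complex.I • grp Φ r (A u)) r := by
  have h1 := h.hasDerivAt_grp_zero u
  rw [← sub_self r] at h1
  have h2 := h1.comp_sub_const r r
  have h3 := hasDerivAt_clm_apply (grp Φ r) h2
  rw [_root_.map_smul] at h3
  refine h3.congr_of_eventuallyEq (Eventually.of_forall fun s => ?_)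
  change grp Φ s (u : E) = grp Φ r (grp Φ (s - r) (u : E))
  rw [← h.toIsBorelHom.grp_add]
  simp

end SelfAdjoint

/-! ### Iterated commutators and Taylor's formula for the conjugated operator -/

section Commutators
variable {E : Type*} [NormedAddCommGroup E] [InnerProductSpace ℂ E] [CompleteSpace E]
variable {A : E →ₗ.[ℂ] E} {Φ : (ℝ → ℂ) → E →L[ℂ] E} {B T S : E →L[ℂ] E}
set_option linter.unusedSectionVars false

theorem ext_of_inner_domain (hA : Dense (A.domain : Set E))
    (h : ∀ u v : A.domain, ⟪(u : E), T v⟫_ℂ = ⟪(u : E), S v⟫_ℂ) : T = S := by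
  refine ContinuousLinearMap.ext_on (s := (A.domain : Set E)) (by rwa [Submodule.span_eq])
    fun v hv => ?_
  exact hA.eq_of_inner_right (𝕜 := ℂ) fun w hw => h ⟨w, hw⟩ ⟨v, hv⟩

theorem IsCommutator.unique (hA : Dense (A.domain : Set E)) (h1 : IsCommutator A B T)
    (h2 : IsCommutator A B S) : T = S :=
  ext_of_inner_domain hA fun u v => by rw [h1 u v, h2 u v]

theorem IsAd.unique (hA : Dense (A.domain : Set E)) {k : ℕ} : ∀ {T S : E →L[ℂ] E},
    IsAd A B k T → IsAd A B k S → T = S := by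
  induction k with
  | zero => intro T S h1 h2; exact h1.trans h2.symm
  | succ k ih =>
    rintro T S ⟨T', h1, h1'⟩ ⟨S', h2, h2'⟩
    obtain rfl := ih h1 h2
    exact h1'.unique hA h2'

/-- Boundedness of the commutator form is what makes B preserve the domain of A. -/
theorem IsCommutator.apply_mem_domain (hA : IsSelfAdjoint A) (h : IsCommutator A B T)
    (v : A.domain) : ∃ hv : B (v : E) ∈ A.domain, A ⟨_, hv⟩ = B (A v) - T (v : E) :=
  mem_domain_of_inner hA fun w => by rw [inner_sub_right, h w v]; ring

/-- `T k` is the `k`-th iterated commutator of `T 0` with `A`. -/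
def IsChain (A : E →ₗ.[ℂ] E) (T : ℕ → E →L[ℂ] E) : Prop :=
  ∀ k, IsCommutator A (T k) (T (k + 1))

theorem IsChain.shift {T : ℕ → E →L[ℂ] E} (h : IsChain A T) (m : ℕ) :
    IsChain A fun k => T (k + m) := fun k => by
  have := h (k + m)
  rwa [add_right_comm] at this

/-- Each `IsAd` statement carries its own lower commutators. Uniqueness, from density of the domain,
makes them agree, so that one sequence serves all orders. -/
theorem exists_chain (hA : Dense (A.domain : Set E)) (h : ∀ k, ∃ T, IsAd A B k T) :
    ∃ T : ℕ → E →L[ℂ] E, T 0 = B ∧ IsChain A T ∧ ∀ k, IsAd A B k (T k) := by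
  choose T hT using h
  refine ⟨T, hT 0, fun k => ?_, hT⟩
  obtain ⟨S, h1, h2⟩ := hT (k + 1)
  rwa [IsAd.unique hA h1 (hT k)] at h2

/-- The Taylor remainder of `e^{-irA} T₀ e^{irA}`. -/
noncomputable def taylorRem (Φ : (ℝ → ℂ) → E →L[ℂ] E) (T : ℕ → E →L[ℂ] E) (n : ℕ) (r : ℝ) (u v : E) : ℂ :=
  ⟪grp Φ r u, T 0 (grp Φ r v)⟫_ℂ -
    ∑ k ∈ Finset.range n, (Complex.I * r) ^ k / (k.factorial : ℂ) * ⟪u, T k v⟫_ℂ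

theorem hasDerivAt_inner_conj (h : IsBorelCalculus A Φ) (hA : IsSelfAdjoint A)
    (hBT : IsCommutator A B T) (u v : A.domain) (r : ℝ) :
    HasDerivAt (fun r => ⟪grp Φ r (u : E), B (grp Φ r (v : E))⟫_ℂ)
      (Complex.I * ⟪grp Φ r (u : E), T (grp Φ r (v : E))⟫_ℂ) r := by
  obtain ⟨hu, hu'⟩ := h.apply_mem_domain hA (bddBorel_exp r) u
  obtain ⟨hv, hv'⟩ := h.apply_mem_domain hA (bddBorel_exp r) v
  have h1 := (h.hasDerivAt_grp u r).inner ℂ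
    (hasDerivAt_clm_apply B (h.hasDerivAt_grp v r))
  refine h1.congr_deriv ?_
  have h2 := hBT ⟨_, hu⟩ ⟨_, hv⟩
  rw [hu', hv'] at h2
  simp only at h2
  simp only [_root_.map_smul, inner_smul_left, inner_smul_right, Complex.conj_I]
  change Complex.I * ⟪grp Φ r (u : E), B (grp Φ r (A v))⟫_ℂ +
    -Complex.I * ⟪grp Φ r (A u), B (grp Φ r (v : E))⟫_ℂ =
    Complex.I * ⟪grp Φ r (u : E), T (grp Φ r (v : E))⟫_ℂ
  change ⟪grp Φ r (u : E), T (grp Φ r (v : E))⟫_ℂ = ⟪grp Φ r (u : E), B (grp Φ r (A v))⟫_ℂ -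
    ⟪grp Φ r (A u), B (grp Φ r (v : E))⟫_ℂ at h2
  rw [h2]
  ring

/-- Differentiating e^{-irA} T₀ e^{irA} replaces T₀ by i[T₀, A] = iT₁, and differentiating the
Taylor polynomial lowers its degree: the derivative is again a remainder, of lower order and for the
shifted chain. -/
theorem hasDerivAt_taylorRem (h : IsBorelCalculus A Φ) (hA : IsSelfAdjoint A)
    {T : ℕ → E →L[ℂ] E} (hT : IsChain A T) (n : ℕ) (u v : A.domain) (r : ℝ) :
    HasDerivAt (fun r => taylorRem Φ T (n + 1) r u v)
      (Complex.I * taylorRem Φ (fun k => T (k + 1)) n r u v) r := by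
  have h1 := hasDerivAt_inner_conj h hA (hT 0) u v r
  have h2 : ∀ k : ℕ, HasDerivAt
      (fun r : ℝ => (Complex.I * r) ^ (k + 1) / ((k + 1).factorial : ℂ) * ⟪(u : E), T (k + 1) v⟫_ℂ)
      (Complex.I * ((Complex.I * r) ^ k / (k.factorial : ℂ) * ⟪(u : E), T (k + 1) v⟫_ℂ)) r := by
    intro k
    have h3 : HasDerivAt (fun r : ℝ => Complex.I * (r : ℂ)) (Complex.I * 1) r :=
      (hasDerivAt_id r).ofReal_comp.const_mul Complex.I
    refine (((h3.pow (k + 1)).div_const _).mul_const _).congr_deriv ?_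
    rw [Nat.factorial_succ]
    have : (k.factorial : ℂ) ≠ 0 := by exact_mod_cast k.factorial_ne_zero
    have : (k : ℂ) + 1 ≠ 0 := by exact_mod_cast k.succ_ne_zero
    push_cast
    field_simp
  have h3 := h1.sub (HasDerivAt.fun_sum fun k (_ : k ∈ Finset.range n) => h2 k)
  rw [← Finset.mul_sum, ← mul_sub] at h3
  -- The subtracted constant is the zeroth term of the Taylor polynomial, which does not contribute
  -- to the derivative.
  refine (h3.sub_const ⟪(u : E), T 0 v⟫_ℂ).congr_of_eventuallyEq (Eventually.of_forall fun s => ?_)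
  simp only [taylorRem, Finset.sum_range_succ', Pi.sub_apply]
  simp
  ring

/-- Induction on n: the remainder vanishes at r = 0 and its derivative is a remainder of order one
less, so the bound |r|ⁿ/n! integrates to the next one. Differentiation needs vectors in the domain
of A; density and continuity remove this restriction. -/
theorem norm_taylorRem_le (h : IsBorelCalculus A Φ) (hA : IsSelfAdjoint A) (n : ℕ) :
    ∀ {T : ℕ → E →L[ℂ] E}, IsChain A T → ∀ (r : ℝ) (u v : E),
    ‖taylorRem Φ T n r u v‖ ≤ |r| ^ n / n.factorial * (‖T n‖ * ‖u‖ * ‖v‖) := by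
  induction n with
  | zero =>
    intro T hT r u v
    simp only [taylorRem, Finset.range_zero, Finset.sum_empty, sub_zero, pow_zero,
      Nat.factorial_zero, Nat.cast_one, div_one, one_mul]
    refine (norm_inner_le_norm _ _).trans ?_
    have := (T 0).le_opNorm (grp Φ r v)
    rw [h.toIsBorelHom.norm_grp] at this ⊢
    nlinarith [norm_nonneg u]
  | succ n ih =>
    intro T hT r u v
    have hcont : ∀ r, Continuous fun p : E × E => taylorRem Φ T (n + 1) r p.1 p.2 := by
      intro r
      unfold taylorRem
      fun_prop
    suffices H : ∀ u v : A.domain, ‖taylorRem Φ T (n + 1) r u v‖ ≤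
        |r| ^ (n + 1) / (n + 1).factorial * (‖T (n + 1)‖ * ‖(u : E)‖ * ‖(v : E)‖) by
      have hcl : IsClosed {p : E × E | ‖taylorRem Φ T (n + 1) r p.1 p.2‖ ≤
          |r| ^ (n + 1) / (n + 1).factorial * (‖T (n + 1)‖ * ‖p.1‖ * ‖p.2‖)} :=
        isClosed_le (hcont r).norm (by fun_prop)
      have hd : Dense ((A.domain : Set E) ×ˢ (A.domain : Set E)) :=
        hA.dense_domain.prod hA.dense_domain
      have := hcl.closure_subset_iff.2 (fun p (hp : p ∈ (A.domain : Set E) ×ˢ (A.domain : Set E)) =>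
        H ⟨p.1, hp.1⟩ ⟨p.2, hp.2⟩)
      exact this (hd (u, v))
    intro u v
    set M := ‖T (n + 1)‖ * ‖(u : E)‖ * ‖(v : E)‖
    have hM : 0 ≤ M := by positivity
    have hder := hasDerivAt_taylorRem h hA hT n u v
    have hz : taylorRem Φ T (n + 1) 0 u v = 0 := by
      simp [taylorRem, Finset.sum_range_succ', h.toIsBorelHom.grp_zero]
    have hb : ∀ r, ‖Complex.I * taylorRem Φ (fun k => T (k + 1)) n r u v‖ ≤
        |r| ^ n / n.factorial * M := by
      intro r
      rw [norm_mul, Complex.norm_I, one_mul]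
      exact ih (hT.shift 1) r u v
    have hB : ∀ x : ℝ, HasDerivAt (fun x : ℝ => x ^ (n + 1) / (n + 1).factorial * M)
        (x ^ n / n.factorial * M) x := by
      intro x
      refine (((hasDerivAt_pow (n + 1) x).div_const _).mul_const _).congr_deriv ?_
      rw [Nat.factorial_succ]
      have h1 : (n.factorial : ℝ) ≠ 0 := by exact_mod_cast n.factorial_ne_zero
      have h2 : (n : ℝ) + 1 ≠ 0 := by exact_mod_cast n.succ_ne_zero
      push_cast
      field_simp
    have key : ∀ (G G' : ℝ → ℂ), (∀ r, HasDerivAt G (G' r) r) → G 0 = 0 →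
        (∀ r, ‖G' r‖ ≤ |r| ^ n / n.factorial * M) → ∀ r, 0 ≤ r →
        ‖G r‖ ≤ r ^ (n + 1) / (n + 1).factorial * M := by
      intro G G' hG h0 hG' r hr
      refine image_norm_le_of_norm_deriv_right_le_deriv_boundary (a := 0) (b := r)
        (fun x _ => (hG x).continuousAt.continuousWithinAt) (fun x _ => (hG x).hasDerivWithinAt)
        (by simp [h0]) hB (fun x hx => ?_) ⟨hr, le_rfl⟩
      have := hG' x
      rwa [abs_of_nonneg hx.1] at this
    rcases le_total 0 r with hr | hr
    · rw [abs_of_nonneg hr]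
      exact key _ _ hder hz hb r hr
    · have h1 := key (fun r => taylorRem Φ T (n + 1) (-r) u v) _
        (fun r => by
          have := (hder (-r)).scomp r (hasDerivAt_neg r)
          exact this) (by simpa using hz) (fun r => by
            rw [norm_smul, norm_neg, norm_one, one_mul]
            simpa using hb (-r)) (-r) (by linarith)
      rw [abs_of_nonpos hr]
      simpa using h1

end Commutators

end SigalSoffer

namespace SigalSoffer

/-! ### Weighted L¹ norms of Fourier transforms -/

section FourierSide
open MeasureTheory FourierTransform
variable {f g : ℝ → ℂ}

theorem contDiff_iteratedDeriv (hf : ContDiff ℝ ∞ f) (k : ℕ) : ContDiff ℝ ∞ (iteratedDeriv k f) := by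
  rw [iteratedDeriv_eq_iterate]
  exact hf.iterate_deriv k

theorem hasCompactSupport_iteratedDeriv (hf : HasCompactSupport f) (k : ℕ) :
    HasCompactSupport (iteratedDeriv k f) := by
  induction k with
  | zero => simpa using hf
  | succ k ih => rw [iteratedDeriv_succ]; exact ih.deriv

theorem integrable_pow_mul_fourier (hf : ContDiff ℝ ∞ f) (hs : HasCompactSupport f) (k : ℕ) :
    Integrable fun ν : ℝ => ((2 * Real.pi * ν : ℝ) : ℂ) ^ k * 𝓕 f ν := by
  have h := (𝓕 (hs.toSchwartzMap hf)).integrable_pow_mul volume k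
  rw [← integrable_norm_iff (by
    exact (Continuous.mul (by fun_prop)
      (𝓕 (hs.toSchwartzMap hf)).continuous : Continuous fun ν : ℝ =>
        ((2 * Real.pi * ν : ℝ) : ℂ) ^ k * 𝓕 (hs.toSchwartzMap hf) ν).aestronglyMeasurable)]
  refine (h.const_mul ((2 * Real.pi) ^ k)).congr (ae_of_all _ fun ν => ?_)
  simp only [norm_mul, norm_pow, Complex.norm_real, Real.norm_eq_abs]
  rw [abs_of_pos Real.pi_pos, abs_two, mul_pow _ |ν|, mul_assoc]
  rfl

theorem integrable_of_smooth (hf : ContDiff ℝ ∞ f) (hs : HasCompactSupport f) : Integrable f :=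
  hf.continuous.integrable_of_hasCompactSupport hs

theorem fourier_iteratedDeriv_eq (hf : ContDiff ℝ ∞ f) (hs : HasCompactSupport f) (k : ℕ) (ν : ℝ) :
    𝓕 (iteratedDeriv k f) ν = (Complex.I * ((2 * Real.pi * ν : ℝ) : ℂ)) ^ k * 𝓕 f ν := by
  rw [Real.fourier_iteratedDeriv (N := ⊤) hf (fun n _ =>
    integrable_of_smooth (contDiff_iteratedDeriv hf n) (hasCompactSupport_iteratedDeriv hs n)) le_top]
  simp only [smul_eq_mul]
  congr 2
  push_cast
  ring

theorem iteratedDeriv_eq_integral (hf : ContDiff ℝ ∞ f) (hs : HasCompactSupport f) (k : ℕ) (y : ℝ) :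
    iteratedDeriv k f y = ∫ ν : ℝ, (Complex.I * ((2 * Real.pi * ν : ℝ) : ℂ)) ^ k * 𝓕 f ν *
      Complex.exp (Complex.I * ((2 * Real.pi * ν : ℝ) : ℂ) * y) := by
  have hk := contDiff_iteratedDeriv hf k
  have hks := hasCompactSupport_iteratedDeriv hs k
  have h1 := integrable_pow_mul_fourier hk hks 0
  simp only [pow_zero, one_mul] at h1
  have h2 := congrFun (hk.continuous.fourierInv_fourier_eq (integrable_of_smooth hk hks) h1) y
  rw [← h2, Real.fourierInv_eq']
  congr 1
  ext ν
  rw [fourier_iteratedDeriv_eq hf hs, smul_eq_mul, mul_comm]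
  congr 2
  simp only [RCLike.inner_apply, conj_trivial]
  push_cast
  ring

theorem norm_fourier_comp_add (L ν : ℝ) : ‖𝓕 (fun x => g (x + L)) ν‖ = ‖𝓕 g ν‖ := by
  have h : 𝓕 (fun x => g (x + L)) ν =
      Complex.exp (((2 * Real.pi * L * ν : ℝ) : ℂ) * Complex.I) * 𝓕 g ν := by
    rw [Real.fourier_real_eq_integral_exp_smul, Real.fourier_real_eq_integral_exp_smul,
      ← integral_const_mul,
      ← integral_add_right_eq_self (fun v : ℝ => Complex.exp (((2 * Real.pi * L * ν : ℝ) : ℂ) *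
        Complex.I) * (Complex.exp (((-2 * Real.pi * v * ν : ℝ) : ℂ) * Complex.I) • g v)) L]
    congr 1
    ext v
    rw [smul_eq_mul, smul_eq_mul, ← mul_assoc, ← Complex.exp_add]
    congr 2
    push_cast
    ring
  rw [h, norm_mul, Complex.norm_exp_ofReal_mul_I, one_mul]

/-- The weighted `L¹` norm of the Fourier transform. -/
noncomputable def fourierWeight (n : ℕ) (f : ℝ → ℂ) : ℝ :=
  ∫ ν : ℝ, ‖((2 * Real.pi * ν : ℝ) : ℂ) ^ n * 𝓕 f ν‖

theorem fourierWeight_nonneg (n : ℕ) (f : ℝ → ℂ) : 0 ≤ fourierWeight n f :=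
  integral_nonneg fun _ => norm_nonneg _

/-- One factor of 2πν turns the function into its derivative f' − f'(· + L), and translation only
changes the phase of a Fourier transform. The bound is therefore uniform in L, although f itself
need not be integrable. -/
theorem fourierWeight_sub_translate_le (n : ℕ) (hf : ContDiff ℝ ∞ f)
    (hs : HasCompactSupport (deriv f)) (L : ℝ) (hL : HasCompactSupport fun x => f x - f (x + L)) :
    fourierWeight (n + 1) (fun x => f x - f (x + L)) ≤ 2 * fourierWeight n (deriv f) := by
  have hd : ContDiff ℝ ∞ (deriv f) := by simpa using contDiff_iteratedDeriv hf 1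
  have hLc : ContDiff ℝ ∞ fun x => f x - f (x + L) :=
    hf.sub (hf.comp (contDiff_id.add contDiff_const))
  have hdd : Differentiable ℝ f := hf.differentiable (by simp)
  have hder : deriv (fun x => f x - f (x + L)) = fun x => deriv f x - deriv f (x + L) := by
    ext x
    have h1 : DifferentiableAt ℝ (fun x => f (x + L)) x :=
      (hdd.comp (differentiable_id.add_const L)) x
    rw [deriv_fun_sub (hdd x) h1, deriv_comp_add_const]
  have hi1 := integrable_of_smooth hd hs
  have hi2 : Integrable fun x => deriv f (x + L) := hi1.comp_add_right L
  have key : ∀ ν : ℝ, ‖((2 * Real.pi * ν : ℝ) : ℂ) ^ (n + 1) * 𝓕 (fun x => f x - f (x + L)) ν‖ ≤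
      2 * ‖((2 * Real.pi * ν : ℝ) : ℂ) ^ n * 𝓕 (deriv f) ν‖ := by
    intro ν
    have h1 := fourier_iteratedDeriv_eq hLc hL 1 ν
    rw [iteratedDeriv_one, hder, pow_one] at h1
    have h2 : 𝓕 (fun x => deriv f x - deriv f (x + L)) ν =
        𝓕 (deriv f) ν - 𝓕 (fun x => deriv f (x + L)) ν := by
      have hint : ∀ {g : ℝ → ℂ}, Integrable g → Integrable fun v : ℝ =>
          Complex.exp (((-2 * Real.pi * v * ν : ℝ) : ℂ) * Complex.I) • g v := fun hg =>
        hg.bdd_mul (c := 1) (by fun_prop : Continuous _).aestronglyMeasurable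
          (ae_of_all _ fun v => by rw [Complex.norm_exp_ofReal_mul_I])
      simp only [Real.fourier_real_eq_integral_exp_smul]
      rw [← integral_sub (hint hi1) (hint hi2)]
      simp only [smul_sub]
    have h3 : ‖((2 * Real.pi * ν : ℝ) : ℂ)‖ * ‖𝓕 (fun x => f x - f (x + L)) ν‖ ≤
        2 * ‖𝓕 (deriv f) ν‖ := by
      have h4 := congrArg norm h1
      rw [norm_mul, norm_mul, Complex.norm_I, one_mul] at h4
      rw [← h4, h2]
      refine (norm_sub_le _ _).trans (le_of_eq ?_)
      rw [norm_fourier_comp_add]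
      ring
    rw [pow_succ, norm_mul, norm_mul, norm_mul, mul_assoc, mul_left_comm 2]
    exact mul_le_mul_of_nonneg_left h3 (norm_nonneg _)
  rw [fourierWeight, fourierWeight, ← integral_const_mul]
  refine integral_mono (integrable_pow_mul_fourier hLc hL (n + 1)).norm
    ((integrable_pow_mul_fourier hd hs n).norm.const_mul 2) key

end FourierSide

/-! ### The commutator expansion for compactly supported functions -/

section Compact
open MeasureTheory FourierTransform
variable {E : Type*} [NormedAddCommGroup E] [InnerProductSpace ℂ E] [CompleteSpace E]
variable {A : E →ₗ.[ℂ] E} {Φ : (ℝ → ℂ) → E →L[ℂ] E} {f : ℝ → ℂ} {s : ℝ}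

/-- The function `x ↦ f ((x - c) / s)`. -/
noncomputable def rescale (f : ℝ → ℂ) (s c : ℝ) (x : ℝ) : ℂ := f ((x - c) / s)

/-- The remainder in the commutator expansion of `T₀ f((A - c) / s)`. -/
noncomputable def commRem (Φ : (ℝ → ℂ) → E →L[ℂ] E) (T : ℕ → E →L[ℂ] E) (f : ℝ → ℂ) (s c : ℝ) (n : ℕ) :
    E →L[ℂ] E :=
  T 0 * Φ (rescale f s c) - ∑ k ∈ Finset.range n,
    ((s⁻¹ ^ k / k.factorial : ℝ) : ℂ) • (Φ (rescale (iteratedDeriv k f) s c) * T k)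

/-- Fourier inversion, read in the functional calculus with r = 2πν/s. The factors s⁻ᵏ turn (2πiν)ᵏ
into (ir)ᵏ, the powers that occur in the Taylor polynomial. -/
theorem inner_rescale_iteratedDeriv (h : IsBorelHom Φ) (hf : ContDiff ℝ ∞ f)
    (hs : HasCompactSupport f) (hs0 : 0 < s) (c : ℝ) (k : ℕ) (u v : E) :
    Integrable (fun ν : ℝ => 𝓕 f ν *
      Complex.exp (-(Complex.I * ((2 * Real.pi * ν / s * c : ℝ) : ℂ))) *
      ((Complex.I * ((2 * Real.pi * ν / s : ℝ) : ℂ)) ^ k * ⟪u, grp Φ (2 * Real.pi * ν / s) v⟫_ℂ)) ∧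
    ((s⁻¹ ^ k : ℝ) : ℂ) * ⟪u, Φ (rescale (iteratedDeriv k f) s c) v⟫_ℂ = ∫ ν : ℝ, 𝓕 f ν *
      Complex.exp (-(Complex.I * ((2 * Real.pi * ν / s * c : ℝ) : ℂ))) *
      ((Complex.I * ((2 * Real.pi * ν / s : ℝ) : ℂ)) ^ k * ⟪u, grp Φ (2 * Real.pi * ν / s) v⟫_ℂ) := by
  have hsc : (s : ℂ) ≠ 0 := by exact_mod_cast hs0.ne'
  have hm : Integrable fun ν : ℝ => (Complex.I * ((2 * Real.pi * ν : ℝ) : ℂ)) ^ k * 𝓕 f ν *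
      Complex.exp (-(Complex.I * ((2 * Real.pi * ν / s * c : ℝ) : ℂ))) := by
    have h1 := (integrable_pow_mul_fourier hf hs k).const_mul (Complex.I ^ k)
    refine ((h1.mul_bdd (c := 1)
      (g := fun ν : ℝ => Complex.exp (-(Complex.I * ((2 * Real.pi * ν / s * c : ℝ) : ℂ))))
      (by fun_prop : Continuous _).aestronglyMeasurable (ae_of_all _ fun ν => ?_))).congr
        (ae_of_all _ fun ν => ?_)
    · rw [← mul_neg, ← Complex.ofReal_neg, mul_comm, Complex.norm_exp_ofReal_mul_I]
    · simp only [mul_pow]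
      ring
  obtain ⟨h1, h2⟩ := h.inner_integral_exp hm (2 * Real.pi / s)
    (F := rescale (iteratedDeriv k f) s c) (fun x => by
      rw [rescale, iteratedDeriv_eq_integral hf hs]
      congr 1
      ext ν
      rw [mul_assoc _ (Complex.exp _), ← Complex.exp_add]
      congr 2
      push_cast
      field_simp
      ring) u v
  have he : ∀ ν : ℝ, 2 * Real.pi / s * ν = 2 * Real.pi * ν / s := fun ν => by ring
  have h3 : ∀ ν : ℝ, (Complex.I * ((2 * Real.pi * ν : ℝ) : ℂ)) ^ k * 𝓕 f ν *
      Complex.exp (-(Complex.I * ((2 * Real.pi * ν / s * c : ℝ) : ℂ))) *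
      ⟪u, Φ (fun x => Complex.exp (Complex.I * ((2 * Real.pi / s * ν : ℝ) : ℂ) * x)) v⟫_ℂ =
      (s : ℂ) ^ k * (𝓕 f ν *
      Complex.exp (-(Complex.I * ((2 * Real.pi * ν / s * c : ℝ) : ℂ))) *
      ((Complex.I * ((2 * Real.pi * ν / s : ℝ) : ℂ)) ^ k *
        ⟪u, grp Φ (2 * Real.pi * ν / s) v⟫_ℂ)) := by
    intro ν
    rw [he, grp]
    have : (Complex.I * ((2 * Real.pi * ν : ℝ) : ℂ)) =
      s * (Complex.I * ((2 * Real.pi * ν / s : ℝ) : ℂ)) := by push_cast; field_simp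
    rw [this, mul_pow]
    ring
  simp only [h3] at h1 h2
  have hsk : (s : ℂ) ^ k ≠ 0 := pow_ne_zero _ hsc
  refine ⟨?_, ?_⟩
  · have := h1.const_mul ((s : ℂ) ^ k)⁻¹
    simpa only [inv_mul_cancel_left₀ hsk] using this
  · rw [h2, integral_const_mul]
    push_cast
    rw [inv_pow, inv_mul_cancel_left₀ hsk]

/-- Since T₀ e^{irA} = e^{irA}(e^{-irA} T₀ e^{irA}), the remainder of the expansion is the integral
of Taylor remainders against the Fourier transform of f. The factor |r|ⁿ in their bound becomes the
weight |2πν|ⁿ times s⁻ⁿ. -/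
theorem norm_commRem_le_of_compact (h : IsBorelCalculus A Φ) (hA : IsSelfAdjoint A)
    {T : ℕ → E →L[ℂ] E} (hT : IsChain A T) (hf : ContDiff ℝ ∞ f)
    (hs : HasCompactSupport f) (hs0 : 0 < s) (c : ℝ) (n : ℕ) (u v : E) :
    ‖⟪u, commRem Φ T f s c n v⟫_ℂ‖ ≤
      fourierWeight n f / n.factorial * s⁻¹ ^ n * (‖T n‖ * ‖u‖ * ‖v‖) := by
  let r : ℝ → ℝ := fun ν => 2 * Real.pi * ν / s
  let m : ℝ → ℂ := fun ν => 𝓕 f ν * Complex.exp (-(Complex.I * ((r ν * c : ℝ) : ℂ)))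
  have hsum := fun k (w : E) => inner_rescale_iteratedDeriv h.toIsBorelHom hf hs hs0 c k u w
  obtain ⟨i0, e0⟩ := inner_rescale_iteratedDeriv h.toIsBorelHom hf hs hs0 c 0
    (ContinuousLinearMap.adjoint (T 0) u) v
  simp only [pow_zero, Complex.ofReal_one, one_mul, iteratedDeriv_zero] at i0 e0
  have hpt : ∀ ν, m ν * taylorRem Φ T n (r ν) (grp Φ (-r ν) u) v =
      m ν * ⟪ContinuousLinearMap.adjoint (T 0) u, grp Φ (r ν) v⟫_ℂ -
      ∑ k ∈ Finset.range n, (1 / (k.factorial : ℂ)) * (m ν *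
        ((Complex.I * (r ν : ℝ)) ^ k * ⟪u, grp Φ (r ν) (T k v)⟫_ℂ)) := by
    intro ν
    rw [taylorRem, mul_sub, Finset.mul_sum, ContinuousLinearMap.adjoint_inner_left]
    have h1 : grp Φ (r ν) (grp Φ (-r ν) u) = u := by
      have := h.toIsBorelHom.grp_neg_grp (-r ν) u
      rwa [neg_neg] at this
    rw [h1]
    congr 1
    refine Finset.sum_congr rfl fun k _ => ?_
    rw [h.toIsBorelHom.grp_inner, neg_neg]
    ring
  -- The unitary e^{irA} to the left of the Taylor remainder is moved onto u, where it becomes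
  -- e^{-irA}.
  have hmain : ⟪u, commRem Φ T f s c n v⟫_ℂ =
      ∫ ν, m ν * taylorRem Φ T n (r ν) (grp Φ (-r ν) u) v := by
    simp only [hpt]
    rw [integral_sub i0 (integrable_finsetSum _ fun k _ => ((hsum k (T k v)).1).const_mul _),
      integral_finsetSum _ (fun k _ => ((hsum k (T k v)).1).const_mul _), ← e0]
    simp only [integral_const_mul]
    rw [commRem, sub_apply, inner_sub_right, mul_apply_eq_comp, sum_apply, inner_sum,
      ContinuousLinearMap.adjoint_inner_left]
    congr 1
    refine Finset.sum_congr rfl fun k _ => ?_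
    rw [smul_apply, inner_smul_right, mul_apply_eq_comp]
    have := (hsum k (T k v)).2
    rw [← this]
    push_cast
    ring
  rw [hmain]
  have hb : ∀ ν, ‖m ν * taylorRem Φ T n (r ν) (grp Φ (-r ν) u) v‖ ≤
      ‖((2 * Real.pi * ν : ℝ) : ℂ) ^ n * 𝓕 f ν‖ *
        ((1 / n.factorial) * s⁻¹ ^ n * (‖T n‖ * ‖u‖ * ‖v‖)) := by
    intro ν
    have h1 := norm_taylorRem_le h hA n hT (r ν) (grp Φ (-r ν) u) v
    rw [h.toIsBorelHom.norm_grp] at h1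
    have h2 : ‖m ν‖ = ‖𝓕 f ν‖ := by
      simp only [m]
      rw [norm_mul, ← mul_neg, ← Complex.ofReal_neg, mul_comm Complex.I,
        Complex.norm_exp_ofReal_mul_I, mul_one]
    have h3 : |r ν| = ‖((2 * Real.pi * ν : ℝ) : ℂ)‖ * s⁻¹ := by
      simp only [r]
      rw [Complex.norm_real, Real.norm_eq_abs, abs_div, abs_of_pos hs0, div_eq_mul_inv]
    rw [norm_mul, h2]
    refine (mul_le_mul_of_nonneg_left h1 (norm_nonneg _)).trans (le_of_eq ?_)
    rw [h3, norm_mul, norm_pow, mul_pow]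
    ring
  refine (norm_integral_le_of_norm_le
    ((integrable_pow_mul_fourier hf hs n).norm.mul_const _) (ae_of_all _ hb)).trans (le_of_eq ?_)
  rw [integral_mul_const, fourierWeight]
  ring

end Compact

end SigalSoffer

/-! ### Step functions and the commutator expansion for them -/

namespace SigalSoffer

/-- Smooth functions which vanish near `+∞` and are constant near `-∞`. -/
structure IsStep (f : ℝ → ℂ) : Prop where
  smooth : ContDiff ℝ ∞ f
  tails : ∃ (R : ℝ) (b : ℂ), 0 ≤ R ∧ (∀ x, R ≤ x → f x = 0) ∧ ∀ x, x ≤ -R → f x = b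

section Step
variable {f g : ℝ → ℂ}

theorem IsStep.of_compact (hf : ContDiff ℝ ∞ f) (hs : HasCompactSupport f) : IsStep f := by
  refine ⟨hf, ?_⟩
  obtain ⟨R, hR⟩ := hs.isBounded.subset_closedBall 0
  have h0 : ∀ x, R < |x| → f x = 0 := fun x hx => by
    by_contra h
    have := hR (subset_tsupport f h)
    rw [mem_closedBall_zero_iff, Real.norm_eq_abs] at this
    linarith
  refine ⟨max R 0 + 1, 0, by positivity, fun x hx => h0 x ?_, fun x hx => h0 x ?_⟩
  · linarith [le_abs_self x, le_max_left R 0]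
  · linarith [neg_abs_le x, le_max_left R 0]

theorem IsStep.deriv_eq_zero (hf : IsStep f) : ∃ R : ℝ, 0 ≤ R ∧ ∀ x, R ≤ |x| → deriv f x = 0 := by
  obtain ⟨R, b, hR, h1, h2⟩ := hf.tails
  refine ⟨R + 1, by linarith, fun x hx => ?_⟩
  rcases le_abs.1 hx with h | h
  · have : f =ᶠ[𝓝 x] fun _ => 0 := by
      filter_upwards [lt_mem_nhds (show R < x by linarith)] with y hy
      exact h1 y hy.le
    rw [this.deriv_eq, deriv_const]
  · have : f =ᶠ[𝓝 x] fun _ => b := by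
      filter_upwards [gt_mem_nhds (show x < -R by linarith)] with y hy
      exact h2 y hy.le
    rw [this.deriv_eq, deriv_const]

theorem IsStep.hasCompactSupport_deriv (hf : IsStep f) : HasCompactSupport (deriv f) := by
  obtain ⟨R, -, h⟩ := hf.deriv_eq_zero
  refine HasCompactSupport.of_support_subset_isCompact (isCompact_closedBall (0 : ℝ) R) fun x hx => ?_
  rw [mem_closedBall_zero_iff, Real.norm_eq_abs]
  by_contra h'
  exact hx (h x (not_le.1 h').le)

theorem IsStep.deriv (hf : IsStep f) : IsStep (deriv f) :=
  IsStep.of_compact (by simpa using contDiff_iteratedDeriv hf.smooth 1) hf.hasCompactSupport_deriv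

theorem IsStep.iteratedDeriv (hf : IsStep f) (k : ℕ) : IsStep (iteratedDeriv k f) := by
  induction k with
  | zero => simpa using hf
  | succ k ih => rw [iteratedDeriv_succ]; exact ih.deriv

theorem IsStep.bddBorel (hf : IsStep f) : BddBorel f := by
  obtain ⟨R, b, hR, h1, h2⟩ := hf.tails
  obtain ⟨C, hC⟩ := (isCompact_Icc (a := -R) (b := R)).exists_bound_of_continuousOn
    hf.smooth.continuous.continuousOn
  refine ⟨hf.smooth.continuous.measurable, C, fun x => ?_⟩
  rcases le_total x (-R) with h | h
  · rw [h2 x h, ← h2 (-R) le_rfl]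
    exact hC _ ⟨le_rfl, by linarith⟩
  · rcases le_total x R with h' | h'
    · exact hC x ⟨h, h'⟩
    · rw [h1 x h', ← h1 R le_rfl]
      exact hC _ ⟨by linarith, le_rfl⟩

theorem BddBorel.rescale (hf : BddBorel f) (s c : ℝ) : BddBorel (rescale f s c) := by
  obtain ⟨C, hC⟩ := hf.2
  exact ⟨hf.1.comp (by fun_prop), C, fun x => hC _⟩

theorem IsStep.hasCompactSupport_sub_translate (hf : IsStep f) (L : ℝ) :
    HasCompactSupport fun x => f x - f (x + L) := by
  obtain ⟨R, b, hR, h1, h2⟩ := hf.tails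
  refine HasCompactSupport.of_support_subset_isCompact
    (isCompact_closedBall (0 : ℝ) (R + |L|)) fun x hx => ?_
  rw [mem_closedBall_zero_iff, Real.norm_eq_abs]
  by_contra h'
  refine hx ?_
  rcases lt_abs.1 (not_le.1 h') with h | h
  · simp only
    rw [h1 x (by linarith [abs_nonneg L]), h1 _ (by linarith [neg_abs_le L]), sub_zero]
  · simp only
    rw [h2 x (by linarith [abs_nonneg L]), h2 _ (by linarith [le_abs_self L]), sub_self]

theorem iteratedDeriv_sub_translate (hf : ContDiff ℝ ∞ f) (k : ℕ) (L x : ℝ) :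
    iteratedDeriv k (fun x => f x - f (x + L)) x = iteratedDeriv k f x - iteratedDeriv k f (x + L) := by
  have h1 : ContDiff ℝ ∞ fun x => f (x + L) := hf.comp (contDiff_id.add contDiff_const)
  rw [iteratedDeriv_fun_sub ((hf.of_le (by exact_mod_cast le_top)).contDiffAt)
    ((h1.of_le (by exact_mod_cast le_top)).contDiffAt)]
  rw [iteratedDeriv_comp_add_const]

end Step

section Expansion
variable {E : Type*} [NormedAddCommGroup E] [InnerProductSpace ℂ E] [CompleteSpace E]
variable {A : E →ₗ.[ℂ] E} {Φ : (ℝ → ℂ) → E →L[ℂ] E} {f : ℝ → ℂ} {s : ℝ}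

/-- The constant in the remainder estimate of the commutator expansion. -/
noncomputable def commConst (n : ℕ) (f : ℝ → ℂ) : ℝ :=
  2 * fourierWeight (n - 1) (deriv f) / n.factorial

theorem commConst_nonneg (n : ℕ) (f : ℝ → ℂ) : 0 ≤ commConst n f := by
  have := fourierWeight_nonneg (n - 1) (deriv f)
  unfold commConst
  positivity

/-- A step function vanishes near +∞, so at each point f(x + N) is eventually zero: the compactly
supported functions f − f(· + N) approximate f boundedly and pointwise. -/
theorem tendsto_rescale_sub_translate (h : IsBorelHom Φ) (hf : IsStep f) (s c : ℝ) (k : ℕ)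
    (v : E) : Tendsto (fun N : ℕ => Φ (rescale (iteratedDeriv k fun x => f x - f (x + N)) s c) v) atTop
      (𝓝 (Φ (rescale (iteratedDeriv k f) s c) v)) := by
  have hk := hf.iteratedDeriv k
  obtain ⟨C, hC⟩ := hk.bddBorel.2
  obtain ⟨R, b, hR, h1, h2⟩ := hk.tails
  have he : ∀ (N : ℕ) x, rescale (iteratedDeriv k fun x => f x - f (x + N)) s c x =
      iteratedDeriv k f ((x - c) / s) - iteratedDeriv k f ((x - c) / s + N) := fun N x =>
    iteratedDeriv_sub_translate hf.smooth k N _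
  refine h.tendsto_of_bounded _ _ (C + C) (fun N => ?_) (fun N x => ?_) (fun x => ?_) v
  · rw [funext (he N)]
    have := hk.smooth.continuous.measurable
    exact (this.comp (by fun_prop)).sub (this.comp (by fun_prop))
  · rw [he]
    exact (norm_sub_le _ _).trans (add_le_add (hC _) (hC _))
  · refine tendsto_const_nhds.congr' ?_
    obtain ⟨N, hN⟩ := exists_nat_ge (R - (x - c) / s)
    filter_upwards [eventually_ge_atTop N] with n hn
    have : (N : ℝ) ≤ n := by exact_mod_cast hn
    rw [he, h1 ((x - c) / s + n) (by linarith), sub_zero]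
    rfl

/-- The commutator expansion `T₀ f(A_s) = ∑_{k<n} s^{-k} f^{(k)}(A_s) T_k / k! + O(s^{-n})`. -/
theorem norm_commRem_le (h : IsBorelCalculus A Φ) (hA : IsSelfAdjoint A)
    {T : ℕ → E →L[ℂ] E} (hT : IsChain A T) (hf : IsStep f) (hs0 : 0 < s) (c : ℝ) {n : ℕ}
    (hn : 1 ≤ n) : ‖commRem Φ T f s c n‖ ≤ commConst n f * s⁻¹ ^ n * ‖T n‖ := by
  obtain ⟨m, rfl⟩ := Nat.exists_eq_add_of_le' hn
  have hc := commConst_nonneg (m + 1) f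
  have main : ∀ u v : E, ‖⟪u, commRem Φ T f s c (m + 1) v⟫_ℂ‖ ≤
      commConst (m + 1) f * s⁻¹ ^ (m + 1) * ‖T (m + 1)‖ * ‖u‖ * ‖v‖ := by
    intro u v
    -- The compactly supported case is applied to f − f(· + N), where the Fourier weight is bounded
    -- uniformly in N, and then N → ∞.
    have hlim : Tendsto (fun N : ℕ => ⟪u, commRem Φ T (fun x => f x - f (x + N)) s c (m + 1) v⟫_ℂ) atTop
        (𝓝 ⟪u, commRem Φ T f s c (m + 1) v⟫_ℂ) := by
      refine tendsto_const_nhds.inner ?_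
      simp only [commRem, sub_apply, sum_apply, smul_apply, mul_apply_eq_comp]
      refine Tendsto.sub ?_ (tendsto_finsetSum _ fun k _ => ?_)
      · have := tendsto_rescale_sub_translate h.toIsBorelHom hf s c 0 v
        simp only [iteratedDeriv_zero] at this
        exact ((T 0).continuous.tendsto _).comp this
      · exact (tendsto_rescale_sub_translate h.toIsBorelHom hf s c k (T k v)).const_smul _
    refine le_of_tendsto hlim.norm (Eventually.of_forall fun N => ?_)
    have hLs := hf.hasCompactSupport_sub_translate N
    have h1 := norm_commRem_le_of_compact h hA hT
      (hf.smooth.sub (hf.smooth.comp (contDiff_id.add contDiff_const))) hLs hs0 c (m + 1) u v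
    refine h1.trans ?_
    have h2 := fourierWeight_sub_translate_le m hf.smooth hf.hasCompactSupport_deriv N hLs
    have h3 : fourierWeight (m + 1) (fun x => f x - f (x + N)) / (m + 1).factorial ≤
        commConst (m + 1) f := by
      unfold commConst
      simp only [Nat.add_sub_cancel]
      gcongr
    calc _ ≤ commConst (m + 1) f * s⁻¹ ^ (m + 1) * (‖T (m + 1)‖ * ‖u‖ * ‖v‖) := by gcongr; exact h3
      _ = _ := by ring
  refine ContinuousLinearMap.opNorm_le_bound _ (by positivity) fun v => ?_
  have h1 := main (commRem Φ T f s c (m + 1) v) v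
  rw [inner_self_eq_norm_sq_to_K, norm_pow, RCLike.norm_ofReal, abs_norm] at h1
  by_cases h0 : ‖commRem Φ T f s c (m + 1) v‖ = 0
  · rw [h0]; positivity
  · have h2 : 0 < ‖commRem Φ T f s c (m + 1) v‖ := lt_of_le_of_ne (norm_nonneg _) (Ne.symm h0)
    refine le_of_mul_le_mul_left ?_ h2
    nlinarith

end Expansion

end SigalSoffer

namespace SigalSoffer

/-! ### Localized forms of the commutator expansion -/

section SupNorm
variable {f g F : ℝ → ℂ}

/-- The supremum norm. -/
noncomputable def supNorm (f : ℝ → ℂ) : ℝ := ⨆ x, ‖f x‖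

theorem supNorm_nonneg (f : ℝ → ℂ) : 0 ≤ supNorm f := Real.iSup_nonneg fun _ => norm_nonneg _

theorem BddBorel.norm_le_supNorm (hf : BddBorel f) (x : ℝ) : ‖f x‖ ≤ supNorm f := by
  obtain ⟨C, hC⟩ := hf.2
  exact le_ciSup (f := fun x => ‖f x‖) ⟨C, by rintro _ ⟨y, rfl⟩; exact hC y⟩ x

/-- `F = 1` near the support of `f`. -/
def IsLocalizer (f F : ℝ → ℂ) : Prop := ∀ x ∈ tsupport f, F =ᶠ[𝓝 x] fun _ => 1

theorem IsLocalizer.mul_eq (h : IsLocalizer f F) (x : ℝ) : f x * F x = f x := by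
  by_cases hx : f x = 0
  · simp [hx]
  · rw [(h x (subset_tsupport f hx)).self_of_nhds, mul_one]

theorem IsLocalizer.mul_iteratedDeriv (h : IsLocalizer f F) {k : ℕ} (hk : k ≠ 0) (x : ℝ) :
    f x * iteratedDeriv k F x = 0 := by
  by_cases hx : f x = 0
  · simp [hx]
  · rw [(h x (subset_tsupport f hx)).iteratedDeriv_eq k, iteratedDeriv_const, if_neg hk, mul_zero]

theorem IsLocalizer.deriv (h : IsLocalizer f F) : IsLocalizer (deriv f) F := fun x hx =>
  h x (tsupport_deriv_subset (𝕜 := ℝ) hx)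

theorem IsLocalizer.iteratedDeriv_succ (h : IsLocalizer (_root_.deriv f) F) (k : ℕ) :
    IsLocalizer (iteratedDeriv (k + 1) f) F := by
  induction k with
  | zero => simpa using h
  | succ k ih => rw [_root_.iteratedDeriv_succ]; exact ih.deriv

end SupNorm

section Localization
variable {E : Type*} [NormedAddCommGroup E] [InnerProductSpace ℂ E] [CompleteSpace E]
variable {A : E →ₗ.[ℂ] E} {Φ : (ℝ → ℂ) → E →L[ℂ] E} {f g F : ℝ → ℂ} {s c : ℝ} {n : ℕ}
  {T : ℕ → E →L[ℂ] E}

theorem IsBorelHom.norm_rescale_le (h : IsBorelHom Φ) (hf : BddBorel f) (s c : ℝ) :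
    ‖Φ (rescale f s c)‖ ≤ supNorm f :=
  h.norm_le _ (hf.rescale s c) _ (supNorm_nonneg f) fun _ => hf.norm_le_supNorm _

theorem IsBorelHom.norm_rescale_apply_le (h : IsBorelHom Φ) (hf : BddBorel f) (s c : ℝ) (u : E) :
    ‖Φ (rescale f s c) u‖ ≤ supNorm f * ‖u‖ :=
  (Φ _).le_of_opNorm_le (h.norm_rescale_le hf s c) u

theorem IsBorelHom.rescale_mul (h : IsBorelHom Φ) (hf : BddBorel f) (hg : BddBorel g) (s c : ℝ) :
    Φ (rescale f s c) * Φ (rescale g s c) = Φ (rescale (fun x => f x * g x) s c) :=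
  (h.map_mul _ _ (hf.rescale s c) (hg.rescale s c)).symm

theorem IsBorelHom.norm_rescale_localizer (h : IsBorelHom Φ) (hf : BddBorel f) (hF : BddBorel F)
    (hl : IsLocalizer f F) (s c : ℝ) (u : E) :
    ‖Φ (rescale f s c) u‖ ≤ supNorm f * ‖Φ (rescale F s c) u‖ := by
  have h1 : (fun x => f x * F x) = f := funext hl.mul_eq
  have h2 := h.rescale_mul hf hF s c
  rw [h1] at h2
  rw [← h2]
  exact h.norm_rescale_apply_le hf s c _

/-- Insertion of a localizer to the right of a smooth operator. -/
theorem norm_localize_le (h : IsBorelCalculus A Φ) (hA : IsSelfAdjoint A) (hT : IsChain A T)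
    (hf : BddBorel f) (hF : IsStep F) (hl : IsLocalizer f F) (hs : 0 < s) (hn : 1 ≤ n) (w : E) :
    ‖Φ (rescale f s c) (T 0 w)‖ ≤ supNorm f * (‖T 0‖ * ‖Φ (rescale F s c) w‖ +
      commConst n F * s⁻¹ ^ n * ‖T n‖ * ‖w‖) := by
  have hk : ∀ k, k ≠ 0 → Φ (rescale f s c) * Φ (rescale (iteratedDeriv k F) s c) = 0 := by
    intro k hk
    rw [h.toIsBorelHom.rescale_mul hf (hF.iteratedDeriv k).bddBorel]
    have : rescale (fun x => f x * iteratedDeriv k F x) s c = fun _ => 0 :=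
      funext fun x => hl.mul_iteratedDeriv hk _
    rw [this, h.toIsBorelHom.map_zero]
  have h0 : Φ (rescale f s c) * Φ (rescale F s c) = Φ (rescale f s c) := by
    rw [h.toIsBorelHom.rescale_mul hf hF.bddBorel, funext hl.mul_eq]
  obtain ⟨m, rfl⟩ := Nat.exists_eq_add_of_le' hn
  -- In the expansion of T₀F every term with k ≥ 1 is killed by f on the left, because F is constant
  -- near the support of f, while fF = f.
  have key : Φ (rescale f s c) * T 0 =
      Φ (rescale f s c) * (T 0 * Φ (rescale F s c) - commRem Φ T F s c (m + 1)) := by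
    rw [commRem, sub_sub_cancel, Finset.sum_range_succ', mul_add, Finset.mul_sum]
    rw [Finset.sum_eq_zero (fun k _ => by rw [mul_smul_comm, ← mul_assoc, hk _ k.succ_ne_zero,
      zero_mul, smul_zero])]
    simp only [pow_zero, Nat.factorial_zero, Nat.cast_one, div_one, Complex.ofReal_one, one_smul,
      iteratedDeriv_zero, zero_add]
    rw [← mul_assoc, h0]
  have key' : Φ (rescale f s c) (T 0 w) = Φ (rescale f s c) (T 0 (Φ (rescale F s c) w) -
      commRem Φ T F s c (m + 1) w) := congrArg (fun B : E →L[ℂ] E => B w) key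
  rw [key']
  refine (h.toIsBorelHom.norm_rescale_apply_le hf s c _).trans ?_
  refine mul_le_mul_of_nonneg_left ?_ (supNorm_nonneg f)
  exact (norm_sub_le _ _).trans (add_le_add ((T 0).le_opNorm _)
    ((commRem Φ T F s c (m + 1)).le_of_opNorm_le (norm_commRem_le h hA hT hF hs c hn) w))

/-- The constant in the localized bound for commutator expansions. -/
noncomputable def locConst (n : ℕ) (f F : ℝ → ℂ) : ℝ :=
  supNorm f * (1 + commConst n F)

theorem locConst_nonneg (n : ℕ) (f F : ℝ → ℂ) : 0 ≤ locConst n f F :=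
  mul_nonneg (supNorm_nonneg f) (by linarith [commConst_nonneg n F])

theorem norm_localize_le' (h : IsBorelCalculus A Φ) (hA : IsSelfAdjoint A) (hT : IsChain A T)
    (hf : BddBorel f) (hF : IsStep F) (hl : IsLocalizer f F) (hs : 0 < s) (hn : 1 ≤ n) {w : E}
    {M X : ℝ} (hM0 : ‖T 0‖ ≤ M) (hMn : ‖T n‖ ≤ M) (hX : ‖Φ (rescale F s c) w‖ ≤ X)
    (hX' : s⁻¹ ^ n * ‖w‖ ≤ X) :
    ‖Φ (rescale f s c) (T 0 w)‖ ≤ locConst n f F * M * X := by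
  refine (norm_localize_le h hA hT hf hF hl hs hn w).trans ?_
  have hM := (norm_nonneg _).trans hM0
  have hX0 := (norm_nonneg _).trans hX
  have h1 : ‖T 0‖ * ‖Φ (rescale F s c) w‖ ≤ M * X := mul_le_mul hM0 hX (norm_nonneg _) hM
  have h2 : ‖T n‖ * (s⁻¹ ^ n * ‖w‖) ≤ M * X := mul_le_mul hMn hX' (by positivity) hM
  have h3 := mul_le_mul_of_nonneg_left h2 (commConst_nonneg n F)
  rw [locConst]
  calc _ = supNorm f * (‖T 0‖ * ‖Φ (rescale F s c) w‖ +
        commConst n F * (‖T n‖ * (s⁻¹ ^ n * ‖w‖))) := by ring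
    _ ≤ supNorm f * (M * X + commConst n F * (M * X)) := by
        have := supNorm_nonneg f
        gcongr
    _ = _ := by ring

/-- The tail of the commutator expansion from order `m` on. -/
noncomputable def tailConst (n m : ℕ) (f F : ℝ → ℂ) : ℝ :=
  ∑ k ∈ Finset.range (n + 1), locConst n (iteratedDeriv (k + (m + 1)) f) F
    + commConst (n + m + 2) f

theorem tailConst_nonneg (n m : ℕ) (f F : ℝ → ℂ) : 0 ≤ tailConst n m f F :=
  add_nonneg (Finset.sum_nonneg fun _ _ => locConst_nonneg _ _ _) (commConst_nonneg _ _)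

/-- The terms of the commutator expansion of order less than `m`. -/
noncomputable def commHead (Φ : (ℝ → ℂ) → E →L[ℂ] E) (T : ℕ → E →L[ℂ] E) (f : ℝ → ℂ) (s c : ℝ)
    (m : ℕ) (w : E) : E :=
  ∑ k ∈ Finset.range m, ((s⁻¹ ^ k / k.factorial : ℝ) : ℂ) • Φ (rescale (iteratedDeriv k f) s c) (T k w)

/-- The terms of order at least m + 1 contain derivatives of f, which live where F = 1; each is
bounded by the mass X seen by F. Expanding n + 1 orders further leaves a remainder with a surplus
factor s⁻ⁿ, which is absorbed since s⁻ⁿ‖w‖ ≤ X. The localization costs n more commutators, whence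
the range 2n + m + 2. -/
theorem norm_sub_commHead_le (h : IsBorelCalculus A Φ) (hA : IsSelfAdjoint A) (hT : IsChain A T)
    (hf : IsStep f) (hF : IsStep F) (hl : IsLocalizer (deriv f) F) (hs : 1 ≤ s) (hn : 1 ≤ n)
    (m : ℕ) {w : E} {M X : ℝ} (hM : ∀ k, m + 1 ≤ k → k ≤ 2 * n + m + 2 → ‖T k‖ ≤ M)
    (hX : ‖Φ (rescale F s c) w‖ ≤ X) (hX' : s⁻¹ ^ n * ‖w‖ ≤ X) :
    ‖T 0 (Φ (rescale f s c) w) - commHead Φ T f s c (m + 1) w‖ ≤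
      tailConst n m f F * s⁻¹ ^ (m + 1) * M * X := by
  have hs0 : 0 < s := by linarith
  have hsi : s⁻¹ ≤ 1 := inv_le_one_of_one_le₀ hs
  have hsi0 : 0 ≤ s⁻¹ := by positivity
  have hM0 : 0 ≤ M := (norm_nonneg _).trans (hM (m + 1) le_rfl (by omega))
  have hX0 : 0 ≤ X := (norm_nonneg _).trans hX
  have e1 : T 0 (Φ (rescale f s c) w) - commHead Φ T f s c (m + 1) w =
      ∑ k ∈ Finset.range (n + 1), ((s⁻¹ ^ (k + (m + 1)) / (k + (m + 1)).factorial : ℝ) : ℂ) •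
        Φ (rescale (iteratedDeriv (k + (m + 1)) f) s c) (T (k + (m + 1)) w) +
        commRem Φ T f s c (n + m + 2) w := by
    have h1 : n + m + 2 = (m + 1) + (n + 1) := by ring
    rw [commRem, h1, Finset.sum_range_add _ (m + 1) (n + 1)]
    simp only [sub_apply, add_apply, sum_apply, smul_apply, mul_apply_eq_comp, commHead]
    simp only [add_comm (m + 1)]
    abel
  have h1 : ∀ k ∈ Finset.range (n + 1), ‖((s⁻¹ ^ (k + (m + 1)) / (k + (m + 1)).factorial : ℝ) : ℂ) •
        Φ (rescale (iteratedDeriv (k + (m + 1)) f) s c) (T (k + (m + 1)) w)‖ ≤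
      locConst n (iteratedDeriv (k + (m + 1)) f) F * (s⁻¹ ^ (m + 1) * M * X) := by
    intro k hk
    have hk' := Finset.mem_range.1 hk
    rw [norm_smul, Complex.norm_real, Real.norm_of_nonneg (by positivity)]
    have h2 := norm_localize_le' h hA (hT.shift (k + (m + 1)))
      (hf.iteratedDeriv (k + (m + 1))).bddBorel hF (hl.iteratedDeriv_succ (k + m)) hs0 hn (c := c)
      (M := M) (by simpa using hM (k + (m + 1)) (by omega) (by omega))
      (hM _ (by omega) (by omega)) hX hX'
    simp only [zero_add] at h2
    have h3 : s⁻¹ ^ (k + (m + 1)) / (k + (m + 1)).factorial ≤ s⁻¹ ^ (m + 1) := by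
      refine (div_le_self (by positivity) (by exact_mod_cast Nat.factorial_pos _)).trans ?_
      exact pow_le_pow_of_le_one hsi0 hsi (by omega)
    refine (mul_le_mul h3 h2 (norm_nonneg _) (by positivity)).trans (le_of_eq (by ring))
  have h2 : ‖commRem Φ T f s c (n + m + 2) w‖ ≤
      commConst (n + m + 2) f * (s⁻¹ ^ (m + 1) * M * X) := by
    refine ((commRem Φ T f s c (n + m + 2)).le_of_opNorm_le
      (norm_commRem_le h hA hT hf hs0 c (by omega)) w).trans ?_
    have h4 : s⁻¹ ^ (n + m + 2) ≤ s⁻¹ ^ (m + 1) * s⁻¹ ^ n := by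
      rw [← pow_add]
      exact pow_le_pow_of_le_one hsi0 hsi (by omega)
    have h5 := hM (n + m + 2) (by omega) (by omega)
    have h6 := commConst_nonneg (n + m + 2) f
    calc commConst (n + m + 2) f * s⁻¹ ^ (n + m + 2) * ‖T (n + m + 2)‖ * ‖w‖
        ≤ commConst (n + m + 2) f * (s⁻¹ ^ (m + 1) * s⁻¹ ^ n) * M * ‖w‖ := by gcongr
      _ = commConst (n + m + 2) f * (s⁻¹ ^ (m + 1) * M * (s⁻¹ ^ n * ‖w‖)) := by ring
      _ ≤ _ := by gcongr
  rw [e1]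
  refine (norm_add_le _ _).trans ?_
  refine (add_le_add ((norm_sum_le _ _).trans (Finset.sum_le_sum h1)) h2).trans (le_of_eq ?_)
  rw [← Finset.sum_mul, tailConst]
  ring

theorem norm_commutator_le (h : IsBorelCalculus A Φ) (hA : IsSelfAdjoint A) (hT : IsChain A T)
    (hf : IsStep f) (hF : IsStep F) (hl : IsLocalizer (deriv f) F) (hs : 1 ≤ s) (hn : 1 ≤ n)
    {w : E} {M X : ℝ} (hM : ∀ k, 1 ≤ k → k ≤ 2 * n + 2 → ‖T k‖ ≤ M)
    (hX : ‖Φ (rescale F s c) w‖ ≤ X) (hX' : s⁻¹ ^ n * ‖w‖ ≤ X) :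
    ‖T 0 (Φ (rescale f s c) w) - Φ (rescale f s c) (T 0 w)‖ ≤ tailConst n 0 f F * s⁻¹ * M * X := by
  have := norm_sub_commHead_le h hA hT hf hF hl hs hn 0 (M := M)
    (fun k h1 h2 => hM k (by omega) (by omega)) hX hX'
  simpa [commHead] using this

end Localization

end SigalSoffer

namespace SigalSoffer

/-! ### The flux estimate -/

section Flux
variable {E : Type*} [NormedAddCommGroup E] [InnerProductSpace ℂ E] [CompleteSpace E]
variable {A : E →ₗ.[ℂ] E} {Φ : (ℝ → ℂ) → E →L[ℂ] E} {f g F : ℝ → ℂ} {s c : ℝ} {n : ℕ}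
  {T : ℕ → E →L[ℂ] E}

theorem IsBorelHom.rescale_inner (h : IsBorelHom Φ) (hf : BddBorel f) (hr : ∀ x, star (f x) = f x)
    (s c : ℝ) (u v : E) : ⟪Φ (rescale f s c) u, v⟫_ℂ = ⟪u, Φ (rescale f s c) v⟫_ℂ := by
  rw [h.inner_left (hf.rescale s c)]
  congr 3
  ext x
  exact hr _

/-- The constant in the localized quadratic form bound for commutator expansions. -/
noncomputable def formConst (n m : ℕ) (f F : ℝ → ℂ) : ℝ :=
  ∑ k ∈ Finset.range (2 * n + 1), locConst n (iteratedDeriv (k + (m + 1)) f) F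
    + commConst (2 * n + m + 2) f

/-- The quadratic form gains a localizer on both sides, hence X². The remainder must then supply
s⁻ⁿ‖w‖ twice, so the expansion goes 2n + 1 orders further. -/
theorem norm_inner_sub_commHead_le (h : IsBorelCalculus A Φ) (hA : IsSelfAdjoint A)
    (hT : IsChain A T) (hf : IsStep f) (hF : IsStep F) (hFr : ∀ x, star (F x) = F x)
    (hl : IsLocalizer (deriv f) F) (hs : 1 ≤ s) (hn : 1 ≤ n)
    (m : ℕ) {w : E} {M X : ℝ} (hM : ∀ k, m + 1 ≤ k → k ≤ 3 * n + m + 2 → ‖T k‖ ≤ M)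
    (hX : ‖Φ (rescale F s c) w‖ ≤ X) (hX' : s⁻¹ ^ n * ‖w‖ ≤ X) :
    ‖⟪w, T 0 (Φ (rescale f s c) w) - commHead Φ T f s c (m + 1) w⟫_ℂ‖ ≤
      formConst n m f F * s⁻¹ ^ (m + 1) * M * X ^ 2 := by
  have hs0 : 0 < s := by linarith
  have hsi : s⁻¹ ≤ 1 := inv_le_one_of_one_le₀ hs
  have hsi0 : 0 ≤ s⁻¹ := by positivity
  have hM0 : 0 ≤ M := (norm_nonneg _).trans (hM (m + 1) le_rfl (by omega))
  have hX0 : 0 ≤ X := (norm_nonneg _).trans hX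
  have e1 : T 0 (Φ (rescale f s c) w) - commHead Φ T f s c (m + 1) w =
      ∑ k ∈ Finset.range (2 * n + 1), ((s⁻¹ ^ (k + (m + 1)) / (k + (m + 1)).factorial : ℝ) : ℂ) •
        Φ (rescale (iteratedDeriv (k + (m + 1)) f) s c) (T (k + (m + 1)) w) +
        commRem Φ T f s c (2 * n + m + 2) w := by
    have h1 : 2 * n + m + 2 = (m + 1) + (2 * n + 1) := by ring
    rw [commRem, h1, Finset.sum_range_add _ (m + 1) (2 * n + 1)]
    simp only [sub_apply, add_apply, sum_apply, smul_apply, mul_apply_eq_comp, commHead]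
    simp only [add_comm (m + 1)]
    abel
  have h1 : ∀ k ∈ Finset.range (2 * n + 1),
      ‖⟪w, ((s⁻¹ ^ (k + (m + 1)) / (k + (m + 1)).factorial : ℝ) : ℂ) •
        Φ (rescale (iteratedDeriv (k + (m + 1)) f) s c) (T (k + (m + 1)) w)⟫_ℂ‖ ≤
      locConst n (iteratedDeriv (k + (m + 1)) f) F * (s⁻¹ ^ (m + 1) * M * X ^ 2) := by
    intro k hk
    have hk' := Finset.mem_range.1 hk
    have hfk := (hf.iteratedDeriv (k + (m + 1))).bddBorel
    have hlk := hl.iteratedDeriv_succ (k + m)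
    -- A second copy of F is inserted on the left of the derivative of f, to be moved onto w.
    have e2 : ∀ y, Φ (rescale (iteratedDeriv (k + (m + 1)) f) s c) y =
        Φ (rescale F s c) (Φ (rescale (iteratedDeriv (k + (m + 1)) f) s c) y) := by
      intro y
      have := h.toIsBorelHom.rescale_mul hF.bddBorel hfk s c
      rw [show (fun x => F x * iteratedDeriv (k + (m + 1)) f x) = iteratedDeriv (k + (m + 1)) f from
        funext fun x => by rw [mul_comm]; exact hlk.mul_eq x] at this
      exact congrArg (fun B : E →L[ℂ] E => B y) this.symm
    rw [inner_smul_right, norm_mul, Complex.norm_real, Real.norm_of_nonneg (by positivity), e2,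
      ← h.toIsBorelHom.rescale_inner hF.bddBorel hFr]
    have h2 := norm_localize_le' h hA (hT.shift (k + (m + 1))) hfk hF hlk hs0 hn (c := c)
      (M := M) (by simpa using hM (k + (m + 1)) (by omega) (by omega))
      (hM _ (by omega) (by omega)) hX hX'
    simp only [zero_add] at h2
    have h3 : s⁻¹ ^ (k + (m + 1)) / (k + (m + 1)).factorial ≤ s⁻¹ ^ (m + 1) := by
      refine (div_le_self (by positivity) (by exact_mod_cast Nat.factorial_pos _)).trans ?_
      exact pow_le_pow_of_le_one hsi0 hsi (by omega)
    have h4 := (norm_inner_le_norm (𝕜 := ℂ) (Φ (rescale F s c) w)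
      (Φ (rescale (iteratedDeriv (k + (m + 1)) f) s c) (T (k + (m + 1)) w))).trans
      (mul_le_mul hX h2 (norm_nonneg _) hX0)
    refine (mul_le_mul h3 h4 (norm_nonneg _) (by positivity)).trans (le_of_eq (by ring))
  have h2 : ‖⟪w, commRem Φ T f s c (2 * n + m + 2) w⟫_ℂ‖ ≤
      commConst (2 * n + m + 2) f * (s⁻¹ ^ (m + 1) * M * X ^ 2) := by
    refine (norm_inner_le_norm _ _).trans ((mul_le_mul_of_nonneg_left
      ((commRem Φ T f s c (2 * n + m + 2)).le_of_opNorm_le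
      (norm_commRem_le h hA hT hf hs0 c (by omega)) w) (norm_nonneg _)).trans ?_)
    have h4 : s⁻¹ ^ (2 * n + m + 2) ≤ s⁻¹ ^ (m + 1) * (s⁻¹ ^ n * s⁻¹ ^ n) := by
      rw [← pow_add, ← pow_add]
      exact pow_le_pow_of_le_one hsi0 hsi (by omega)
    have h5 := hM (2 * n + m + 2) (by omega) (by omega)
    have h6 := commConst_nonneg (2 * n + m + 2) f
    calc ‖w‖ * (commConst (2 * n + m + 2) f * s⁻¹ ^ (2 * n + m + 2) * ‖T (2 * n + m + 2)‖ * ‖w‖)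
        ≤ ‖w‖ * (commConst (2 * n + m + 2) f * (s⁻¹ ^ (m + 1) * (s⁻¹ ^ n * s⁻¹ ^ n)) * M * ‖w‖) := by
          gcongr
      _ = commConst (2 * n + m + 2) f * (s⁻¹ ^ (m + 1) * M * (s⁻¹ ^ n * ‖w‖) ^ 2) := by ring
      _ ≤ _ := by gcongr
  rw [e1, inner_add_right, inner_sum]
  refine (norm_add_le _ _).trans ?_
  refine (add_le_add ((norm_sum_le _ _).trans (Finset.sum_le_sum h1)) h2).trans (le_of_eq ?_)
  rw [← Finset.sum_mul, formConst]
  ring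

/-- The constant in the flux estimate. -/
noncomputable def fluxConst (n : ℕ) (S G F : ℝ → ℂ) (M θ ħ₀ : ℝ) : ℝ :=
  tailConst n 0 G F * M * supNorm G * (1 + M) * (θ * ħ₀ + M) + supNorm G * tailConst n 0 G F * M
    + formConst n 1 S F * M

/-- With φ = g(H)w, the expansion to second order of the commutator of T₀ with S leaves the term
−s⁻¹ G²T₁, symmetrized to −s⁻¹ G T₁ G. The Mourre bound applies to b = g(H)Gw rather than to a =
Gg(H)w. Their difference is O(ħ/s) and T₁ = O(ħ), so exchanging them costs O(ħ²/s), which s⁻¹ in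
front turns into the allowed error ħ²s⁻². -/
theorem flux_le (h : IsBorelCalculus A Φ) (hA : IsSelfAdjoint A) {R : ℕ → E →L[ℂ] E}
    (hT : IsChain A T) (hR : IsChain A R) {S G : ℝ → ℂ} (hS : IsStep S) (hG : IsStep G)
    (hF : IsStep F) (hFr : ∀ x, star (F x) = F x) (hGr : ∀ x, star (G x) = G x)
    (hSG : ∀ x, deriv S x = -(G x * G x)) (hlS : IsLocalizer (deriv S) F) (hlG : IsLocalizer G F)
    (hs : 1 ≤ s) (hn : 1 ≤ n) {θ ħ ħ₀ M X : ℝ} (hθ : 0 ≤ θ) (hħ : 0 ≤ ħ) (hħ₀ : ħ ≤ ħ₀)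
    (hT1 : ‖T 1‖ ≤ M * ħ) (hT2 : ∀ k, 2 ≤ k → k ≤ 3 * n + 3 → ‖T k‖ ≤ M * ħ ^ 2)
    (hR0 : ‖R 0‖ ≤ M) (hR1 : ∀ k, 1 ≤ k → k ≤ 2 * n + 2 → ‖R k‖ ≤ M * ħ)
    (hmourre : ∀ u ∈ A.domain, θ * ħ ^ 2 * ‖R 0 u‖ ^ 2 ≤ (Complex.I * ⟪R 0 u, T 1 (R 0 u)⟫_ℂ).re)
    {w : E} (hw : Φ (rescale G s c) w ∈ A.domain)
    (hX1 : ‖Φ (rescale F s c) w‖ ≤ X) (hX1' : s⁻¹ ^ n * ‖w‖ ≤ X)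
    (hX2 : ‖Φ (rescale F s c) (R 0 w)‖ ≤ X) (hX2' : s⁻¹ ^ n * ‖R 0 w‖ ≤ X) :
    (Complex.I * ⟪R 0 w, T 0 (Φ (rescale S s c) (R 0 w)) - Φ (rescale S s c) (T 0 (R 0 w))⟫_ℂ).re ≤
      -(s⁻¹ * (θ * ħ ^ 2 * ‖Φ (rescale G s c) (R 0 w)‖ ^ 2)) +
        fluxConst n S G F M θ ħ₀ * s⁻¹ ^ 2 * ħ ^ 2 * X ^ 2 := by
  have hs0 : 0 < s := by linarith
  have hsi : s⁻¹ ≤ 1 := inv_le_one_of_one_le₀ hs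
  have hsi0 : 0 ≤ s⁻¹ := by positivity
  have hM : 0 ≤ M := (norm_nonneg _).trans hR0
  have hX0 : 0 ≤ X := (norm_nonneg _).trans hX1
  set φ := R 0 w with hφ
  set D := Φ (rescale G s c) with hD
  set a := D φ with ha
  set b := R 0 (D w) with hb
  set γ := supNorm G with hγ
  set κ := tailConst n 0 G F with hκ
  have hγ0 : 0 ≤ γ := supNorm_nonneg G
  have hκ0 : 0 ≤ κ := tailConst_nonneg n 0 G F
  have hba : ‖b - a‖ ≤ κ * s⁻¹ * (M * ħ) * X :=
    norm_commutator_le h hA hR hG hF hlG.deriv hs hn hR1 hX1 hX1'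
  -- Here the commutator is with T₁, so its own commutators start at T₂ and already carry ħ².
  have hcomm : ‖T 1 a - D (T 1 φ)‖ ≤ κ * s⁻¹ * (M * ħ ^ 2) * X := by
    have := norm_commutator_le h hA (hT.shift 1) hG hF hlG.deriv hs hn (M := M * ħ ^ 2) (w := φ)
      (fun k h1 h2 => hT2 (k + 1) (by omega) (by omega)) hX2 hX2'
    simpa using this
  have haX : ‖a‖ ≤ γ * X := (h.toIsBorelHom.norm_rescale_localizer hG.bddBorel hF.bddBorel hlG s c φ).trans
    (mul_le_mul_of_nonneg_left hX2 hγ0)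
  have hbX : ‖b‖ ≤ M * (γ * X) := by
    refine ((R 0).le_of_opNorm_le hR0 _).trans (mul_le_mul_of_nonneg_left ?_ hM)
    exact (h.toIsBorelHom.norm_rescale_localizer hG.bddBorel hF.bddBorel hlG s c w).trans
      (mul_le_mul_of_nonneg_left hX1 hγ0)
  have hab : ‖a‖ + ‖b‖ ≤ γ * (1 + M) * X := by linarith
  have hmo := hmourre _ hw
  rw [← hb] at hmo
  have hq : |(Complex.I * ⟪b, T 1 b⟫_ℂ).re - (Complex.I * ⟪a, T 1 a⟫_ℂ).re| ≤
      κ * M * γ * (1 + M) * M * s⁻¹ * ħ ^ 2 * X ^ 2 := by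
    have e1 : Complex.I * ⟪b, T 1 b⟫_ℂ - Complex.I * ⟪a, T 1 a⟫_ℂ =
        Complex.I * (⟪b - a, T 1 b⟫_ℂ + ⟪a, T 1 (b - a)⟫_ℂ) := by
      rw [inner_sub_left, map_sub, inner_sub_right]; ring
    rw [← Complex.sub_re, e1]
    refine (Complex.abs_re_le_norm _).trans ?_
    rw [norm_mul, Complex.norm_I, one_mul]
    have h1 : ‖⟪b - a, T 1 b⟫_ℂ‖ ≤ ‖b - a‖ * (M * ħ * ‖b‖) := (norm_inner_le_norm _ _).trans
      (mul_le_mul_of_nonneg_left ((T 1).le_of_opNorm_le hT1 _) (norm_nonneg _))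
    have h2 : ‖⟪a, T 1 (b - a)⟫_ℂ‖ ≤ ‖a‖ * (M * ħ * ‖b - a‖) := (norm_inner_le_norm _ _).trans
      (mul_le_mul_of_nonneg_left ((T 1).le_of_opNorm_le hT1 _) (norm_nonneg _))
    calc _ ≤ ‖b - a‖ * (M * ħ * ‖b‖) + ‖a‖ * (M * ħ * ‖b - a‖) :=
          (norm_add_le _ _).trans (add_le_add h1 h2)
      _ = M * ħ * (‖b - a‖ * (‖a‖ + ‖b‖)) := by ring
      _ ≤ M * ħ * ((κ * s⁻¹ * (M * ħ) * X) * (γ * (1 + M) * X)) := by gcongr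
      _ = _ := by ring
  have hsq : ‖a‖ ^ 2 - ‖b‖ ^ 2 ≤ κ * M * γ * (1 + M) * s⁻¹ * ħ * X ^ 2 := by
    have h1 : ‖a‖ - ‖b‖ ≤ ‖b - a‖ := by
      rw [norm_sub_rev]; exact norm_sub_norm_le a b
    calc ‖a‖ ^ 2 - ‖b‖ ^ 2 = (‖a‖ - ‖b‖) * (‖a‖ + ‖b‖) := by ring
      _ ≤ ‖b - a‖ * (‖a‖ + ‖b‖) := by gcongr
      _ ≤ (κ * s⁻¹ * (M * ħ) * X) * (γ * (1 + M) * X) := by gcongr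
      _ = _ := by ring
  have hpos : θ * ħ ^ 2 * ‖a‖ ^ 2 - κ * M * γ * (1 + M) * (θ * ħ₀ + M) * s⁻¹ * ħ ^ 2 * X ^ 2 ≤
      (Complex.I * ⟪a, T 1 a⟫_ℂ).re := by
    have h1 := (abs_le.1 hq).2
    have h2 := mul_le_mul_of_nonneg_left hsq (show 0 ≤ θ * ħ ^ 2 by positivity)
    -- Replacing ‖b‖² by ‖a‖² in the Mourre lower bound produces ħ³; the spare power is bounded by
    -- ħ₀, which is why `fluxConst` contains θħ₀.
    have h3 : κ * M * γ * (1 + M) * s⁻¹ * (θ * ħ ^ 2 * X ^ 2) * ħ ≤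
        κ * M * γ * (1 + M) * s⁻¹ * (θ * ħ ^ 2 * X ^ 2) * ħ₀ := by gcongr
    nlinarith
  have hform := norm_inner_sub_commHead_le h hA hT hS hF hFr hlS hs hn 1 (c := c) (M := M * ħ ^ 2)
    (fun k h1 h2 => hT2 k (by omega) (by omega)) hX2 hX2'
  have hhead : commHead Φ T S s c (1 + 1) φ = Φ (rescale S s c) (T 0 φ) -
      ((s⁻¹ : ℝ) : ℂ) • D (D (T 1 φ)) := by
    have h1 : Φ (rescale (deriv S) s c) = -(D * D) := by
      rw [h.toIsBorelHom.rescale_mul hG.bddBorel hG.bddBorel]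
      have : rescale (deriv S) s c = fun x => (-1) * rescale (fun x => G x * G x) s c x := by
        ext x
        simp only [rescale]
        rw [hSG]
        ring
      rw [this, h.map_smul _ _ ((hG.bddBorel.fun_mul hG.bddBorel).rescale s c)]
      module
    simp only [commHead, Finset.sum_range_succ, Finset.sum_range_zero, zero_add, pow_zero, pow_one,
      Nat.factorial_zero, Nat.factorial_one, Nat.cast_one, div_one, Complex.ofReal_one, one_smul,
      iteratedDeriv_zero, iteratedDeriv_one, h1, neg_apply, mul_apply_eq_comp, smul_neg,
      sub_eq_add_neg]
  rw [hhead] at hform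
  have hDD : ⟪φ, D (D (T 1 φ))⟫_ℂ = ⟪a, T 1 a⟫_ℂ - ⟪a, T 1 a - D (T 1 φ)⟫_ℂ := by
    rw [hD, ← h.toIsBorelHom.rescale_inner hG.bddBorel hGr, ← hD, ← ha, inner_sub_right]
    ring
  have hfin : Complex.I * ⟪φ, T 0 (Φ (rescale S s c) φ) - Φ (rescale S s c) (T 0 φ)⟫_ℂ =
      Complex.I * ⟪φ, T 0 (Φ (rescale S s c) φ) - (Φ (rescale S s c) (T 0 φ) -
        ((s⁻¹ : ℝ) : ℂ) • D (D (T 1 φ)))⟫_ℂ - ((s⁻¹ : ℝ) : ℂ) * (Complex.I * ⟪a, T 1 a⟫_ℂ) +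
        ((s⁻¹ : ℝ) : ℂ) * (Complex.I * ⟪a, T 1 a - D (T 1 φ)⟫_ℂ) := by
    simp only [inner_sub_right, inner_smul_right] at hDD ⊢
    rw [hDD]
    ring
  rw [hfin, Complex.add_re, Complex.sub_re, Complex.re_ofReal_mul, Complex.re_ofReal_mul]
  have t1 : (Complex.I * ⟪φ, T 0 (Φ (rescale S s c) φ) - (Φ (rescale S s c) (T 0 φ) -
        ((s⁻¹ : ℝ) : ℂ) • D (D (T 1 φ)))⟫_ℂ).re ≤
        formConst n 1 S F * s⁻¹ ^ 2 * (M * ħ ^ 2) * X ^ 2 := by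
    refine (Complex.re_le_norm _).trans ?_
    rw [norm_mul, Complex.norm_I, one_mul]
    exact hform
  have t2 : (Complex.I * ⟪a, T 1 a - D (T 1 φ)⟫_ℂ).re ≤
      (γ * X) * (κ * s⁻¹ * (M * ħ ^ 2) * X) := by
    refine (Complex.re_le_norm _).trans ?_
    rw [norm_mul, Complex.norm_I, one_mul]
    refine (norm_inner_le_norm _ _).trans (mul_le_mul haX hcomm (norm_nonneg _) (by positivity))
  have t3 := mul_le_mul_of_nonneg_left hpos hsi0
  have t4 := mul_le_mul_of_nonneg_left t2 hsi0
  rw [fluxConst, ← hκ, ← hγ]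
  nlinarith

end Flux

end SigalSoffer

namespace SigalSoffer

/-! ### Factorization of smooth functions with prescribed support -/

section Factorization

/-- A diagonal choice of weights. The derivatives of U_i may grow, but those of V_i decay faster
than any of these growth rates, so small a_i can make the first sum converge with all derivatives
while the inverses a_i⁻¹ are still harmless in the second. -/
theorem exists_smooth_sums {U V : ℕ → ℝ → ℂ} {P β : ℕ → ℕ → ℝ}
    (hU : ∀ i, ContDiff ℝ ∞ (U i)) (hV : ∀ i, ContDiff ℝ ∞ (V i))
    (hP0 : ∀ k i, 0 ≤ P k i) (hP : ∀ k l i, k ≤ l → P k i ≤ P l i)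
    (hUb : ∀ k i x, ‖iteratedDeriv k (U i) x‖ ≤ P k i)
    (hVb : ∀ k i x, ‖iteratedDeriv k (V i) x‖ ≤ β k i)
    (hlim : ∀ j k, Tendsto (fun i => 4 ^ i * (1 + P k i) * β j i) atTop (𝓝 0)) :
    ∃ a : ℕ → ℂ, (∀ i, a i ≠ 0) ∧ ContDiff ℝ ∞ (fun x => ∑' i, a i * U i x) ∧
      ContDiff ℝ ∞ (fun x => ∑' i, (a i)⁻¹ * V i x) := by
  classical
  -- Q i m says that at index i the first m derivatives are under control; m i is the largest such
  -- order up to i. It tends to infinity, so each fixed derivative is controlled for all but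
  -- finitely many i. The default value 0 of `findGreatest` matters only for those finitely many.
  let Q : ℕ → ℕ → Prop := fun i m => ∀ j ≤ m, 4 ^ i * (1 + P m i) * β j i ≤ 1
  let m : ℕ → ℕ := fun i => Nat.findGreatest (Q i) i
  let r : ℕ → ℝ := fun i => (1 / 2) ^ i / (1 + P (m i) i)
  have hr : ∀ i, 0 < r i := fun i => by
    have := hP0 (m i) i
    positivity
  have hev : ∀ k, ∀ᶠ i in atTop, k ≤ m i ∧ Q i (m i) := by
    intro k
    have h1 : ∀ᶠ i in atTop, Q i k := by
      have h2 : ∀ j, ∀ᶠ i in atTop, 4 ^ i * (1 + P k i) * β j i ≤ 1 := fun j =>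
        ((hlim j k).eventually (gt_mem_nhds zero_lt_one)).mono fun i hi => hi.le
      have h3 := (Finset.eventually_all (Finset.range (k + 1))
        (p := fun j i => 4 ^ i * (1 + P k i) * β j i ≤ 1) (l := atTop)).2 fun j _ => h2 j
      filter_upwards [h3] with i hi j hj
      exact hi j (Finset.mem_range.2 (by omega))
    filter_upwards [h1, eventually_ge_atTop k] with i hi hk
    exact ⟨Nat.le_findGreatest hk hi, Nat.findGreatest_spec hk hi⟩
  have hsum : Summable fun i : ℕ => ((1 / 2 : ℝ)) ^ i := summable_geometric_two
  refine ⟨fun i => (r i : ℂ), fun i => Complex.ofReal_ne_zero.2 (hr i).ne', ?_, ?_⟩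
  · refine contDiff_tsum_of_eventually (N := ⊤) (v := fun _ i => (1 / 2 : ℝ) ^ i)
      (fun i => contDiff_const.mul (hU i)) (fun _ _ => hsum) (fun k _ => ?_)
    rw [Nat.cofinite_eq_atTop]
    filter_upwards [hev k] with i hi x
    rw [norm_iteratedFDeriv_eq_norm_iteratedDeriv, iteratedDeriv_const_mul _
      ((hU i).of_le (by exact_mod_cast le_top)).contDiffAt, norm_mul, Complex.norm_real,
      Real.norm_of_nonneg (hr i).le]
    have h1 := (hUb k i x).trans (hP k (m i) i hi.1)
    have h2 := hP0 (m i) i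
    calc r i * ‖iteratedDeriv k (U i) x‖ ≤ r i * (1 + P (m i) i) := by
          have := (hr i).le
          gcongr
          linarith
      _ = (1 / 2) ^ i := div_mul_cancel₀ _ (by linarith)
  · refine contDiff_tsum_of_eventually (N := ⊤) (v := fun _ i => (1 / 2 : ℝ) ^ i)
      (fun i => contDiff_const.mul (hV i)) (fun _ _ => hsum) (fun k _ => ?_)
    rw [Nat.cofinite_eq_atTop]
    filter_upwards [hev k] with i hi x
    rw [norm_iteratedFDeriv_eq_norm_iteratedDeriv, iteratedDeriv_const_mul _
      ((hV i).of_le (by exact_mod_cast le_top)).contDiffAt, norm_mul, norm_inv, Complex.norm_real,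
      Real.norm_of_nonneg (hr i).le]
    have h1 := hi.2 k hi.1
    have h2 := hP0 (m i) i
    have h3 : (r i)⁻¹ = 2 ^ i * (1 + P (m i) i) := by
      simp only [r, inv_div, one_div, inv_pow]
      rw [div_inv_eq_mul, mul_comm]
    have h4 : (4 : ℝ) ^ i = 2 ^ i * 2 ^ i := by rw [← mul_pow]; norm_num
    calc (r i)⁻¹ * ‖iteratedDeriv k (V i) x‖ ≤ (r i)⁻¹ * β k i := by
          have := (inv_pos.2 (hr i)).le
          gcongr
          exact hVb k i x
      _ = (1 / 2) ^ i * (4 ^ i * (1 + P (m i) i) * β k i) := by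
          rw [h3, h4, one_div, inv_pow]
          field_simp
      _ ≤ (1 / 2) ^ i * 1 := by gcongr
      _ = (1 / 2) ^ i := mul_one _

variable {g : ℝ → ℂ}

theorem iteratedDeriv_eq_zero_of_nonpos (hg : ContDiff ℝ ∞ g) (h0 : ∀ x ≤ 0, g x = 0) (j : ℕ)
    {x : ℝ} (hx : x ≤ 0) : iteratedDeriv j g x = 0 := by
  have h1 : ∀ y ∈ Iio (0 : ℝ), iteratedDeriv j g y = 0 := by
    intro y hy
    have : g =ᶠ[𝓝 y] fun _ => 0 := by
      filter_upwards [gt_mem_nhds hy] with z hz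
      exact h0 z (le_of_lt hz)
    rw [this.iteratedDeriv_eq, iteratedDeriv_const]
    simp
  have hc : IsClosed {y | iteratedDeriv j g y = 0} :=
    isClosed_eq (contDiff_iteratedDeriv hg j).continuous continuous_const
  have h2 := hc.closure_subset_iff.2 h1
  rw [closure_Iio] at h2
  exact h2 hx

/-- All derivatives vanish at 0, so a bound of order N for the derivative of order j + 1 integrates
to one of order N + 1 for that of order j. -/
theorem exists_flat_bound (hg : ContDiff ℝ ∞ g) (hs : HasCompactSupport g) (h0 : ∀ x ≤ 0, g x = 0)
    (N : ℕ) : ∀ j, ∃ C, 0 ≤ C ∧ ∀ x, 0 ≤ x → ‖iteratedDeriv j g x‖ ≤ C * x ^ N := by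
  induction N with
  | zero =>
    intro j
    exact ⟨_, supNorm_nonneg _, fun x _ => by
      simpa using ((IsStep.of_compact hg hs).iteratedDeriv j).bddBorel.norm_le_supNorm x⟩
  | succ N ih =>
    intro j
    obtain ⟨C, hC, h1⟩ := ih (j + 1)
    refine ⟨C, hC, fun x hx => ?_⟩
    have hd : ∀ y ∈ Icc 0 x, HasDerivWithinAt (iteratedDeriv j g) (iteratedDeriv (j + 1) g y)
        (Icc 0 x) y := fun y _ => by
      rw [iteratedDeriv_succ]
      exact ((contDiff_iteratedDeriv hg j).differentiable (by simp) y).hasDerivAt.hasDerivWithinAt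
    have := norm_image_sub_le_of_norm_deriv_le_segment' hd (C := C * x ^ N) (fun y hy =>
      (h1 y hy.1).trans (by have := hy.1; have := hy.2.le; gcongr)) x ⟨hx, le_rfl⟩
    rw [iteratedDeriv_eq_zero_of_nonpos hg h0 j le_rfl, sub_zero, sub_zero] at this
    rwa [pow_succ, ← mul_assoc]

/-- A smooth function which is `0` on `(-∞, 1]` and `1` on `[2, ∞)`. -/
noncomputable def ramp (x : ℝ) : ℂ := (Real.smoothTransition (x - 1) : ℝ)

theorem contDiff_ramp : ContDiff ℝ ∞ ramp :=
  Complex.ofRealCLM.contDiff.comp (Real.smoothTransition.contDiff.comp (contDiff_id.sub contDiff_const))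

theorem ramp_of_le {x : ℝ} (hx : x ≤ 1) : ramp x = 0 := by
  rw [ramp, Real.smoothTransition.zero_of_nonpos (by linarith), Complex.ofReal_zero]

theorem ramp_of_ge {x : ℝ} (hx : 2 ≤ x) : ramp x = 1 := by
  rw [ramp, Real.smoothTransition.one_of_one_le (by linarith), Complex.ofReal_one]

/-- A dyadic cutoff, supported in `[1/16, 2]`. -/
noncomputable def annulus (x : ℝ) : ℂ := ramp (16 * x) - ramp x

/-- A cutoff which is `1` on the support of `annulus`, supported in `[1/32, 4]`. -/
noncomputable def wideAnnulus (x : ℝ) : ℂ := ramp (32 * x) * (1 - ramp (x / 2))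

theorem contDiff_annulus : ContDiff ℝ ∞ annulus :=
  (contDiff_ramp.comp (contDiff_const.mul contDiff_id)).sub contDiff_ramp

theorem contDiff_wideAnnulus : ContDiff ℝ ∞ wideAnnulus :=
  (contDiff_ramp.comp (contDiff_const.mul contDiff_id)).mul
    (contDiff_const.sub (contDiff_ramp.comp (contDiff_id.div_const 2)))

theorem annulus_of_le {x : ℝ} (hx : x ≤ 1 / 16) : annulus x = 0 := by
  rw [annulus, ramp_of_le (by linarith), ramp_of_le (by linarith), sub_zero]

theorem annulus_of_ge {x : ℝ} (hx : 2 ≤ x) : annulus x = 0 := by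
  rw [annulus, ramp_of_ge (by linarith), ramp_of_ge (by linarith), sub_self]

theorem wideAnnulus_of_le {x : ℝ} (hx : x ≤ 1 / 32) : wideAnnulus x = 0 := by
  rw [wideAnnulus, ramp_of_le (by linarith), zero_mul]

theorem wideAnnulus_of_ge {x : ℝ} (hx : 4 ≤ x) : wideAnnulus x = 0 := by
  rw [wideAnnulus, ramp_of_ge (x := x / 2) (by linarith), sub_self, mul_zero]

theorem wideAnnulus_of_mem {x : ℝ} (h1 : 1 / 16 ≤ x) (h2 : x ≤ 2) : wideAnnulus x = 1 := by
  rw [wideAnnulus, ramp_of_ge (by linarith), ramp_of_le (by linarith), sub_zero, mul_one]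

theorem hasCompactSupport_annulus : HasCompactSupport annulus :=
  HasCompactSupport.of_support_subset_isCompact (isCompact_Icc (a := (1 / 16 : ℝ)) (b := 2))
    fun _ hx => ⟨by by_contra h; exact hx (annulus_of_le (by linarith)),
      by by_contra h; exact hx (annulus_of_ge (by linarith))⟩

theorem hasCompactSupport_wideAnnulus : HasCompactSupport wideAnnulus :=
  HasCompactSupport.of_support_subset_isCompact (isCompact_Icc (a := (1 / 32 : ℝ)) (b := 4))
    fun _ hx => ⟨by by_contra h; exact hx (wideAnnulus_of_le (by linarith)),
      by by_contra h; exact hx (wideAnnulus_of_ge (by linarith))⟩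

theorem iteratedDeriv_comp_mul {f : ℝ → ℂ} (hf : ContDiff ℝ ∞ f) (k : ℕ) (c x : ℝ) :
    iteratedDeriv k (fun x => f (c * x)) x = (c : ℂ) ^ k * iteratedDeriv k f (c * x) := by
  have := congrFun (iteratedDeriv_comp_const_smul (𝕜 := ℝ) (n := k)
    (hf.of_le (by exact_mod_cast le_top)) c) x
  rw [Complex.real_smul, Complex.ofReal_pow] at this
  exact this

theorem norm_iteratedDeriv_comp_mul_le {f : ℝ → ℂ} (hf : ContDiff ℝ ∞ f)
    (hs : HasCompactSupport f) (k : ℕ) {c : ℝ} (hc : 1 ≤ c) (j : ℕ) (hj : j ≤ k) (x : ℝ) :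
    ‖iteratedDeriv j (fun x => f (c * x)) x‖ ≤
      (∑ l ∈ Finset.range (k + 1), supNorm (iteratedDeriv l f)) * c ^ k := by
  rw [iteratedDeriv_comp_mul hf, norm_mul, norm_pow, Complex.norm_real,
    Real.norm_of_nonneg (by linarith), mul_comm]
  refine mul_le_mul ?_ (pow_le_pow_right₀ hc hj) (by positivity)
    (Finset.sum_nonneg fun _ _ => supNorm_nonneg _)
  exact (((IsStep.of_compact hf hs).iteratedDeriv j).bddBorel.norm_le_supNorm _).trans
    (Finset.single_le_sum (f := fun l => supNorm (iteratedDeriv l f))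
      (fun _ _ => supNorm_nonneg _) (Finset.mem_range.2 (by omega)))

/-- On the support of the cutoff x ≤ 2/c, where flatness of order N + j gives c⁻ᴺ⁻ʲ; the derivatives
falling on the cutoff cost at most cʲ. -/
theorem exists_annulus_bound (hg : ContDiff ℝ ∞ g) (hs : HasCompactSupport g)
    (h0 : ∀ x ≤ 0, g x = 0) (j N : ℕ) : ∃ C, 0 ≤ C ∧ ∀ c : ℝ, 1 ≤ c → ∀ x,
      ‖iteratedDeriv j (fun x => g x * annulus (c * x)) x‖ ≤ C * c⁻¹ ^ N := by
  choose G hG0 hG using exists_flat_bound hg hs h0 (N + j)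
  set B := ∑ l ∈ Finset.range (j + 1), supNorm (iteratedDeriv l annulus)
  have hB : 0 ≤ B := Finset.sum_nonneg fun _ _ => supNorm_nonneg _
  refine ⟨∑ i ∈ Finset.range (j + 1), (j.choose i : ℝ) * (G i * 2 ^ (N + j)) * B,
    Finset.sum_nonneg fun i _ => by have := hG0 i; positivity, fun c hc x => ?_⟩
  have hc0 : 0 < c := by linarith
  have ha : ContDiff ℝ ∞ fun x => annulus (c * x) :=
    contDiff_annulus.comp (contDiff_const.mul contDiff_id)
  rw [← norm_iteratedFDeriv_eq_norm_iteratedDeriv]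
  refine (norm_iteratedFDeriv_mul_le hg ha x (by exact_mod_cast le_top)).trans ?_
  rw [Finset.sum_mul]
  refine Finset.sum_le_sum fun i hi => ?_
  have hi' : i ≤ j := by have := Finset.mem_range.1 hi; omega
  rw [norm_iteratedFDeriv_eq_norm_iteratedDeriv, norm_iteratedFDeriv_eq_norm_iteratedDeriv]
  have hGi := hG0 i
  rcases le_total x 0 with hx | hx
  · rw [iteratedDeriv_eq_zero_of_nonpos hg h0 i hx, norm_zero, mul_zero, zero_mul]
    positivity
  · rcases lt_or_ge (2 / c) x with hx2 | hx2
    · have : (fun x => annulus (c * x)) =ᶠ[𝓝 x] fun _ => 0 := by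
        filter_upwards [lt_mem_nhds hx2] with y hy
        refine annulus_of_ge ?_
        rw [div_lt_iff₀ hc0] at hy
        linarith
      rw [this.iteratedDeriv_eq, iteratedDeriv_const]
      simp only [ite_self, norm_zero, mul_zero]
      positivity
    · have h1 : ‖iteratedDeriv i g x‖ ≤ G i * 2 ^ (N + j) * (c⁻¹ ^ N * c⁻¹ ^ j) := by
        refine (hG i x hx).trans ?_
        rw [← pow_add, mul_assoc, ← mul_pow, ← div_eq_mul_inv]
        gcongr
      have h2 := norm_iteratedDeriv_comp_mul_le contDiff_annulus hasCompactSupport_annulus j hc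
        (j - i) (by omega) x
      calc (j.choose i : ℝ) * ‖iteratedDeriv i g x‖ *
            ‖iteratedDeriv (j - i) (fun x => annulus (c * x)) x‖
          ≤ (j.choose i : ℝ) * (G i * 2 ^ (N + j) * (c⁻¹ ^ N * c⁻¹ ^ j)) * (B * c ^ j) := by
            gcongr
        _ = (j.choose i : ℝ) * (G i * 2 ^ (N + j)) * B * c⁻¹ ^ N * (c⁻¹ * c) ^ j := by ring
        _ = _ := by rw [inv_mul_cancel₀ hc0.ne', one_pow, mul_one]

/-- The factors are u = ∑ aᵢ Uᵢ and v = ∑ aᵢ⁻¹ Vᵢ, where Uᵢ is a wide annulus and Vᵢ is g cut to the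
narrow annulus inside it. Wide annuli have end ratio 128, less than the step 256, so the cross terms
vanish and the weights cancel. Smoothness at 0 is where the flatness of g enters. -/
theorem exists_annulus_factor (hg : ContDiff ℝ ∞ g) (hs : HasCompactSupport g)
    (h0 : ∀ x ≤ 0, g x = 0) {q : ℝ} (hq : 1 ≤ q) : ∃ u v : ℝ → ℂ, ContDiff ℝ ∞ u ∧ ContDiff ℝ ∞ v ∧
      (∀ x ≤ 0, u x = 0) ∧ (∀ x ≤ 0, v x = 0) ∧
      ∀ x, ∑' i : ℕ, g x * annulus (q * 256 ^ i * x) = u x * v x := by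
  have hc : ∀ i : ℕ, 1 ≤ q * 256 ^ i := fun i => by
    have : (1 : ℝ) ≤ 256 ^ i := one_le_pow₀ (by norm_num)
    nlinarith
  let U : ℕ → ℝ → ℂ := fun i x => wideAnnulus (q * 256 ^ i * x)
  let V : ℕ → ℝ → ℂ := fun i x => g x * annulus (q * 256 ^ i * x)
  have hU : ∀ i, ContDiff ℝ ∞ (U i) := fun i =>
    contDiff_wideAnnulus.comp (contDiff_const.mul contDiff_id)
  have hV : ∀ i, ContDiff ℝ ∞ (V i) := fun i =>
    hg.mul (contDiff_annulus.comp (contDiff_const.mul contDiff_id))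
  let B : ℕ → ℝ := fun k => ∑ l ∈ Finset.range (k + 1), supNorm (iteratedDeriv l wideAnnulus)
  have hB : ∀ k, 0 ≤ B k := fun k => Finset.sum_nonneg fun _ _ => supNorm_nonneg _
  have hBm : ∀ k l, k ≤ l → B k ≤ B l := fun k l hkl =>
    Finset.sum_le_sum_of_subset_of_nonneg (Finset.range_mono (by omega))
      fun _ _ _ => supNorm_nonneg _
  obtain ⟨a, ha, hu, hv⟩ := exists_smooth_sums (P := fun k i => B k * (q * 256 ^ i) ^ k)
    (β := fun k i => supNorm (iteratedDeriv k (V i))) hU hV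
    (fun k i => mul_nonneg (hB k) (pow_nonneg (zero_le_one.trans (hc i)) _))
    (fun k l i hkl => mul_le_mul (hBm k l hkl) (pow_le_pow_right₀ (hc i) hkl)
      (pow_nonneg (zero_le_one.trans (hc i)) _) (hB l))
    (fun k i x => norm_iteratedDeriv_comp_mul_le contDiff_wideAnnulus
      hasCompactSupport_wideAnnulus k (hc i) k le_rfl x)
    (fun k i x => ((IsStep.of_compact (hV i) hs.mul_right).iteratedDeriv k).bddBorel.norm_le_supNorm x)
    (fun j k => by
      -- One order more than the growth cᵏ is enough: the spare c⁻¹ ≤ 256⁻ⁱ beats 4ⁱ and leaves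
      -- 64⁻ⁱ.
      obtain ⟨C, hC0, hC⟩ := exists_annulus_bound hg hs h0 j (k + 1)
      have hlim : Tendsto (fun i : ℕ => (1 + B k) * C * (1 / 64 : ℝ) ^ i) atTop (𝓝 0) := by
        simpa using (tendsto_pow_atTop_nhds_zero_of_lt_one (r := (1 / 64 : ℝ)) (by norm_num)
          (by norm_num)).const_mul ((1 + B k) * C)
      refine squeeze_zero (fun i => ?_) (fun i => ?_) hlim
      · have := hB k
        have := supNorm_nonneg (iteratedDeriv j (V i))
        positivity
      · set c := q * 256 ^ i
        have hc1 := hc i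
        have hc0 : 0 < c := by linarith
        have hBk := hB k
        have h1 : supNorm (iteratedDeriv j (V i)) ≤ C * c⁻¹ ^ (k + 1) :=
          Real.iSup_le (fun x => hC c hc1 x) (by positivity)
        have h2 : 1 + B k * c ^ k ≤ (1 + B k) * c ^ k := by
          have : (1 : ℝ) ≤ c ^ k := one_le_pow₀ hc1
          nlinarith
        have h3 : c⁻¹ ≤ (1 / 256) ^ i := by
          rw [one_div, inv_pow]
          refine inv_anti₀ (by positivity) ?_
          simp only [c]
          have : (0 : ℝ) < 256 ^ i := by positivity
          nlinarith
        calc 4 ^ i * (1 + B k * c ^ k) * supNorm (iteratedDeriv j (V i))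
            ≤ 4 ^ i * ((1 + B k) * c ^ k) * (C * c⁻¹ ^ (k + 1)) := by
              have := supNorm_nonneg (iteratedDeriv j (V i))
              gcongr
          _ = (1 + B k) * C * (4 ^ i * (c * c⁻¹) ^ k * c⁻¹) := by ring
          _ = (1 + B k) * C * (4 ^ i * c⁻¹) := by rw [mul_inv_cancel₀ hc0.ne', one_pow, mul_one]
          _ ≤ (1 + B k) * C * (4 ^ i * (1 / 256) ^ i) := by gcongr
          _ = _ := by rw [← mul_pow]; norm_num)
  refine ⟨_, _, hu, hv, fun x hx => ?_, fun x hx => ?_, fun x => ?_⟩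
  · refine (tsum_congr fun i => ?_).trans tsum_zero
    have : q * 256 ^ i * x ≤ 0 := mul_nonpos_of_nonneg_of_nonpos (zero_le_one.trans (hc i)) hx
    simp only [U]
    rw [wideAnnulus_of_le (by linarith), mul_zero]
  · refine (tsum_congr fun i => ?_).trans tsum_zero
    simp only [V]
    rw [h0 x hx, zero_mul, mul_zero]
  · have hwa : ∀ i j, i ≠ j → wideAnnulus (q * 256 ^ i * x) ≠ 0 → annulus (q * 256 ^ j * x) = 0 := by
      intro i j hij hw
      have h1 : 1 / 32 < q * 256 ^ i * x := by
        by_contra h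
        exact hw (wideAnnulus_of_le (not_lt.1 h))
      have h2 : q * 256 ^ i * x < 4 := by
        by_contra h
        exact hw (wideAnnulus_of_ge (not_lt.1 h))
      rcases lt_or_gt_of_ne hij with h | h
      · refine annulus_of_ge ?_
        obtain ⟨d, rfl⟩ := Nat.exists_eq_add_of_lt h
        have h3 : (1 : ℝ) ≤ 256 ^ d := one_le_pow₀ (by norm_num)
        have h4 : q * 256 ^ (i + d + 1) * x = 256 ^ d * 256 * (q * 256 ^ i * x) := by ring
        rw [h4]
        nlinarith
      · refine annulus_of_le ?_
        obtain ⟨d, rfl⟩ := Nat.exists_eq_add_of_lt h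
        have h3 : (1 : ℝ) ≤ 256 ^ d := one_le_pow₀ (by norm_num)
        have h4 : q * 256 ^ (j + d + 1) * x = 256 ^ d * 256 * (q * 256 ^ j * x) := by ring
        rw [h4] at h2 h1
        by_contra h5
        nlinarith
    have hself : ∀ i, annulus (q * 256 ^ i * x) ≠ 0 → wideAnnulus (q * 256 ^ i * x) = 1 := by
      intro i hi
      refine wideAnnulus_of_mem ?_ ?_
      · by_contra h; exact hi (annulus_of_le (by linarith))
      · by_contra h; exact hi (annulus_of_ge (by linarith))
    by_cases hx : ∃ i, annulus (q * 256 ^ i * x) ≠ 0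
    · obtain ⟨i, hi⟩ := hx
      have hw := hself i hi
      have hV0 : ∀ j, j ≠ i → annulus (q * 256 ^ j * x) = 0 := fun j hj =>
        hwa i j hj.symm (by rw [hw]; exact one_ne_zero)
      have hU0 : ∀ j, j ≠ i → wideAnnulus (q * 256 ^ j * x) = 0 := fun j hj => by
        by_contra h
        exact hi (hwa j i hj h)
      rw [tsum_eq_single i fun j hj => by rw [hV0 j hj, mul_zero]]
      simp only [U, V]
      rw [tsum_eq_single i fun j hj => by rw [hU0 j hj, mul_zero],
        tsum_eq_single i fun j hj => by rw [hV0 j hj, mul_zero, mul_zero], hw, mul_one,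
        mul_inv_cancel_left₀ (ha i)]
    · push Not at hx
      simp only [V, hx, mul_zero, tsum_zero]

/-- Narrow annuli at scales 16ⁿ overlap only with neighbours of different parity, so even and odd n
are factored separately, by q = 1 and q = 16. The telescoping sum of annuli is 1 minus a ramp on x >
0; the ramp part factors directly, since the ramp is reproduced by a wider ramp. -/
theorem halfline_factor_induction (hg : ContDiff ℝ ∞ g) (hs : HasCompactSupport g)
    (h0 : ∀ x ≤ 0, g x = 0) {P : (ℝ → ℂ) → Prop}
    (hadd : ∀ u v, P u → P v → P fun x => u x + v x)
    (hmul : ∀ u v, ContDiff ℝ ∞ u → ContDiff ℝ ∞ v → (∀ x ≤ 0, u x = 0) → (∀ x ≤ 0, v x = 0) →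
      P fun x => u x * v x) : P g := by
  obtain ⟨u1, v1, hu1, hv1, hu1', hv1', h1⟩ := exists_annulus_factor hg hs h0 le_rfl
  obtain ⟨u2, v2, hu2, hv2, hu2', hv2', h2⟩ := exists_annulus_factor hg hs h0
    (q := 16) (by norm_num)
  have key : g = fun x => ramp (16 * x) * (g x * ramp x) + (u1 x * v1 x + u2 x * v2 x) := by
    ext x
    rcases le_or_gt x 0 with hx | hx
    · rw [h0 x hx, hu1' x hx, hu2' x hx]
      simp
    · have hr : ramp (16 * x) * ramp x = ramp x := by
        rcases le_total x 1 with h | h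
        · rw [ramp_of_le h, mul_zero]
        · rw [ramp_of_ge (x := 16 * x) (by linarith), one_mul]
      obtain ⟨N, hN⟩ := pow_unbounded_of_one_lt (2 / x) (show (1 : ℝ) < 16 by norm_num)
      have hbig : ∀ n, N ≤ n → 2 ≤ 16 ^ n * x := by
        intro n hn
        have : (16 : ℝ) ^ N ≤ 16 ^ n := pow_le_pow_right₀ (by norm_num) hn
        rw [div_lt_iff₀ hx] at hN
        nlinarith
      have hz : ∀ n, n ∉ Finset.range N → g x * annulus (16 ^ n * x) = 0 := by
        intro n hn
        rw [annulus_of_ge (hbig n (by simpa using hn)), mul_zero]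
      have htel : ∀ n : ℕ, ∑ i ∈ Finset.range n, g x * annulus (16 ^ i * x) =
          g x * (ramp (16 ^ n * x) - ramp x) := by
        intro n
        induction n with
        | zero => simp
        | succ n ih =>
          rw [Finset.sum_range_succ, ih, annulus, ← mul_assoc, ← pow_succ']
          ring
      have hsum : Summable fun n : ℕ => g x * annulus (16 ^ n * x) :=
        summable_of_ne_finset_zero (s := Finset.range N) hz
      have htot : ∑' n : ℕ, g x * annulus (16 ^ n * x) = g x * (1 - ramp x) := by
        rw [tsum_eq_sum (s := Finset.range N) hz, htel, ramp_of_ge (hbig N le_rfl)]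
      have hinj1 : Function.Injective fun k : ℕ => 2 * k := fun a b h => by simpa using h
      have hinj2 : Function.Injective fun k : ℕ => 2 * k + 1 := fun a b h => by simpa using h
      have heo := tsum_even_add_odd (f := fun n : ℕ => g x * annulus (16 ^ n * x))
        (hsum.comp_injective hinj1) (hsum.comp_injective hinj2)
      have e1 : ∀ k : ℕ, (16 : ℝ) ^ (2 * k) = 1 * 256 ^ k := fun k => by
        rw [pow_mul]; norm_num
      have e2 : ∀ k : ℕ, (16 : ℝ) ^ (2 * k + 1) = 16 * 256 ^ k := fun k => by
        rw [pow_succ, pow_mul]; norm_num [mul_comm]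
      simp only [e1, e2] at heo
      rw [h1 x, h2 x, htot] at heo
      rw [heo, mul_left_comm, hr]
      ring
  rw [key]
  refine hadd _ _ (hmul _ _ (contDiff_ramp.comp (contDiff_const.mul contDiff_id))
    (hg.mul contDiff_ramp) (fun x hx => ramp_of_le (by linarith)) (fun x hx => ?_))
    (hadd _ _ (hmul _ _ hu1 hv1 hu1' hv1') (hmul _ _ hu2 hv2 hu2' hv2'))
  rw [h0 x hx, zero_mul]

/-- Smooth functions supported in `[a, b]`. -/
structure IsSmoothOn (a b : ℝ) (g : ℝ → ℂ) : Prop where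
  smooth : ContDiff ℝ ∞ g
  zero : ∀ x, x ∉ Icc a b → g x = 0

theorem IsSmoothOn.hasCompactSupport {a b : ℝ} (h : IsSmoothOn a b g) : HasCompactSupport g :=
  HasCompactSupport.of_support_subset_isCompact (isCompact_Icc (a := a) (b := b)) fun x hx => by
    by_contra h'
    exact hx (h.zero x h')

theorem IsSmoothOn.zero_of_notMem_Ioo {a b : ℝ} (h : IsSmoothOn a b g) {x : ℝ}
    (hx : x ∉ Ioo a b) : g x = 0 := by
  have hc : IsClosed {y | g y = 0} := isClosed_eq h.smooth.continuous continuous_const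
  rcases le_or_gt x a with h1 | h1
  · have h2 : Iio a ⊆ {y | g y = 0} := fun y hy => h.zero y fun h' => not_lt.2 h'.1 hy
    have h3 := hc.closure_subset_iff.2 h2
    rw [closure_Iio] at h3
    exact h3 h1
  · have h2 : Ioi b ⊆ {y | g y = 0} := fun y hy => h.zero y fun h' => not_lt.2 h'.2 hy
    have h3 := hc.closure_subset_iff.2 h2
    rw [closure_Ioi] at h3
    exact h3 (not_lt.1 fun h4 => hx ⟨h1, h4⟩)

/-- Every smooth function supported in `[a, b]` is a finite sum of products of such functions. -/
theorem factor_induction {a b : ℝ} (hg : IsSmoothOn a b g) {P : (ℝ → ℂ) → Prop}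
    (hadd : ∀ u v, P u → P v → P fun x => u x + v x)
    (hmul : ∀ u v, IsSmoothOn a b u → IsSmoothOn a b v → P fun x => u x * v x) : P g := by
  rcases le_or_gt b a with hab | hab
  · have h1 : g = fun x => g x * g x := by
      ext x
      rw [hg.zero_of_notMem_Ioo (x := x) fun h => by linarith [h.1, h.2], mul_zero]
    rw [h1]
    exact hmul g g hg hg
  · have hd : 0 < b - a := by linarith
    let t : ℝ → ℝ := fun x => (x - a) / (b - a)
    have ht : ContDiff ℝ ∞ t := (contDiff_id.sub contDiff_const).div_const _
    -- The partition 1 = (1 − σ) + σ separates the two endpoints. The half-line factors need not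
    -- vanish beyond the far endpoint, so the square of a cutoff equal to 1 on the relevant piece is
    -- attached and shared, one copy to each factor.
    let κL : ℝ → ℂ := fun x => 1 - ramp (3 * t x - 1)
    let κR : ℝ → ℂ := fun x => ramp (3 * t x + 1)
    let σ : ℝ → ℂ := fun x => ramp (3 * t x)
    have hκL : ContDiff ℝ ∞ κL := contDiff_const.sub
      (contDiff_ramp.comp ((contDiff_const.mul ht).sub contDiff_const))
    have hκR : ContDiff ℝ ∞ κR :=
      contDiff_ramp.comp ((contDiff_const.mul ht).add contDiff_const)
    have hσ : ContDiff ℝ ∞ σ := contDiff_ramp.comp (contDiff_const.mul ht)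
    have hta : ∀ x, x ≤ a → t x ≤ 0 := fun x hx =>
      div_nonpos_of_nonpos_of_nonneg (by linarith) hd.le
    have htb : ∀ x, b ≤ x → 1 ≤ t x := fun x hx => by
      simp only [t]
      rw [le_div_iff₀ hd]
      linarith
    have hL : P fun x => κL x ^ 2 * ((1 - σ x) * g x) := by
      have := halfline_factor_induction (g := fun y => (1 - σ (y + a)) * g (y + a))
        (P := fun f => P fun x => κL x ^ 2 * f (x - a))
        ((contDiff_const.sub (hσ.comp (contDiff_id.add contDiff_const))).mul
          (hg.smooth.comp (contDiff_id.add contDiff_const)))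
        ((hg.hasCompactSupport.comp_homeomorph (Homeomorph.addRight a)).mul_left)
        (fun x hx => by
          rw [hg.zero_of_notMem_Ioo (x := x + a) fun h => by linarith [h.1], mul_zero])
        (fun u v hu hv => by simpa only [mul_add] using hadd _ _ hu hv)
        (fun u v hu hv hu0 hv0 => by
          have hcl : ∀ w : ℝ → ℂ, ContDiff ℝ ∞ w → (∀ x ≤ 0, w x = 0) →
              IsSmoothOn a b fun x => κL x * w (x - a) := fun w hw hw0 =>
            ⟨hκL.mul (hw.comp (contDiff_id.sub contDiff_const)), fun x hx => by
              rcases le_total x a with h | h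
              · rw [hw0 _ (by linarith), mul_zero]
              · have h3 := htb x (by by_contra h4; exact hx ⟨h, (not_le.1 h4).le⟩)
                simp only [κL]
                rw [ramp_of_ge (by linarith), sub_self, zero_mul]⟩
          have := hmul _ _ (hcl u hu hu0) (hcl v hv hv0)
          convert this using 2 with x
          ring)
      simpa only [sub_add_cancel] using this
    have hR : P fun x => κR x ^ 2 * (σ x * g x) := by
      have := halfline_factor_induction (g := fun y => σ (b - y) * g (b - y))
        (P := fun f => P fun x => κR x ^ 2 * f (b - x))
        ((hσ.comp (contDiff_const.sub contDiff_id)).mul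
          (hg.smooth.comp (contDiff_const.sub contDiff_id)))
        ((hg.hasCompactSupport.comp_homeomorph (Homeomorph.subLeft b)).mul_left)
        (fun x hx => by
          rw [hg.zero_of_notMem_Ioo (x := b - x) fun h => by linarith [h.2], mul_zero])
        (fun u v hu hv => by simpa only [mul_add] using hadd _ _ hu hv)
        (fun u v hu hv hu0 hv0 => by
          have hcl : ∀ w : ℝ → ℂ, ContDiff ℝ ∞ w → (∀ x ≤ 0, w x = 0) →
              IsSmoothOn a b fun x => κR x * w (b - x) := fun w hw hw0 =>
            ⟨hκR.mul (hw.comp (contDiff_const.sub contDiff_id)), fun x hx => by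
              rcases le_total b x with h | h
              · rw [hw0 _ (by linarith), mul_zero]
              · have h3 := hta x (by by_contra h4; exact hx ⟨(not_le.1 h4).le, h⟩)
                simp only [κR]
                rw [ramp_of_le (by linarith), zero_mul]⟩
          have := hmul _ _ (hcl u hu hu0) (hcl v hv hv0)
          convert this using 2 with x
          ring)
      simpa only [sub_sub_cancel] using this
    have hsum := hadd _ _ hL hR
    convert hsum using 2 with x
    have e1 : κL x ^ 2 * (1 - σ x) = 1 - σ x := by
      rcases le_total (t x) (2 / 3) with h | h
      · simp only [κL]
        rw [ramp_of_le (x := 3 * t x - 1) (by linarith)]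
        ring
      · simp only [σ]
        rw [ramp_of_ge (x := 3 * t x) (by linarith)]
        ring
    have e2 : κR x ^ 2 * σ x = σ x := by
      rcases le_total (t x) (1 / 3) with h | h
      · simp only [σ]
        rw [ramp_of_le (x := 3 * t x) (by linarith)]
        ring
      · simp only [κR]
        rw [ramp_of_ge (x := 3 * t x + 1) (by linarith)]
        ring
    linear_combination (-g x) * e1 - g x * e2

end Factorization

end SigalSoffer

/-! ### Monotone cutoffs and strong derivatives -/

namespace SigalSoffer

/-- A smooth decreasing cutoff `S`, equal to `1` on `(-∞, -2δ]` and to `0` on `[-δ, ∞)`, with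
`S' = -G²`. -/
structure IsCutoff (δ : ℝ) (S G : ℝ → ℝ) : Prop where
  smooth : ContDiff ℝ ∞ S
  smooth_sqrt : ContDiff ℝ ∞ G
  hasDerivAt : ∀ x, HasDerivAt S (-(G x * G x)) x
  nonneg : ∀ x, 0 ≤ S x
  le_one : ∀ x, S x ≤ 1
  one : ∀ x, x ≤ -(2 * δ) → S x = 1
  zero : ∀ x, -δ ≤ x → S x = 0

/-- A real function as a complex function. -/
def toC (f : ℝ → ℝ) (x : ℝ) : ℂ := (f x : ℂ)

section Cutoff
open MeasureTheory intervalIntegral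
variable {δ : ℝ} {S G : ℝ → ℝ}

/-- S is a normalized primitive of −χ² for a bump function χ. Starting from the square root makes G
smooth, which a given smooth S with S' ≤ 0 would not guarantee. -/
theorem exists_isCutoff (hδ : 0 < δ) : ∃ S G, IsCutoff δ S G := by
  let χ : ContDiffBump (-(3 / 2 * δ)) := ⟨δ / 4, δ / 2, by linarith, by linarith⟩
  have hχ : ContDiff ℝ ∞ fun x => χ x := χ.contDiff
  have hχ0 : ∀ x, x ≤ -(2 * δ) ∨ -δ ≤ x → χ x = 0 := by
    intro x hx
    refine χ.zero_of_le_dist ?_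
    change δ / 2 ≤ _
    rw [Real.dist_eq]
    rcases hx with hx | hx
    · rw [abs_of_nonpos (by linarith)]; linarith
    · rw [abs_of_nonneg (by linarith)]; linarith
  have hc : Continuous fun x => χ x * χ x := hχ.continuous.mul hχ.continuous
  let J : ℝ → ℝ := fun x => ∫ y in (-(2 * δ))..x, χ y * χ y
  have hJ : ∀ x, HasDerivAt J (χ x * χ x) x := fun x =>
    integral_hasDerivAt_right (hc.intervalIntegrable _ _) (hc.stronglyMeasurableAtFilter _ _)
      hc.continuousAt
  have hJpos : 0 < J (-δ) := by
    refine intervalIntegral_pos_of_pos_on (hc.intervalIntegrable _ _) (fun x hx => ?_) (by linarith)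
    have : 0 < χ x := by
      refine χ.pos_of_mem_ball ?_
      change dist _ _ < δ / 2
      rw [Real.dist_eq, abs_lt]
      constructor <;> linarith [hx.1, hx.2]
    positivity
  have hJm : Monotone J := monotone_of_deriv_nonneg (fun x => (hJ x).differentiableAt)
    fun x => by rw [(hJ x).deriv]; exact mul_self_nonneg _
  have hJl : ∀ x, x ≤ -(2 * δ) → J x = 0 := by
    intro x hx
    refine (integral_congr (g := fun _ => (0 : ℝ)) fun y hy => ?_).trans integral_zero
    rw [uIcc_of_ge hx] at hy
    simp only
    rw [hχ0 y (Or.inl hy.2), mul_zero]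
  have hJr : ∀ x, -δ ≤ x → J x = J (-δ) := by
    intro x hx
    have h1 := integral_add_adjacent_intervals (hc.intervalIntegrable (μ := volume) (-(2 * δ)) (-δ))
      (hc.intervalIntegrable (-δ) x)
    have h2 : ∫ y in (-δ)..x, χ y * χ y = 0 := by
      refine (integral_congr (g := fun _ => (0 : ℝ)) fun y hy => ?_).trans integral_zero
      rw [uIcc_of_le hx] at hy
      simp only
      rw [hχ0 y (Or.inr hy.1), mul_zero]
    rw [h2, add_zero] at h1
    exact h1.symm
  have hJs : ContDiff ℝ ∞ J := by
    rw [contDiff_infty_iff_deriv]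
    refine ⟨fun x => (hJ x).differentiableAt, ?_⟩
    rw [show deriv J = fun x => χ x * χ x from funext fun x => (hJ x).deriv]
    exact hχ.mul hχ
  have hJ0 : ∀ x, 0 ≤ J x := fun x => by
    rcases le_total x (-(2 * δ)) with h | h
    · rw [hJl x h]
    · rw [← hJl _ le_rfl]; exact hJm h
  have hJ1 : ∀ x, J x ≤ J (-δ) := fun x => by
    rcases le_total x (-δ) with h | h
    · exact hJm h
    · rw [hJr x h]
  refine ⟨fun x => 1 - J x / J (-δ), fun x => χ x / Real.sqrt (J (-δ)),
    contDiff_const.sub (hJs.div_const _), hχ.div_const _, fun x => ?_, fun x => ?_, fun x => ?_,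
    fun x hx => ?_, fun x hx => ?_⟩
  · refine (((hJ x).div_const (J (-δ))).const_sub 1).congr_deriv ?_
    rw [div_mul_div_comm, Real.mul_self_sqrt hJpos.le]
  · have := (div_le_one hJpos).2 (hJ1 x)
    linarith
  · have := div_nonneg (hJ0 x) hJpos.le
    linarith
  · rw [hJl x hx, zero_div, sub_zero]
  · rw [hJr x hx, div_self hJpos.ne', sub_self]

theorem contDiff_toC {f : ℝ → ℝ} (hf : ContDiff ℝ ∞ f) : ContDiff ℝ ∞ (toC f) :=
  Complex.ofRealCLM.contDiff.comp hf

theorem star_toC (f : ℝ → ℝ) (x : ℝ) : star (toC f x) = toC f x := by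
  simp [toC]

theorem IsCutoff.isStep (h : IsCutoff δ S G) : IsStep (toC S) := by
  refine ⟨contDiff_toC h.smooth, 2 * |δ|, 1, by positivity, fun x hx => ?_, fun x hx => ?_⟩
  · rw [toC, h.zero x (by linarith [neg_abs_le δ, abs_nonneg δ]), Complex.ofReal_zero]
  · rw [toC, h.one x (by linarith [le_abs_self δ]), Complex.ofReal_one]

theorem IsCutoff.deriv_eq (h : IsCutoff δ S G) (x : ℝ) :
    deriv (toC S) x = -(toC G x * toC G x) := by
  have := (h.hasDerivAt x).ofReal_comp.deriv
  change deriv (fun y => (S y : ℂ)) x = _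
  rw [this]
  simp [toC]

theorem IsCutoff.support_subset (h : IsCutoff δ S G) {x : ℝ} (hx : G x ≠ 0) :
    x ∈ Icc (-(2 * δ)) (-δ) := by
  by_contra h'
  refine hx (mul_self_eq_zero.1 (neg_eq_zero.1 ?_))
  rw [mem_Icc, not_and_or, not_le, not_le] at h'
  rcases h' with h1 | h1
  · have : S =ᶠ[𝓝 x] fun _ => 1 := by
      filter_upwards [gt_mem_nhds h1] with y hy
      exact h.one y hy.le
    rw [← (h.hasDerivAt x).deriv, this.deriv_eq, deriv_const]
  · have : S =ᶠ[𝓝 x] fun _ => 0 := by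
      filter_upwards [lt_mem_nhds h1] with y hy
      exact h.zero y hy.le
    rw [← (h.hasDerivAt x).deriv, this.deriv_eq, deriv_const]

theorem IsCutoff.tsupport_sqrt_subset (h : IsCutoff δ S G) :
    tsupport (toC G) ⊆ Icc (-(2 * δ)) (-δ) :=
  closure_minimal (fun x hx => h.support_subset fun h0 => hx (by simp [toC, h0])) isClosed_Icc

theorem IsCutoff.tsupport_deriv_subset (h : IsCutoff δ S G) :
    tsupport (deriv (toC S)) ⊆ Icc (-(2 * δ)) (-δ) :=
  closure_minimal (fun x hx => h.support_subset fun h0 => hx (by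
    rw [h.deriv_eq]; simp [toC, h0])) isClosed_Icc

theorem IsCutoff.isStep_sqrt (h : IsCutoff δ S G) : IsStep (toC G) :=
  IsStep.of_compact (contDiff_toC h.smooth_sqrt)
    (isCompact_Icc.of_isClosed_subset (isClosed_tsupport _) h.tsupport_sqrt_subset)

/-- The cutoff with parameter δ/4 equals 1 up to −δ/2, to the right of −δ where the supports of G
and S' end. Shrinking δ thus supplies the wider cutoff used in the induction. -/
theorem isLocalizer_toC (hδ : 0 < δ) {F J : ℝ → ℝ}
    (hF : IsCutoff (δ / 4) F J) {f : ℝ → ℂ} (hf : tsupport f ⊆ Icc (-(2 * δ)) (-δ)) :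
    IsLocalizer f (toC F) := by
  intro x hx
  have h1 : x < -(δ / 2) := by linarith [(hf hx).2]
  filter_upwards [gt_mem_nhds h1] with y hy
  rw [toC, hF.one y (by linarith), Complex.ofReal_one]

theorem IsCutoff.abs_sub_le (h : IsCutoff δ S G) : ∃ L, 0 ≤ L ∧ ∀ x y, |S y - S x| ≤ L * |y - x| := by
  obtain ⟨C, hC⟩ := h.isStep_sqrt.bddBorel.2
  have hC0 : 0 ≤ C := (norm_nonneg _).trans (hC 0)
  refine ⟨C * C, by positivity, fun x y => ?_⟩
  have := Convex.norm_image_sub_le_of_norm_hasDerivWithin_le (s := univ) (C := C * C)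
    (fun x _ => (h.hasDerivAt x).hasDerivWithinAt) (fun x _ => by
      have := hC x
      rw [toC, Complex.norm_real] at this
      rw [norm_neg, norm_mul]
      gcongr) convex_univ (mem_univ x) (mem_univ y)
  simpa [Real.norm_eq_abs] using this

end Cutoff

section Calculus
variable {E : Type*} [NormedAddCommGroup E] [InnerProductSpace ℂ E] [CompleteSpace E]
variable {Φ : (ℝ → ℂ) → E →L[ℂ] E} {δ : ℝ} {S G : ℝ → ℝ}
set_option linter.unusedSectionVars false

/-- Product rule for a bounded, strongly differentiable family of operators. -/
theorem hasDerivAt_apply {P : ℝ → E →L[ℂ] E} {φ : ℝ → E} {φ' y : E} {t C : ℝ}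
    (hP : HasDerivAt (fun r => P r (φ t)) y t) (hb : ∀ r, ‖P r‖ ≤ C)
    (hc : ∀ u, Tendsto (fun r => P r u) (𝓝 t) (𝓝 (P t u))) (hφ : HasDerivAt φ φ' t) :
    HasDerivAt (fun r => P r (φ r)) (y + P t φ') t := by
  rw [hasDerivAt_iff_tendsto_slope_zero] at hP hφ ⊢
  have hadd : Tendsto (fun r : ℝ => t + r) (𝓝[≠] 0) (𝓝 t) := by
    have : Tendsto (fun r : ℝ => t + r) (𝓝 0) (𝓝 (t + 0)) := tendsto_const_nhds.add tendsto_id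
    rw [add_zero] at this
    exact this.mono_left nhdsWithin_le_nhds
  have h1 : Tendsto (fun r : ℝ => P (t + r) (r⁻¹ • (φ (t + r) - φ t))) (𝓝[≠] 0) (𝓝 (P t φ')) := by
    have h2 : Tendsto (fun r : ℝ => P (t + r) (r⁻¹ • (φ (t + r) - φ t) - φ')) (𝓝[≠] 0) (𝓝 0) := by
      have h3 := (hφ.sub_const φ').norm.const_mul C
      rw [sub_self, norm_zero, mul_zero] at h3
      exact squeeze_zero_norm (fun r => (P (t + r)).le_of_opNorm_le (hb _) _) h3
    have h4 := h2.add ((hc φ').comp hadd)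
    rw [zero_add] at h4
    refine h4.congr fun r => ?_
    simp
  refine (hP.add h1).congr fun r => ?_
  have h5 : P (t + r) (r⁻¹ • (φ (t + r) - φ t)) = r⁻¹ • P (t + r) (φ (t + r) - φ t) :=
    ((P (t + r)).restrictScalars ℝ).map_smul _ _
  rw [h5, map_sub, ← smul_add]
  congr 1
  abel

/-- The difference quotients are bounded because S is Lipschitz, and converge pointwise; bounded
convergence in the calculus gives the strong derivative. The sign is positive because the cutoff
moves to the right and S' = −G². -/
theorem IsCutoff.hasDerivAt_rescale (h : IsBorelHom Φ) (hS : IsCutoff δ S G) {s : ℝ} (hs : 0 < s)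
    (c θ t : ℝ) (u : E) :
    HasDerivAt (fun r => Φ (rescale (toC S) s (c + θ * r)) u)
      (((θ / s : ℝ) : ℂ) • Φ (rescale (fun x => toC G x * toC G x) s (c + θ * t)) u) t := by
  obtain ⟨L, hL0, hL⟩ := hS.abs_sub_le
  rw [hasDerivAt_iff_tendsto_slope_zero]
  refine tendsto_of_seq_tendsto fun ε hε => ?_
  have hSb := hS.isStep.bddBorel
  have hGb := hS.isStep_sqrt.bddBorel
  let F : ℕ → ℝ → ℂ := fun n x => (((ε n)⁻¹ : ℝ) : ℂ) *
    (rescale (toC S) s (c + θ * (t + ε n)) x - rescale (toC S) s (c + θ * t) x)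
  have hF : ∀ n, BddBorel (F n) := fun n => ((hSb.rescale _ _).fun_sub (hSb.rescale _ _)).fun_const_mul _
  have hlim := h.tendsto_of_bounded F
    (fun x => ((θ / s : ℝ) : ℂ) * rescale (fun x => toC G x * toC G x) s (c + θ * t) x)
    (L * (|θ| / s)) (fun n => (hF n).1) (fun n x => ?_) (fun x => ?_) u
  · rw [h.map_smul _ _ ((hGb.fun_mul hGb).rescale _ _)] at hlim
    refine hlim.congr fun n => ?_
    rw [h.map_smul _ _ ((hSb.rescale _ _).fun_sub (hSb.rescale _ _)),
      h.map_sub (hSb.rescale _ _) (hSb.rescale _ _)]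
    rfl
  · simp only [F, rescale, toC]
    rw [← Complex.ofReal_sub, ← Complex.ofReal_mul, Complex.norm_real, Real.norm_eq_abs, abs_mul,
      abs_inv]
    by_cases h0 : ε n = 0
    · rw [h0, abs_zero, inv_zero, zero_mul]; positivity
    · rw [inv_mul_le_iff₀ (abs_pos.2 h0)]
      refine (hL _ _).trans (le_of_eq ?_)
      have : (x - (c + θ * (t + ε n))) / s - (x - (c + θ * t)) / s = -(θ * ε n / s) := by ring
      rw [this, abs_neg, abs_div, abs_mul, abs_of_pos hs]
      ring
  · have hd : HasDerivAt (fun r : ℝ => S ((x - (c + θ * r)) / s))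
        (-(G ((x - (c + θ * t)) / s) * G ((x - (c + θ * t)) / s)) * (-(θ * 1) / s)) t :=
      (hS.hasDerivAt _).comp t
        ((((hasDerivAt_id t).const_mul θ).const_add c).const_sub x |>.div_const s)
    rw [hasDerivAt_iff_tendsto_slope_zero] at hd
    have h2 := (Complex.continuous_ofReal.tendsto _).comp (hd.comp hε)
    refine (h2.congr fun n => ?_).trans (le_of_eq ?_)
    · simp only [F, rescale, toC, Function.comp_apply, smul_eq_mul]
      push_cast
      ring
    · congr 1
      simp only [rescale, toC]
      push_cast
      ring

end Calculus

end SigalSoffer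

namespace SigalSoffer

/-! ### The Mourre hypotheses at fixed ħ -/

section Pair
variable {E : Type*} [NormedAddCommGroup E] [InnerProductSpace ℂ E] [CompleteSpace E]
variable {K : ℕ → (ℝ → ℂ) → ℝ} {a b θ ħ₀ ħ : ℝ} {H A : E →ₗ.[ℂ] E} {g κ : ℝ → ℂ}

/-- The hypotheses of the propagation estimate at a fixed value of `ħ`. -/
structure IsMourrePair (K : ℕ → (ℝ → ℂ) → ℝ) (a b θ ħ₀ : ℝ) (H A : E →ₗ.[ℂ] E) (ħ : ℝ) : Prop where
  selfAdjoint_left : IsSelfAdjoint H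
  selfAdjoint_right : IsSelfAdjoint A
  pos : 0 < ħ
  le : ħ ≤ ħ₀
  ad_bound : ∀ (k : ℕ) (g : ℝ → ℂ), ContDiff ℝ ∞ g → HasCompactSupport g →
    ∃ T : E →L[ℂ] E, IsAd A (fc H g) k T ∧ ‖T‖ ≤ K k g * ħ ^ k
  mourre : MourreBound H A (Icc a b) θ ħ

theorem IsMourrePair.borel_left (h : IsMourrePair K a b θ ħ₀ H A ħ) : IsBorelCalculus H (fc H) :=
  fc_isBorelCalculus H h.selfAdjoint_left

theorem IsMourrePair.borel_right (h : IsMourrePair K a b θ ħ₀ H A ħ) : IsBorelCalculus A (fc A) :=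
  fc_isBorelCalculus A h.selfAdjoint_right

/-- A common bound for the rescaled commutators of order less than `N`. -/
noncomputable def adConst (K : ℕ → (ℝ → ℂ) → ℝ) (ħ₀ : ℝ) (N : ℕ) (g : ℝ → ℂ) : ℝ :=
  ∑ k ∈ Finset.range N, |K k g| * (1 + ħ₀) ^ k

theorem IsMourrePair.exists_chain (h : IsMourrePair K a b θ ħ₀ H A ħ) (hg : ContDiff ℝ ∞ g)
    (hs : HasCompactSupport g) : ∃ T : ℕ → E →L[ℂ] E, T 0 = fc H g ∧ IsChain A T ∧
      ∀ N m k, m ≤ k → k < N → ‖T k‖ ≤ adConst K ħ₀ N g * ħ ^ m := by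
  have hd := h.selfAdjoint_right.dense_domain
  obtain ⟨T, hT0, hT, had⟩ := SigalSoffer.exists_chain hd (B := fc H g) fun k =>
    (h.ad_bound k g hg hs).imp fun _ hk => hk.1
  refine ⟨T, hT0, hT, fun N m k hmk hkN => ?_⟩
  obtain ⟨T', h1, h2⟩ := h.ad_bound k g hg hs
  rw [IsAd.unique hd (had k) h1]
  have hħ := h.pos
  have hħ₀ := h.le
  -- The surplus powers of ħ are bounded through 1 + ħ₀, so one constant serves every m ≤ k.
  have hle : ħ ^ (k - m) ≤ (1 + ħ₀) ^ k :=
    (pow_le_pow_left₀ hħ.le (by linarith) _).trans (pow_le_pow_right₀ (by linarith) (by omega))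
  calc ‖T'‖ ≤ K k g * ħ ^ k := h2
    _ ≤ |K k g| * ħ ^ k := by gcongr; exact le_abs_self _
    _ = |K k g| * ħ ^ (k - m) * ħ ^ m := by rw [mul_assoc, ← pow_add, Nat.sub_add_cancel hmk]
    _ ≤ |K k g| * (1 + ħ₀) ^ k * ħ ^ m := by gcongr
    _ ≤ adConst K ħ₀ N g * ħ ^ m := by
        gcongr
        exact Finset.single_le_sum (f := fun k => |K k g| * (1 + ħ₀) ^ k)
          (fun i _ => by have : 0 ≤ 1 + ħ₀ := by linarith
                         positivity) (Finset.mem_range.2 hkN)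

/-- A smooth compactly supported real function which is the identity on `[a, b]`. -/
structure IsCutId (a b : ℝ) (κ : ℝ → ℂ) : Prop where
  smooth : ContDiff ℝ ∞ κ
  compact : HasCompactSupport κ
  real : ∀ x, star (κ x) = κ x
  eq_id : ∀ x ∈ Icc a b, κ x = x

theorem exists_isCutId (a b : ℝ) : ∃ κ, IsCutId a b κ := by
  let χ : ContDiffBump ((a + b) / 2) := ⟨|b - a| + 1, |b - a| + 2, by positivity, by linarith⟩
  refine ⟨toC fun x => x * χ x, contDiff_toC (contDiff_id.mul χ.contDiff),
    HasCompactSupport.of_support_subset_isCompact χ.hasCompactSupport fun x hx =>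
      subset_tsupport _ fun h0 => hx (by simp [toC, h0]),
    star_toC _, fun x hx => ?_⟩
  have : χ x = 1 := by
    refine χ.one_of_mem_closedBall ?_
    rw [Metric.mem_closedBall, Real.dist_eq]
    change |x - (a + b) / 2| ≤ |b - a| + 1
    have := le_abs_self (b - a)
    rw [abs_le]
    constructor <;> linarith [hx.1, hx.2]
  rw [toC, this, mul_one]

theorem IsSmoothOn.bddBorel (hg : IsSmoothOn a b g) : BddBorel g :=
  (IsStep.of_compact hg.smooth hg.hasCompactSupport).bddBorel

theorem IsCutId.bddBorel (hκ : IsCutId a b κ) : BddBorel κ :=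
  (IsStep.of_compact hκ.smooth hκ.compact).bddBorel

theorem IsCutId.mul_eq (hκ : IsCutId a b κ) (hg : IsSmoothOn a b g) (x : ℝ) :
    κ x * g x = (x : ℂ) * g x := by
  by_cases hx : x ∈ Icc a b
  · rw [hκ.eq_id x hx]
  · rw [hg.zero x hx, mul_zero, mul_zero]

theorem IsMourrePair.range_mem_domain (h : IsMourrePair K a b θ ħ₀ H A ħ) (hκ : IsCutId a b κ)
    (hg : IsSmoothOn a b g) (v : E) :
    ∃ hv : fc H g v ∈ H.domain, H ⟨_, hv⟩ = fc H κ (fc H g v) := by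
  have h1 : (fun x : ℝ => (x : ℂ) * g x) = fun x => κ x * g x := funext fun x => (hκ.mul_eq hg x).symm
  obtain ⟨hv, hv'⟩ := h.borel_left.range_mem_domain h.selfAdjoint_left hg.bddBorel
    (h1 ▸ hκ.bddBorel.fun_mul hg.bddBorel) v
  exact ⟨hv, by rw [hv', h1, h.borel_left.mul_apply hκ.bddBorel hg.bddBorel]⟩

theorem IsMourrePair.cutId_inner (h : IsMourrePair K a b θ ħ₀ H A ħ) (hκ : IsCutId a b κ) (u v : E) :
    ⟪fc H κ u, v⟫_ℂ = ⟪u, fc H κ v⟫_ℂ := by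
  rw [h.borel_left.inner_left hκ.bddBorel]
  simp only [hκ.real]

/-- The vector g(H)u lies in the range of χ_I(H). It is in the domain of H because g has compact
support, and in that of A because [g(H), A] is bounded. There H acts as the bounded operator κ(H),
so the form i[H, A] is that of T₁ = [κ(H), A]; a factor ħ turns the right side into θħ². -/
theorem IsMourrePair.mourre_le (h : IsMourrePair K a b θ ħ₀ H A ħ) (hκ : IsCutId a b κ)
    (hg : IsSmoothOn a b g) {R T : ℕ → E →L[ℂ] E} (hR0 : R 0 = fc H g) (hR : IsChain A R)
    (hT0 : T 0 = fc H κ) (hT : IsChain A T) :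
    ∀ u ∈ A.domain, θ * ħ ^ 2 * ‖R 0 u‖ ^ 2 ≤ (Complex.I * ⟪R 0 u, T 1 (R 0 u)⟫_ℂ).re := by
  intro u hu
  obtain ⟨hA, -⟩ := (hR 0).apply_mem_domain h.selfAdjoint_right ⟨u, hu⟩
  simp only at hA
  have hH := h.range_mem_domain hκ hg u
  have hp : spectralProj H (Icc a b) (R 0 u) = R 0 u := by
    rw [spectralProj, hR0, h.borel_left.mul_apply (bddBorel_indicator measurableSet_Icc) hg.bddBorel]
    congr 2
    ext x
    by_cases hx : x ∈ Icc a b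
    · simp [hx]
    · simp [hx, hg.zero x hx]
  rw [← hR0] at hH
  have hm := h.mourre (R 0 u)
  generalize R 0 u = w at *
  obtain ⟨hH, hH'⟩ := hH
  simp only [hp] at hm
  have h1 := hm hH hA
  have hħ := h.pos
  rw [le_inv_mul_iff₀ hħ] at h1
  have h2 : (⟪w, w⟫_ℂ).re = ‖w‖ ^ 2 := inner_self_eq_norm_sq (𝕜 := ℂ) w
  have h3 := hT 0 ⟨w, hA⟩ ⟨w, hA⟩
  simp only [zero_add] at h3
  rw [h2, commForm, hH', h.cutId_inner hκ, ← hT0, ← h3] at h1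
  calc _ = ħ * (θ * ħ * ‖w‖ ^ 2) := by ring
    _ ≤ _ := h1

end Pair

/-! ### Evolved states and expectations of cutoffs -/

section State
variable {E : Type*} [NormedAddCommGroup E] [InnerProductSpace ℂ E] [CompleteSpace E]
variable {K : ℕ → (ℝ → ℂ) → ℝ} {a b θ ħ₀ ħ δ s c τ : ℝ} {H A : E →ₗ.[ℂ] E} {g g' κ : ℝ → ℂ}
  {S G : ℝ → ℝ}

/-- The evolution `g(H) e^{-iτH/ħ²} χ_{[c, ∞)}(A) f`. -/
noncomputable def state (H A : E →ₗ.[ℂ] E) (g : ℝ → ℂ) (ħ c τ : ℝ) (f : E) : E :=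
  fc H g (evol H (τ / ħ ^ 2) (spectralProj A (Ici c) f))

theorem evol_eq_grp (H : E →ₗ.[ℂ] E) (r : ℝ) : evol H r = grp (fc H) (-r) := by
  rw [evol, grp]
  congr 1
  ext x
  push_cast
  ring_nf

theorem IsMourrePair.norm_state_le (h : IsMourrePair K a b θ ħ₀ H A ħ) (hg : BddBorel g)
    (c τ : ℝ) (f : E) : ‖state H A g ħ c τ f‖ ≤ supNorm g * ‖f‖ := by
  refine (h.borel_left.norm_apply_le hg (supNorm_nonneg g) hg.norm_le_supNorm _).trans ?_
  rw [evol_eq_grp, h.borel_left.norm_grp]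
  refine mul_le_mul_of_nonneg_left ?_ (supNorm_nonneg g)
  have h1 := h.borel_right.norm_apply_le (bddBorel_indicator (measurableSet_Ici (a := c))) zero_le_one
    (fun x => by by_cases hx : x ∈ Ici c <;> simp only [indicator, hx, if_true, if_false] <;> simp) f
  rwa [one_mul] at h1

theorem IsMourrePair.state_mul (h : IsMourrePair K a b θ ħ₀ H A ħ) (hg : BddBorel g)
    (hg' : BddBorel g') (c τ : ℝ) (f : E) :
    fc H g (state H A g' ħ c τ f) = state H A (fun x => g x * g' x) ħ c τ f :=
  h.borel_left.mul_apply hg hg' _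

/-- The energy cutoff keeps the state in the domain of H, where the generator may be replaced by
κ(H); no unbounded energy operator appears in the flux. -/
theorem IsMourrePair.hasDerivAt_state (h : IsMourrePair K a b θ ħ₀ H A ħ) (hκ : IsCutId a b κ)
    (hg : IsSmoothOn a b g) (c τ : ℝ) (f : E) :
    HasDerivAt (fun τ => state H A g ħ c τ f)
      ((-(Complex.I * (((ħ ^ 2)⁻¹ : ℝ) : ℂ))) • fc H κ (state H A g ħ c τ f)) τ := by
  set ψ := spectralProj A (Ici c) f
  obtain ⟨hv, hv'⟩ := h.borel_left.range_mem_domain h.selfAdjoint_left hg.bddBorel (by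
    rw [← funext (hκ.mul_eq hg)]; exact hκ.bddBorel.fun_mul hg.bddBorel) ψ
  have h1 : ∀ r, state H A g ħ c r f = grp (fc H) (-(r / ħ ^ 2)) (fc H g ψ) := fun r => by
    rw [state, evol_eq_grp]
    exact h.borel_left.commute_apply hg.bddBorel (bddBorel_exp _) _
  have h2 := (h.borel_left.hasDerivAt_grp ⟨_, hv⟩ (-(τ / ħ ^ 2))).scomp τ
    ((hasDerivAt_id τ).div_const (ħ ^ 2)).neg
  simp only [hv'] at h2
  rw [show (fun τ => state H A g ħ c τ f) = fun r => grp (fc H) (-(r / ħ ^ 2)) (fc H g ψ) from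
    funext h1]
  refine h2.congr_deriv ?_
  have h3 : fc H κ (grp (fc H) (-(τ / ħ ^ 2)) (fc H g ψ)) =
      grp (fc H) (-(τ / ħ ^ 2)) (fc H (fun x : ℝ => (x : ℂ) * g x) ψ) := by
    rw [grp, h.borel_left.commute_apply hκ.bddBorel (bddBorel_exp _),
      h.borel_left.mul_apply hκ.bddBorel hg.bddBorel, funext (hκ.mul_eq hg)]
  rw [h1, h3, ← Complex.coe_smul, smul_smul]
  congr 1
  push_cast
  ring

/-- The expectation of a rescaled cutoff of `A` in the state `u`. -/
noncomputable def expect (A : E →ₗ.[ℂ] E) (S : ℝ → ℝ) (s c : ℝ) (u : E) : ℝ :=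
  (⟪u, fc A (rescale (toC S) s c) u⟫_ℂ).re

theorem IsCutoff.expect_eq (hS : IsCutoff δ S G) (hA : IsSelfAdjoint A) (s c : ℝ) (u : E) :
    expect A S s c u = ‖fc A (rescale (toC fun x => √(S x)) s c) u‖ ^ 2 := by
  have h := (fc_isBorelCalculus A hA).toIsBorelHom.inner_nonneg
    (f := fun x => S ((x - c) / s)) (C := 1)
    (hS.smooth.continuous.measurable.comp ((measurable_id.sub_const c).div_const s))
    (fun x => hS.nonneg _) (fun x => hS.le_one _) u
  rw [expect]
  change (⟪u, fc A (fun x => (S ((x - c) / s) : ℂ)) u⟫_ℂ).re = _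
  rw [h, Complex.ofReal_re]
  rfl

theorem IsCutoff.expect_add_le (hS : IsCutoff δ S G) (hA : IsSelfAdjoint A) (s c : ℝ) (u v : E) :
    expect A S s c (u + v) ≤ 2 * expect A S s c u + 2 * expect A S s c v := by
  rw [hS.expect_eq hA, hS.expect_eq hA, hS.expect_eq hA, map_add]
  have h1 := norm_add_le (fc A (rescale (toC fun x => √(S x)) s c) u)
    (fc A (rescale (toC fun x => √(S x)) s c) v)
  have h2 := norm_nonneg (fc A (rescale (toC fun x => √(S x)) s c) u +
    fc A (rescale (toC fun x => √(S x)) s c) v)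
  nlinarith [sq_nonneg (‖fc A (rescale (toC fun x => √(S x)) s c) u‖ -
    ‖fc A (rescale (toC fun x => √(S x)) s c) v‖)]

theorem IsCutoff.norm_sq_le_expect (hS : IsCutoff δ S G) (hA : IsSelfAdjoint A) (s c : ℝ) (u : E) :
    ‖fc A (rescale (toC S) s c) u‖ ^ 2 ≤ expect A S s c u := by
  rw [hS.expect_eq hA]
  have h1 : ∀ x, ‖toC (fun x => √(S x)) x‖ ≤ 1 := fun x => by
    rw [toC, Complex.norm_real, Real.norm_of_nonneg (Real.sqrt_nonneg _)]
    exact Real.sqrt_le_one.2 (hS.le_one x)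
  have h2 := (fc_isBorelCalculus A hA).toIsBorelHom.norm_apply_le_of_le (C := 1)
    (hS.isStep.bddBorel.rescale s c) (g := rescale (toC fun x => √(S x)) s c)
    (BddBorel.rescale ⟨Complex.measurable_ofReal.comp hS.smooth.continuous.measurable.sqrt, 1, h1⟩ s c)
    zero_le_one (fun x => ?_) u
  · rw [one_mul] at h2
    gcongr
  · simp only [rescale, toC]
    rw [one_mul, Complex.norm_real, Complex.norm_real, Real.norm_of_nonneg (Real.sqrt_nonneg _),
      Real.norm_of_nonneg (hS.nonneg _)]
    refine Real.le_sqrt_of_sq_le ?_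
    nlinarith [hS.nonneg ((x - c) / s), hS.le_one ((x - c) / s)]

theorem IsCutoff.expect_le (hS : IsCutoff δ S G) (hA : IsSelfAdjoint A) (s c : ℝ) (u : E) :
    expect A S s c u ≤ ‖u‖ ^ 2 := by
  have h1 : ‖fc A (rescale (toC S) s c) u‖ ≤ 1 * ‖u‖ :=
    (fc_isBorelCalculus A hA).toIsBorelHom.norm_apply_le (hS.isStep.bddBorel.rescale s c) zero_le_one
    (fun x => by
      rw [rescale, toC, Complex.norm_real, Real.norm_of_nonneg (hS.nonneg _)]
      exact hS.le_one _) u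
  rw [one_mul] at h1
  calc _ ≤ ‖⟪u, fc A (rescale (toC S) s c) u⟫_ℂ‖ := Complex.re_le_norm _
    _ ≤ ‖u‖ * ‖fc A (rescale (toC S) s c) u‖ := norm_inner_le_norm _ _
    _ ≤ ‖u‖ * ‖u‖ := by gcongr
    _ = _ := by ring

/-- Heisenberg's equation for a time-dependent observable: the commutator term, plus the explicit
derivative of the moving cutoff. -/
theorem IsMourrePair.hasDerivAt_expect (h : IsMourrePair K a b θ ħ₀ H A ħ) (hκ : IsCutId a b κ)
    (hg : IsSmoothOn a b g) (hS : IsCutoff δ S G) (hs : 0 < s) (c τ : ℝ) (f : E) :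
    HasDerivAt (fun τ => expect A S s (c + θ * τ) (state H A g ħ c τ f))
      ((ħ ^ 2)⁻¹ * (Complex.I * ⟪state H A g ħ c τ f,
        fc H κ (fc A (rescale (toC S) s (c + θ * τ)) (state H A g ħ c τ f)) -
        fc A (rescale (toC S) s (c + θ * τ)) (fc H κ (state H A g ħ c τ f))⟫_ℂ).re +
        θ / s * ‖fc A (rescale (toC G) s (c + θ * τ)) (state H A g ħ c τ f)‖ ^ 2) τ := by
  have hφ := h.hasDerivAt_state hκ hg c τ f
  have hD := fun u => hS.hasDerivAt_rescale h.borel_right.toIsBorelHom hs c θ τ u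
  have hP := hasDerivAt_apply (hD (state H A g ħ c τ f))
    (fun r => h.borel_right.toIsBorelHom.norm_rescale_le hS.isStep.bddBorel s (c + θ * r))
    (fun u => (hD u).continuousAt) hφ
  have h1 := (hφ.inner ℂ hP)
  have h2 := Complex.reCLM.hasFDerivAt.comp_hasDerivAt τ h1
  refine h2.congr_deriv ?_
  set φ := state H A g ħ c τ f
  have h3 : ⟪φ, fc A (rescale (fun x => toC G x * toC G x) s (c + θ * τ)) φ⟫_ℂ =
      ((‖fc A (rescale (toC G) s (c + θ * τ)) φ‖ ^ 2 : ℝ) : ℂ) := by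
    rw [← h.borel_right.toIsBorelHom.inner_self_sq (hS.isStep_sqrt.bddBorel.rescale s _)]
    congr 3
    ext x
    simp only [rescale, star_toC]
  rw [inner_add_right, inner_smul_right, h3, map_smul, inner_smul_right, inner_smul_left,
    h.cutId_inner hκ, inner_sub_right, ← Complex.re_ofReal_mul, ← Complex.ofReal_mul,
    Complex.reCLM_apply]
  simp only [map_neg, map_mul, Complex.conj_I, Complex.conj_ofReal, Complex.add_re, Complex.ofReal_re]
  rw [add_assoc, add_comm, ← Complex.add_re]
  congr 2
  ring

end State

end SigalSoffer

/-! ### Induction on the order of decay -/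

namespace SigalSoffer

universe u
variable {K : ℕ → (ℝ → ℂ) → ℝ} {a b θ ħ₀ : ℝ}

/-- Uniform propagation estimate of order `j`: the state with energy localization `g`, which starts
in `A ≥ c`, has mass `O(s⁻ʲ)` in `A ≤ c + θτ - 2δs`, for `0 ≤ τ ≤ s`. -/
def Decay (K : ℕ → (ℝ → ℂ) → ℝ) (a b θ ħ₀ : ℝ) (j : ℕ) (g : ℝ → ℂ) : Prop :=
  ∀ δ : ℝ, 0 < δ → ∀ S G : ℝ → ℝ, IsCutoff δ S G → ∃ C : ℝ, 0 ≤ C ∧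
    ∀ (E : Type u) [NormedAddCommGroup E] [InnerProductSpace ℂ E] [CompleteSpace E]
      (H A : E →ₗ.[ℂ] E) (ħ : ℝ), IsMourrePair K a b θ ħ₀ H A ħ →
      ∀ s c τ : ℝ, 1 ≤ s → 0 ≤ τ → τ ≤ s → ∀ f : E,
        expect A S s (c + θ * τ) (state H A g ħ c τ f) ≤ C * s⁻¹ ^ j * ‖f‖ ^ 2

theorem decay_zero {g : ℝ → ℂ} (hg : BddBorel g) : Decay.{u} K a b θ ħ₀ 0 g := by
  intro δ hδ S G hS
  refine ⟨supNorm g ^ 2, by positivity, fun E _ _ _ H A ħ h s c τ hs h0 h1 f => ?_⟩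
  have h2 := h.norm_state_le hg c τ f
  calc _ ≤ ‖state H A g ħ c τ f‖ ^ 2 := hS.expect_le h.selfAdjoint_right _ _ _
    _ ≤ (supNorm g * ‖f‖) ^ 2 := by gcongr
    _ = _ := by ring

theorem Decay.add {j : ℕ} {g g' : ℝ → ℂ} (hg : BddBorel g) (hg' : BddBorel g')
    (h : Decay.{u} K a b θ ħ₀ j g) (h' : Decay.{u} K a b θ ħ₀ j g') :
    Decay.{u} K a b θ ħ₀ j fun x => g x + g' x := by
  intro δ hδ S G hS
  obtain ⟨C, hC, hCb⟩ := h δ hδ S G hS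
  obtain ⟨C', hC', hCb'⟩ := h' δ hδ S G hS
  refine ⟨2 * C + 2 * C', by positivity, fun E _ _ _ H A ħ hp s c τ hs h0 h1 f => ?_⟩
  have e : state H A (fun x => g x + g' x) ħ c τ f = state H A g ħ c τ f + state H A g' ħ c τ f := by
    simp only [state]
    rw [hp.borel_left.map_add g g' hg hg', add_apply]
  rw [e]
  have h2 := hS.expect_add_le hp.selfAdjoint_right s (c + θ * τ) (state H A g ħ c τ f)
    (state H A g' ħ c τ f)
  have h3 := hCb E H A ħ hp s c τ hs h0 h1 f
  have h4 := hCb' E H A ħ hp s c τ hs h0 h1 f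
  linarith

/-- The initial state has small mass to the left of its starting point. -/
theorem IsMourrePair.expect_zero_le {E : Type*} [NormedAddCommGroup E] [InnerProductSpace ℂ E]
    [CompleteSpace E] {H A : E →ₗ.[ℂ] E} {ħ δ s : ℝ} {g : ℝ → ℂ} {S G : ℝ → ℝ}
    (h : IsMourrePair K a b θ ħ₀ H A ħ) (hg : IsSmoothOn a b g) (hS : IsCutoff δ S G) (hδ : 0 < δ)
    {n : ℕ} (hn : 1 ≤ n) (hs : 0 < s) (c : ℝ) (f : E) :
    expect A S s c (state H A g ħ c 0 f) ≤
      commConst n (toC S) * adConst K ħ₀ (n + 1) (fun x => star (g x)) * supNorm g *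
        s⁻¹ ^ n * ‖f‖ ^ 2 := by
  have hgs : ContDiff ℝ ∞ fun x => star (g x) :=
    Complex.conjCLE.contDiff.comp hg.smooth
  have hgc : HasCompactSupport fun x => star (g x) :=
    HasCompactSupport.of_support_subset_isCompact hg.hasCompactSupport fun x hx =>
      subset_tsupport _ fun h0 => hx (by simp [h0])
  obtain ⟨T, hT0, hT, hTb⟩ := h.exists_chain hgs hgc
  set φ := state H A g ħ c 0 f
  set χ : ℝ → ℂ := (Ici c).indicator fun _ => 1
  have hχ : BddBorel χ := bddBorel_indicator measurableSet_Ici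
  have hΦ := h.borel_right.toIsBorelHom
  have hφ : φ = fc H g (fc A χ f) := by
    simp only [φ, state, evol_eq_grp, zero_div, neg_zero, h.borel_left.grp_zero]
    rfl
  have hχs : (fun x => star (χ x)) = χ := by
    ext x
    by_cases hx : x ∈ Ici c <;> simp [χ, hx]
  -- S and all its derivatives vanish on a neighbourhood of [0, ∞), hence the rescaled ones vanish
  -- on [c, ∞), where χ lives.
  have hvan : ∀ k y, fc A χ (fc A (rescale (iteratedDeriv k (toC S)) s c) y) = 0 := by
    intro k y
    rw [hΦ.mul_apply hχ ((hS.isStep.iteratedDeriv k).bddBorel.rescale s c)]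
    have : (fun x => χ x * rescale (iteratedDeriv k (toC S)) s c x) = fun _ => 0 := by
      ext x
      by_cases hx : x ∈ Ici c
      · have h1 : -δ < (x - c) / s := by
          have : 0 ≤ (x - c) / s := div_nonneg (sub_nonneg.2 hx) hs.le
          linarith
        have h2 : toC S =ᶠ[𝓝 ((x - c) / s)] fun _ => 0 := by
          filter_upwards [lt_mem_nhds h1] with z hz
          rw [toC, hS.zero z hz.le, Complex.ofReal_zero]
        have h3 : iteratedDeriv k (toC S) ((x - c) / s) = 0 := by
          rw [h2.iteratedDeriv_eq k, iteratedDeriv_const]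
          split_ifs <;> rfl
        rw [rescale, h3, mul_zero]
      · simp [χ, hx]
    rw [this, hΦ.map_zero, zero_apply]
  -- One of the two projections χ is moved, together with g(H)*, to the left of S; it annihilates
  -- every explicit term of the expansion and only the remainder survives.
  have key : ⟪φ, fc A (rescale (toC S) s c) φ⟫_ℂ =
      ⟪f, fc A χ (commRem (fc A) T (toC S) s c n φ)⟫_ℂ := by
    nth_rw 1 [hφ]
    rw [h.borel_left.inner_left hg.bddBorel, hΦ.inner_left hχ, hχs, ← hT0]
    congr 1
    simp only [commRem, sub_apply, sum_apply, smul_apply, mul_apply_eq_comp, map_sub, map_sum,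
      map_smul, hvan, smul_zero, Finset.sum_const_zero, sub_zero]
  have h1 := norm_commRem_le h.borel_right h.selfAdjoint_right hT hS.isStep hs c hn
  have h2 := hTb (n + 1) 0 n (by omega) (by omega)
  rw [pow_zero, mul_one] at h2
  have h3 : ‖φ‖ ≤ supNorm g * ‖f‖ := h.norm_state_le hg.bddBorel c 0 f
  have h4 : ‖fc A χ (commRem (fc A) T (toC S) s c n φ)‖ ≤
      1 * ‖commRem (fc A) T (toC S) s c n φ‖ := hΦ.norm_apply_le hχ zero_le_one
    (fun x => by by_cases hx : x ∈ Ici c <;> simp [χ, hx]) _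
  have h5 := commConst_nonneg n (toC S)
  have h6 := supNorm_nonneg g
  have h7 : 0 ≤ adConst K ħ₀ (n + 1) (fun x => star (g x)) := (norm_nonneg _).trans h2
  rw [expect, key]
  calc _ ≤ ‖⟪f, fc A χ (commRem (fc A) T (toC S) s c n φ)⟫_ℂ‖ := Complex.re_le_norm _
    _ ≤ ‖f‖ * ‖fc A χ (commRem (fc A) T (toC S) s c n φ)‖ := norm_inner_le_norm _ _
    _ ≤ ‖f‖ * (1 * (commConst n (toC S) * s⁻¹ ^ n *
        adConst K ħ₀ (n + 1) (fun x => star (g x)) * (supNorm g * ‖f‖))) := by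
      refine mul_le_mul_of_nonneg_left (h4.trans (mul_le_mul_of_nonneg_left ?_ zero_le_one))
        (norm_nonneg f)
      refine ((commRem (fc A) T (toC S) s c n).le_of_opNorm_le h1 φ).trans ?_
      gcongr
    _ = _ := by ring

/-- The flux through S is controlled by the masses that F sees in the states with cutoffs r and g·r,
both O(s⁻ʲ) by hypothesis. With the factor s⁻² from the flux and a time span at most s, one order is
gained. -/
theorem Decay.mul (hθ : 0 ≤ θ) (hħ₀ : 0 ≤ ħ₀) {j : ℕ} {g r : ℝ → ℂ} (hg : IsSmoothOn a b g)
    (hr : IsSmoothOn a b r) (h : Decay.{u} K a b θ ħ₀ j r)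
    (h' : Decay.{u} K a b θ ħ₀ j fun x => g x * r x) :
    Decay.{u} K a b θ ħ₀ (j + 1) fun x => g x * r x := by
  intro δ hδ S G hS
  obtain ⟨F, J, hF⟩ := exists_isCutoff (show 0 < δ / 4 by linarith)
  obtain ⟨C₁, hC₁, hb₁⟩ := h (δ / 4) (by linarith) F J hF
  obtain ⟨C₂, hC₂, hb₂⟩ := h' (δ / 4) (by linarith) F J hF
  obtain ⟨κ, hκ⟩ := exists_isCutId a b
  have hgr : IsSmoothOn a b fun x => g x * r x :=
    ⟨hg.smooth.mul hr.smooth, fun x hx => by rw [hg.zero x hx, zero_mul]⟩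
  -- This n is the number of orders by which the expansions are localized: s⁻ⁿ times the norm of the
  -- state is below X, which is of size s^{-j/2}, and the initial mass is already of the new order
  -- s⁻ⁿ. The expansions use commutators up to order 3n + 3, hence 3n + 4 terms.
  set n := j + 1
  set M := adConst K ħ₀ (3 * n + 4) κ + adConst K ħ₀ (3 * n + 4) g
  set L := |fluxConst n (toC S) (toC G) (toC F) M θ ħ₀|
  set D := C₁ + C₂ + supNorm r ^ 2 + supNorm (fun x => g x * r x) ^ 2
  set C₀ := |commConst n (toC S) * adConst K ħ₀ (n + 1) (fun x => star (g x * r x)) *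
    supNorm fun x => g x * r x|
  have hD : 0 ≤ D := by positivity
  refine ⟨C₀ + L * D, by positivity, fun E _ _ _ H A ħ hp s c τ hs h0 h1 f => ?_⟩
  have hs0 : 0 < s := by linarith
  have hsi : s⁻¹ ≤ 1 := inv_le_one_of_one_le₀ hs
  have hsi0 : 0 < s⁻¹ := by positivity
  have hħ := hp.pos
  obtain ⟨T, hT0, hT, hTb⟩ := hp.exists_chain hκ.smooth hκ.compact
  obtain ⟨R, hR0, hR, hRb⟩ := hp.exists_chain hg.smooth hg.hasCompactSupport
  have had : ∀ N g, 0 ≤ adConst K ħ₀ N g := fun N g =>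
    Finset.sum_nonneg fun k _ => by positivity
  have hM1 : adConst K ħ₀ (3 * n + 4) κ ≤ M := le_add_of_nonneg_right (had _ _)
  have hM2 : adConst K ħ₀ (3 * n + 4) g ≤ M := le_add_of_nonneg_left (had _ _)
  set X := √(D * s⁻¹ ^ j * ‖f‖ ^ 2)
  have hX : X ^ 2 = D * s⁻¹ ^ j * ‖f‖ ^ 2 := Real.sq_sqrt (by positivity)
  have hsj : s⁻¹ ^ n ≤ s⁻¹ ^ j := pow_le_pow_of_le_one hsi0.le hsi (by omega)
  have hle : ∀ {y : ℝ} (C : ℝ), C ≤ D → y ^ 2 ≤ C * s⁻¹ ^ j * ‖f‖ ^ 2 → y ≤ X := by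
    intro y C hC hy
    refine Real.le_sqrt_of_sq_le (hy.trans ?_)
    gcongr
  have hsn : ∀ {q : ℝ → ℂ} (t : ℝ), BddBorel q → supNorm q ^ 2 ≤ D →
      s⁻¹ ^ n * ‖state H A q ħ c t f‖ ≤ X := by
    intro q t hq hqD
    refine hle _ hqD ?_
    have h2 := hp.norm_state_le hq c t f
    have h3 : s⁻¹ ^ n * s⁻¹ ^ n ≤ s⁻¹ ^ j * 1 :=
      mul_le_mul hsj (pow_le_one₀ hsi0.le hsi) (by positivity) (by positivity)
    have h4 := supNorm_nonneg q
    calc (s⁻¹ ^ n * ‖state H A q ħ c t f‖) ^ 2 ≤ (s⁻¹ ^ n * (supNorm q * ‖f‖)) ^ 2 := by gcongr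
      _ = (s⁻¹ ^ n * s⁻¹ ^ n) * (supNorm q ^ 2 * ‖f‖ ^ 2) := by ring
      _ ≤ (s⁻¹ ^ j * 1) * (supNorm q ^ 2 * ‖f‖ ^ 2) := by gcongr
      _ = _ := by ring
  set φ := fun t => state H A (fun x => g x * r x) ħ c t f
  have hder := fun t => hp.hasDerivAt_expect hκ hgr hS hs0 c t f
  have hbound : ∀ t ∈ interior (Icc 0 s),
      deriv (fun t => expect A S s (c + θ * t) (φ t)) t ≤ L * s⁻¹ ^ 2 * X ^ 2 := by
    intro t ht
    rw [interior_Icc] at ht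
    rw [(hder t).deriv]
    have hw : R 0 (state H A r ħ c t f) = state H A (fun x => g x * r x) ħ c t f := by
      rw [hR0, hp.state_mul hg.bddBorel hr.bddBorel]
    -- G has compact support, so G(A) maps into the domain of A, as the Mourre bound requires.
    have hxG : BddBorel fun x : ℝ => (x : ℂ) * rescale (toC G) s (c + θ * t) x := by
      have h2 : Continuous fun x : ℝ => (x : ℂ) * rescale (toC G) s (c + θ * t) x := by
        have := hS.isStep_sqrt.smooth.continuous
        unfold rescale
        fun_prop
      refine ⟨h2.measurable, ?_⟩
      obtain ⟨B, hB⟩ := (isCompact_Icc (a := c + θ * t - 2 * δ * s)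
        (b := c + θ * t)).exists_bound_of_continuousOn h2.continuousOn
      refine ⟨max B 0, fun x => ?_⟩
      by_cases hx : x ∈ Icc (c + θ * t - 2 * δ * s) (c + θ * t)
      · exact (hB x hx).trans (le_max_left _ _)
      · have : G ((x - (c + θ * t)) / s) = 0 := by
          by_contra h3
          have h4 := hS.support_subset h3
          rw [mem_Icc, le_div_iff₀ hs0, div_le_iff₀ hs0] at h4
          have := mul_pos hδ hs0
          exact hx ⟨by linarith [h4.1], by linarith [h4.2]⟩
        simp only [rescale, toC, this, Complex.ofReal_zero, mul_zero, norm_zero]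
        exact le_max_right _ _
    obtain ⟨hwd, -⟩ := hp.borel_right.range_mem_domain hp.selfAdjoint_right
      (hS.isStep_sqrt.bddBorel.rescale s (c + θ * t)) hxG (state H A r ħ c t f)
    have hX1 : ∀ {q : ℝ → ℂ} {C : ℝ}, C ≤ D → expect A F s (c + θ * t) (state H A q ħ c t f) ≤
        C * s⁻¹ ^ j * ‖f‖ ^ 2 → ‖fc A (rescale (toC F) s (c + θ * t)) (state H A q ħ c t f)‖ ≤ X :=
      fun hC hq => hle _ hC ((hF.norm_sq_le_expect hp.selfAdjoint_right _ _ _).trans hq)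
    have hfl := flux_le hp.borel_right hp.selfAdjoint_right hT hR hS.isStep hS.isStep_sqrt
      hF.isStep (star_toC F) (star_toC G) hS.deriv_eq
      (isLocalizer_toC hδ hF hS.tsupport_deriv_subset)
      (isLocalizer_toC hδ hF hS.tsupport_sqrt_subset) hs (show 1 ≤ n by omega) hθ hħ.le hp.le
      (M := M) (X := X) (c := c + θ * t)
      (by have := hTb (3 * n + 4) 1 1 le_rfl (by omega)
          rw [pow_one] at this
          exact this.trans (by gcongr))
      (fun k h2 h3 => (hTb (3 * n + 4) 2 k h2 (by omega)).trans (by gcongr))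
      (by have := hRb (3 * n + 4) 0 0 le_rfl (by omega)
          rw [pow_zero, mul_one] at this
          exact this.trans hM2)
      (fun k h2 h3 => by
          have := hRb (3 * n + 4) 1 k h2 (by omega)
          rw [pow_one] at this
          exact this.trans (by gcongr))
      (hp.mourre_le hκ hg hR0 hR hT0 hT) hwd
      (hX1 (by linarith [sq_nonneg (supNorm r), sq_nonneg (supNorm fun x => g x * r x)])
        (hb₁ E H A ħ hp s c t hs ht.1.le ht.2.le f))
      (hsn t hr.bddBorel (by linarith [sq_nonneg (supNorm fun x => g x * r x)]))
      (by rw [hw]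
          exact hX1 (by linarith [sq_nonneg (supNorm r), sq_nonneg (supNorm fun x => g x * r x)])
            (hb₂ E H A ħ hp s c t hs ht.1.le ht.2.le f))
      (by rw [hw]
          exact hsn t hgr.bddBorel (by linarith [sq_nonneg (supNorm r)]))
    rw [hw, hT0] at hfl
    have h2 := mul_le_mul_of_nonneg_left hfl (show 0 ≤ (ħ ^ 2)⁻¹ by positivity)
    have h3 : fluxConst n (toC S) (toC G) (toC F) M θ ħ₀ * s⁻¹ ^ 2 * X ^ 2 ≤ L * s⁻¹ ^ 2 * X ^ 2 := by
      gcongr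
      exact le_abs_self _
    have h4 : ∀ y z : ℝ, (ħ ^ 2)⁻¹ * (-(s⁻¹ * (θ * ħ ^ 2 * y)) + z * s⁻¹ ^ 2 * ħ ^ 2 * X ^ 2) =
        -(θ / s * y) + z * s⁻¹ ^ 2 * X ^ 2 := fun y z => by
      field_simp
    rw [h4] at h2
    linarith
  -- The terms (θ/s)‖Gφ‖² have cancelled, so the derivative is at most L s⁻² X² and the mean value
  -- inequality integrates it from 0 to τ.
  have hmv := Convex.image_sub_le_mul_sub_of_deriv_le (convex_Icc 0 s)
    (fun t _ => (hder t).continuousAt.continuousWithinAt)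
    (fun t _ => (hder t).differentiableAt.differentiableWithinAt) hbound 0 ⟨le_rfl, hs0.le⟩ τ ⟨h0, h1⟩ h0
  have hin := hp.expect_zero_le hgr hS hδ (show 1 ≤ n by omega) hs0 c f
  have hin' : expect A S s c (φ 0) ≤ C₀ * s⁻¹ ^ n * ‖f‖ ^ 2 := by
    refine hin.trans ?_
    gcongr
    exact le_abs_self _
  rw [mul_zero, add_zero, sub_zero, hX] at hmv
  have h5 : L * s⁻¹ ^ 2 * (D * s⁻¹ ^ j * ‖f‖ ^ 2) * τ ≤ L * D * s⁻¹ ^ n * ‖f‖ ^ 2 := by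
    calc _ ≤ L * s⁻¹ ^ 2 * (D * s⁻¹ ^ j * ‖f‖ ^ 2) * s := by gcongr
      _ = L * D * (s⁻¹ * s⁻¹ ^ j) * ‖f‖ ^ 2 * (s⁻¹ * s) := by ring
      _ = _ := by rw [inv_mul_cancel₀ hs0.ne', ← pow_succ']; ring
  linarith

/-- The induction hypothesis is available for every cutoff supported in [a, b], hence for both r and
g·r; factorization passes from products to all cutoffs. -/
theorem decay_of_isSmoothOn (hθ : 0 ≤ θ) (hħ₀ : 0 ≤ ħ₀) (j : ℕ) :
    ∀ {g : ℝ → ℂ}, IsSmoothOn a b g → Decay.{u} K a b θ ħ₀ j g := by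
  induction j with
  | zero => exact fun hg => decay_zero hg.bddBorel
  | succ j ih =>
    intro g hg
    refine (factor_induction hg (P := fun g => BddBorel g ∧ Decay.{u} K a b θ ħ₀ (j + 1) g)
      (fun v w hv hw => ⟨hv.1.fun_add hw.1, hv.2.add hv.1 hw.1 hw.2⟩) fun v w hv hw => ?_).2
    have hvw : IsSmoothOn a b fun x => v x * w x :=
      ⟨hv.smooth.mul hw.smooth, fun x hx => by rw [hv.zero x hx, zero_mul]⟩
    exact ⟨hvw.bddBorel, Decay.mul hθ hħ₀ hv hw (ih hw) (ih hvw)⟩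

end SigalSoffer

/-! ### From propagation of cutoffs to weighted estimates -/

namespace SigalSoffer

theorem one_le_bracket (x : ℝ) : 1 ≤ bracket x := Real.one_le_sqrt.2 (by nlinarith [sq_nonneg x])

theorem abs_le_bracket (x : ℝ) : |x| ≤ bracket x := Real.abs_le_sqrt (by linarith)

theorem bracket_le_one_add_abs (x : ℝ) : bracket x ≤ 1 + |x| :=
  Real.sqrt_le_iff.2 ⟨by positivity, by nlinarith [sq_abs x, abs_nonneg x]⟩

section Weight
variable {E : Type*} [NormedAddCommGroup E] [InnerProductSpace ℂ E] [CompleteSpace E]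
variable {A : E →ₗ.[ℂ] E} {α : ℝ}

/-- The function `⟨x⟩^{-α}`. -/
noncomputable def weightFun (α x : ℝ) : ℂ := ((bracket x ^ (-α) : ℝ) : ℂ)

theorem norm_weightFun (α x : ℝ) : ‖weightFun α x‖ = bracket x ^ (-α) := by
  rw [weightFun, Complex.norm_real, Real.norm_of_nonneg]
  exact Real.rpow_nonneg (Real.sqrt_nonneg _) _

theorem norm_weightFun_le_one (hα : 0 ≤ α) (x : ℝ) : ‖weightFun α x‖ ≤ 1 := by
  rw [norm_weightFun]
  exact Real.rpow_le_one_of_one_le_of_nonpos (one_le_bracket x) (by linarith)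

theorem norm_weightFun_le (hα : 0 ≤ α) {r x : ℝ} (hr : 0 < r) (h : r ≤ |x|) :
    ‖weightFun α x‖ ≤ r ^ (-α) := by
  rw [norm_weightFun]
  exact Real.rpow_le_rpow_of_nonpos hr (h.trans (abs_le_bracket x)) (by linarith)

theorem bddBorel_weightFun (hα : 0 ≤ α) : BddBorel (weightFun α) := by
  refine ⟨Complex.measurable_ofReal.comp (Measurable.pow_const ?_ _), 1, norm_weightFun_le_one hα⟩
  unfold bracket
  fun_prop

theorem norm_weight_apply_le (hA : IsSelfAdjoint A) (hα : 0 ≤ α) (u : E) :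
    ‖weight A α u‖ ≤ ‖u‖ := by
  have := (fc_isBorelCalculus A hA).toIsBorelHom.norm_apply_le (bddBorel_weightFun hα) zero_le_one
    (norm_weightFun_le_one hα) u
  rwa [one_mul] at this

theorem weight_inner (hA : IsSelfAdjoint A) (hα : 0 ≤ α) (u v : E) :
    ⟪weight A α u, v⟫_ℂ = ⟪u, weight A α v⟫_ℂ := by
  have := (fc_isBorelCalculus A hA).toIsBorelHom.inner_left (bddBorel_weightFun hα) u v
  rw [show (fun x => star (weightFun α x)) = weightFun α from
    funext fun x => star_toC (fun x => bracket x ^ (-α)) x] at this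
  exact this

/-- Away from the origin the weight is small. -/
theorem norm_weight_sub_le (hA : IsSelfAdjoint A) (hα : 0 ≤ α) {s : Set ℝ} (hs : MeasurableSet s)
    {r : ℝ} (hr : 0 < r) (h : ∀ x ∉ s, r ≤ |x|) (u : E) :
    ‖weight A α u - spectralProj A s (weight A α u)‖ ≤ r ^ (-α) * ‖u‖ := by
  have hΦ := (fc_isBorelCalculus A hA).toIsBorelHom
  have hw := bddBorel_weightFun hα
  have hi := bddBorel_indicator hs
  have e : weight A α u - spectralProj A s (weight A α u) =
      fc A (fun x => weightFun α x - s.indicator (fun _ => 1) x * weightFun α x) u := by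
    rw [hΦ.map_sub hw (hi.fun_mul hw), sub_apply, ← hΦ.mul_apply hi hw]
    rfl
  rw [e]
  refine hΦ.norm_apply_le (hw.fun_sub (hi.fun_mul hw)) (Real.rpow_nonneg hr.le _) (fun x => ?_) u
  by_cases hx : x ∈ s
  · simp only [indicator_of_mem hx, one_mul, sub_self, norm_zero]
    exact Real.rpow_nonneg hr.le _
  · simp only [indicator_of_notMem hx, zero_mul, sub_zero]
    exact norm_weightFun_le hα hr (h x hx)

end Weight

universe u
variable {K : ℕ → (ℝ → ℂ) → ℝ} {a b θ ħ₀ α : ℝ}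

/-- The propagation estimate at positive times. -/
theorem exists_forward_bound (hθ : 0 < θ) (hħ₀ : 0 ≤ ħ₀) (hα : 0 ≤ α) {g : ℝ → ℂ}
    (hg : IsSmoothOn a b g) : ∃ C : ℝ, 0 ≤ C ∧
    ∀ (E : Type u) [NormedAddCommGroup E] [InnerProductSpace ℂ E] [CompleteSpace E]
      (H A : E →ₗ.[ℂ] E) (ħ : ℝ), IsMourrePair K a b θ ħ₀ H A ħ → ∀ τ : ℝ, 0 ≤ τ → ∀ f : E,
        ‖weight A α (evol H (τ / ħ ^ 2) (fc H g (weight A α f)))‖ ≤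
          C * bracket τ ^ (-α) * ‖f‖ := by
  -- The decay bounds a squared norm, so order j ≥ 2α gives τ^{-α}.
  obtain ⟨j, hj⟩ := exists_nat_ge (2 * α)
  -- With δ = θ/8, s = τ and c = −θτ/4 the cutoff equals 1 for A ≤ c + θτ − 2δτ = θτ/2.
  obtain ⟨S, G, hS⟩ := exists_isCutoff (show 0 < θ / 8 by linarith)
  obtain ⟨C, hC, hb⟩ := decay_of_isSmoothOn.{u} (K := K) hθ.le hħ₀ j hg _ (by linarith) S G hS
  set γ := supNorm g
  have hγ : 0 ≤ γ := supNorm_nonneg g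
  have hq : 0 ≤ (θ / 4) ^ (-α) := Real.rpow_nonneg (by linarith) _
  refine ⟨(γ + (√C + 2 * (γ * (θ / 4) ^ (-α)))) * 2 ^ α, by positivity,
    fun E _ _ _ H A ħ hp τ hτ f => ?_⟩
  have hA := hp.selfAdjoint_right
  have hbr : 0 < bracket τ := zero_lt_one.trans_le (one_le_bracket τ)
  have hfc : ∀ r u, ‖evol H r (fc H g u)‖ ≤ γ * ‖u‖ := fun r u => by
    rw [evol_eq_grp, hp.borel_left.norm_grp]
    exact hp.borel_left.norm_apply_le hg.bddBorel hγ hg.bddBorel.norm_le_supNorm u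
  have hscale : ∀ r : ℝ, 0 < r → bracket τ ≤ 2 * r → r ^ (-α) ≤ 2 ^ α * bracket τ ^ (-α) := by
    intro r hr h
    have h1 := Real.rpow_le_rpow_of_nonpos hbr h (show -α ≤ 0 by linarith)
    rw [Real.mul_rpow zero_le_two hr.le, Real.rpow_neg zero_le_two,
      inv_mul_le_iff₀ (Real.rpow_pos_of_pos two_pos _)] at h1
    exact h1
  have hb0 : 0 ≤ bracket τ ^ (-α) := Real.rpow_nonneg hbr.le _
  rcases le_total τ 1 with h1 | h1
  · have h2 := hscale 1 one_pos (by
      have := bracket_le_one_add_abs τ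
      rw [abs_of_nonneg hτ] at this
      linarith)
    rw [Real.one_rpow] at h2
    calc _ ≤ γ * ‖f‖ := (norm_weight_apply_le hA hα _).trans ((hfc _ _).trans
          (mul_le_mul_of_nonneg_left (norm_weight_apply_le hA hα f) hγ))
      _ ≤ γ * ‖f‖ * (2 ^ α * bracket τ ^ (-α)) := le_mul_of_one_le_right (by positivity) h2
      _ ≤ (γ + (√C + 2 * (γ * (θ / 4) ^ (-α)))) * ‖f‖ * (2 ^ α * bracket τ ^ (-α)) := by
          gcongr
          exact le_add_of_nonneg_right (by positivity)
      _ = _ := by ring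
  have hτ0 : 0 < τ := by linarith
  have h2 := hscale τ hτ0 (by
    have := bracket_le_one_add_abs τ
    rw [abs_of_nonneg hτ] at this
    linarith)
  set c := -(θ * τ / 4) with hc
  have hr : 0 < θ / 4 * τ := by positivity
  have hrp : (θ / 4 * τ) ^ (-α) = (θ / 4) ^ (-α) * τ ^ (-α) :=
    Real.mul_rpow (by positivity) hτ0.le
  set w := weight A α f
  have hw : ‖w‖ ≤ ‖f‖ := norm_weight_apply_le hA hα f
  set φ := state H A g ħ c τ w with hφ
  have hφn : ‖φ‖ ≤ γ * ‖f‖ := (hp.norm_state_le hg.bddBorel c τ w).trans (by gcongr)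
  -- The part of the weighted vector in A < c is small by the weight on the right; what starts in A
  -- ≥ c is treated by propagation and by the weight on the left.
  have e1 : evol H (τ / ħ ^ 2) (fc H g w) = φ +
      evol H (τ / ħ ^ 2) (fc H g (w - spectralProj A (Ici c) w)) := by
    have : φ = evol H (τ / ħ ^ 2) (fc H g (spectralProj A (Ici c) w)) := by
      rw [hφ, state, evol_eq_grp]
      exact hp.borel_left.commute_apply hg.bddBorel (bddBorel_exp _) _
    rw [this, ← map_add, ← map_add, add_sub_cancel]
  have t1 : ‖weight A α (evol H (τ / ħ ^ 2) (fc H g (w - spectralProj A (Ici c) w)))‖ ≤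
      γ * ((θ / 4) ^ (-α) * τ ^ (-α) * ‖f‖) := by
    refine (norm_weight_apply_le hA hα _).trans ((hfc _ _).trans (mul_le_mul_of_nonneg_left ?_ hγ))
    rw [← hrp]
    refine norm_weight_sub_le hA hα measurableSet_Ici hr (fun x hx => ?_) f
    have h3 : x < c := not_le.1 hx
    rw [abs_of_neg (by linarith)]
    linarith
  have t2 : ‖weight A α φ - spectralProj A (Iic (θ / 2 * τ)) (weight A α φ)‖ ≤
      (θ / 4) ^ (-α) * τ ^ (-α) * (γ * ‖f‖) := by
    rw [← hrp]
    refine (norm_weight_sub_le hA hα measurableSet_Iic hr (fun x hx => ?_) φ).trans ?_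
    · have h3 : θ / 2 * τ < x := not_le.1 hx
      rw [abs_of_pos (by linarith)]
      linarith
    · have := Real.rpow_nonneg hr.le (-α)
      gcongr
  have t3 : ‖spectralProj A (Iic (θ / 2 * τ)) (weight A α φ)‖ ≤ √C * τ ^ (-α) * ‖f‖ := by
    have hi := bddBorel_indicator (measurableSet_Iic (a := θ / 2 * τ))
    have hSm : BddBorel (toC fun x => √(S x)) := by
      refine ⟨Complex.measurable_ofReal.comp hS.smooth.continuous.measurable.sqrt, 1, fun x => ?_⟩
      rw [toC, Complex.norm_real, Real.norm_of_nonneg (Real.sqrt_nonneg _)]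
      exact Real.sqrt_le_one.2 (hS.le_one x)
    have h3 : ‖spectralProj A (Iic (θ / 2 * τ)) (weight A α φ)‖ ≤
        1 * ‖fc A (rescale (toC fun x => √(S x)) τ (c + θ * τ)) φ‖ := by
      have e2 : spectralProj A (Iic (θ / 2 * τ)) (weight A α φ) = fc A (fun x =>
          (Iic (θ / 2 * τ)).indicator (fun _ => 1) x * weightFun α x) φ :=
        hp.borel_right.mul_apply hi (bddBorel_weightFun hα) φ
      rw [e2]
      refine hp.borel_right.norm_apply_le_of_le (hi.fun_mul (bddBorel_weightFun hα))
        (hSm.rescale _ _) zero_le_one (fun x => ?_) φ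
      by_cases hx : x ∈ Iic (θ / 2 * τ)
      · rw [indicator_of_mem hx, one_mul, one_mul, rescale, toC, hS.one, Real.sqrt_one,
          Complex.ofReal_one, norm_one]
        · exact norm_weightFun_le_one hα x
        · rw [div_le_iff₀ hτ0]
          have := mem_Iic.1 hx
          linarith
      · rw [indicator_of_notMem hx, zero_mul, norm_zero]
        positivity
    have h4 := hb E H A ħ hp τ c τ h1 hτ le_rfl w
    rw [hS.expect_eq hA] at h4
    rw [one_mul] at h3
    refine h3.trans (Real.le_sqrt_of_sq_le h4 |>.trans ?_)
    have h5 : τ⁻¹ ^ j ≤ (τ ^ (-α)) ^ 2 := by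
      rw [inv_pow, ← Real.rpow_natCast, ← Real.rpow_neg hτ0.le, ← Real.rpow_natCast (τ ^ (-α)),
        ← Real.rpow_mul hτ0.le]
      exact Real.rpow_le_rpow_of_exponent_le h1 (by push_cast; linarith)
    have h6 : 0 ≤ τ ^ (-α) := Real.rpow_nonneg hτ0.le _
    refine Real.sqrt_le_iff.2 ⟨by positivity, ?_⟩
    calc C * τ⁻¹ ^ j * ‖w‖ ^ 2 ≤ C * (τ ^ (-α)) ^ 2 * ‖f‖ ^ 2 := by gcongr
      _ = (√C * τ ^ (-α) * ‖f‖) ^ 2 := by rw [mul_pow, mul_pow, Real.sq_sqrt hC]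
  have t4 : ‖weight A α φ‖ ≤ √C * τ ^ (-α) * ‖f‖ + (θ / 4) ^ (-α) * τ ^ (-α) * (γ * ‖f‖) := by
    have := norm_add_le (spectralProj A (Iic (θ / 2 * τ)) (weight A α φ))
      (weight A α φ - spectralProj A (Iic (θ / 2 * τ)) (weight A α φ))
    rw [add_sub_cancel] at this
    linarith
  rw [e1, map_add]
  calc _ ≤ (√C + 2 * (γ * (θ / 4) ^ (-α))) * ‖f‖ * τ ^ (-α) :=
        (norm_add_le _ _).trans ((add_le_add t4 t1).trans (le_of_eq (by ring)))
    _ ≤ (γ + (√C + 2 * (γ * (θ / 4) ^ (-α)))) * ‖f‖ * (2 ^ α * bracket τ ^ (-α)) := by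
        gcongr ?_ * ‖f‖ * ?_
        exact le_add_of_nonneg_left hγ
    _ = _ := by ring

/-- The propagation estimate at all times. -/
theorem exists_propagation_bound (hθ : 0 < θ) (hħ₀ : 0 ≤ ħ₀) (hα : 0 ≤ α) {g : ℝ → ℂ}
    (hg : IsSmoothOn a b g) : ∃ C : ℝ,
    ∀ (E : Type u) [NormedAddCommGroup E] [InnerProductSpace ℂ E] [CompleteSpace E]
      (H A : E →ₗ.[ℂ] E) (ħ : ℝ), IsMourrePair K a b θ ħ₀ H A ħ → ∀ (τ : ℝ) (f : E),
        ‖weight A α (evol H (τ / ħ ^ 2) (fc H g (weight A α f)))‖ ≤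
          C * bracket τ ^ (-α) * ‖f‖ := by
  have hgs : IsSmoothOn a b fun x => star (g x) :=
    ⟨Complex.conjCLE.contDiff.comp hg.smooth, fun x hx => by rw [hg.zero x hx, star_zero]⟩
  obtain ⟨C, hC, h1⟩ := exists_forward_bound.{u} (K := K) hθ hħ₀ hα hg
  obtain ⟨C', hC', h2⟩ := exists_forward_bound.{u} (K := K) hθ hħ₀ hα hgs
  refine ⟨C + C', fun E _ _ _ H A ħ hp τ f => ?_⟩
  have hb : 0 ≤ bracket τ ^ (-α) := Real.rpow_nonneg (Real.sqrt_nonneg _) _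
  rcases le_total 0 τ with hτ | hτ
  · refine (h1 E H A ħ hp τ hτ f).trans ?_
    gcongr
    linarith
  set y := weight A α (evol H (τ / ħ ^ 2) (fc H g (weight A α f)))
  have hy := h2 E H A ħ hp (-τ) (by linarith) y
  have hbr : bracket (-τ) = bracket τ := by simp [bracket]
  rw [hbr] at hy
  have hA := hp.selfAdjoint_right
  -- The adjoint of the operator at time τ with cutoff g is the one at time −τ with the conjugate
  -- cutoff, so the forward estimate bounds ‖y‖² by ‖f‖ ‖y‖.
  have e : ⟪y, y⟫_ℂ = ⟪f, weight A α (evol H (-τ / ħ ^ 2)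
      (fc H (fun x => star (g x)) (weight A α y)))⟫_ℂ := by
    nth_rw 1 [show y = weight A α (evol H (τ / ħ ^ 2) (fc H g (weight A α f))) from rfl]
    rw [weight_inner hA hα, evol_eq_grp, hp.borel_left.grp_inner, hp.borel_left.inner_left hg.bddBorel,
      weight_inner hA hα, evol_eq_grp, neg_neg, neg_div, neg_neg]
    congr 2
    exact hp.borel_left.commute_apply hgs.bddBorel (bddBorel_exp _) _
  have h3 : ‖y‖ * ‖y‖ ≤ C' * bracket τ ^ (-α) * ‖f‖ * ‖y‖ := by
    calc ‖y‖ * ‖y‖ = ‖⟪y, y⟫_ℂ‖ := by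
          rw [inner_self_eq_norm_sq_to_K, norm_pow, RCLike.norm_ofReal, abs_norm, pow_two]
      _ ≤ ‖f‖ * (C' * bracket τ ^ (-α) * ‖y‖) := by
          rw [e]
          exact (norm_inner_le_norm _ _).trans (by gcongr)
      _ = _ := by ring
  have h4 : ‖y‖ ≤ C' * bracket τ ^ (-α) * ‖f‖ := by
    rcases eq_or_lt_of_le (norm_nonneg y) with h0 | h0
    · rw [← h0]; positivity
    · exact le_of_mul_le_mul_right h3 h0
  refine h4.trans ?_
  gcongr
  linarith

end SigalSoffer

/-! ### The propagation estimate in the original time -/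

theorem mainTheorem3
    (ħ₀ : ℝ) (hħ₀ : 0 < ħ₀)
    (K : ℕ → (ℝ → ℂ) → ℝ)
    (a b : ℝ) (hab : a ≤ b)
    (θ : ℝ) (hθ : 0 < θ)
    (gI : ℝ → ℂ) (hgI : ContDiff ℝ ∞ gI) (hgI_supp : tsupport gI ⊆ Set.Icc a b)
    (α : ℝ) (hα : 0 ≤ α) :
    ∃ ħ₁ : ℝ, 0 < ħ₁ ∧ ħ₁ ≤ ħ₀ ∧ ∃ C : ℝ,
      ∀ (E : Type*) [NormedAddCommGroup E] [InnerProductSpace ℂ E] [CompleteSpace E]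
        (H A : ℝ → E →ₗ.[ℂ] E),
        (∀ ħ ∈ Set.Ioc 0 ħ₀, IsSelfAdjoint (H ħ)) →
        (∀ ħ ∈ Set.Ioc 0 ħ₀, IsSelfAdjoint (A ħ)) →
        (∀ ħ ∈ Set.Ioc 0 ħ₀, ∀ ħ' ∈ Set.Ioc 0 ħ₀, (H ħ).domain = (H ħ').domain) →
        (∀ ħ ∈ Set.Ioc 0 ħ₀, ∀ ħ' ∈ Set.Ioc 0 ħ₀, (A ħ).domain = (A ħ').domain) →
        (∀ (k : ℕ) (g : ℝ → ℂ), ContDiff ℝ ∞ g → HasCompactSupport g →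
          ∀ ħ ∈ Set.Ioc 0 ħ₀, ∃ T : E →L[ℂ] E,
            SigalSoffer.IsAd (A ħ) (SigalSoffer.fc (H ħ) g) k T ∧ ‖T‖ ≤ K k g * ħ ^ k) →
        (∀ ħ ∈ Set.Ioc 0 ħ₀, SigalSoffer.MourreBound (H ħ) (A ħ) (Set.Icc a b) θ ħ) →
        ∀ ħ ∈ Set.Ioc 0 ħ₁, ∀ (t : ℝ) (f : E),
          ‖SigalSoffer.weight (A ħ) α (SigalSoffer.evol (H ħ) (t / ħ)
              (SigalSoffer.fc (H ħ) gI (SigalSoffer.weight (A ħ) α f)))‖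
            ≤ C * SigalSoffer.bracket (ħ * t) ^ (-α) * ‖f‖ := by
  have hg : SigalSoffer.IsSmoothOn a b gI :=
    ⟨hgI, fun x hx => image_eq_zero_of_notMem_tsupport fun h => hx (hgI_supp h)⟩
  obtain ⟨C, hC⟩ := SigalSoffer.exists_propagation_bound (K := K) (ħ₀ := ħ₀) hθ hħ₀.le hα hg
  -- No shrinking of the range of ħ is needed: every power of ħ has been compensated or bounded
  -- through ħ₀. The estimate is used at τ = ħt.
  refine ⟨ħ₀, hħ₀, le_rfl, C, fun E _ _ _ H A hH hA _ _ had hmourre ħ hħ t f => ?_⟩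
  have h := hC E (H ħ) (A ħ) ħ ⟨hH ħ hħ, hA ħ hħ, hħ.1, hħ.2,
    fun k g hg hs => had k g hg hs ħ hħ, hmourre ħ hħ⟩ (ħ * t) f
  have e : ħ * t / ħ ^ 2 = t / ħ := by
    have := hħ.1.ne'
    field_simp
  rwa [e] at h
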